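/- Let $\mathbb T^3=\mathbb R^3/\mathbb Z^3$ with Euclidean distance $|x|$ to the origin. Let $A>0$, $\alpha<2$, $\phi_{min}\le 0$, $\beta>0$, and let $\phi:\mathbb T^3\to\mathbb R$ be even, of class $C^2$ away from $0$, with $\int_{\mathbb T^3}\phi=0$ and, for all $x\neq0$, $$\phi(x)\ge\phi_{min},\qquad \phi(x)\le\frac{A}{|x|^{\alpha-1}},\qquad |\nabla\phi(x)|\le\frac{A}{|x|^{\alpha}},\qquad |\nabla^2\phi(x)|\le\frac{A}{|x|^{\alpha+1}} .$$ For $N\ge1$ consider on $\mathbb T^{3N}\times\mathbb R^{3N}$ the Newton system $\dot X_i=V_i$, $\dot V_i=-\frac1N\sum_{j\ne i}\nabla\phi(X_i-X_j)$, with flow $Z(t,Z_0)$; the energy $H_N(Z)=\sum_i\frac{|V_i|^2}2+\frac1{2N}\sum_{i\neq j}\phi(X_i-X_j)$; the Gibbs measure $d\mu_N=\mathcal B_N^{-1}e^{-\beta H_N(Z)}\,dZ$, where $\mathcal B_N=\int e^{-\beta H_N}\,dZ$; and the norm $\|Z\|_1=\frac1{2N}\sum_i(|X_i|+|V_i|)$.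 Let $\psi_N(Z_0,d\delta)$ be a probability distribution of shifts $\delta\in\mathbb T^{3N}\times\mathbb R^{3N}$ depending measurably on $Z_0$, and let $\tilde\mu_N$ be the law of $Z_0+\delta$ when $Z_0$ has law $\mu_N$ and $\delta$ has law $\psi_N(Z_0,\cdot)$ given $Z_0$. Assume that $\tilde\mu_N\le K_\beta\,\mu_N$ as measures, for a constant $K_\beta>0$. For $\delta_N>0$ set $$Q(t)=\int d\mu_N(Z_0)\int\psi_N(Z_0,d\delta)\,\ln\Bigl(1+\frac{\|Z(t,Z_0)-Z(t,Z_0+\delta)\|_1}{\delta_N}\Bigr)\in[0,\infty].$$ Then, for every $N\ge\frac{6^4}{(2-\alpha)^2}$, for $\mu_N$-almost every $Z_0$ there is exactly one global collision-free solution of the Newton system starting from $Z_0$. Moreover, for $\delta_N=N^{-\varepsilon}$ with any $\varepsilon\le1-\alpha/3$, for any exponent $a>2\alpha/3$ and all $t\ge0$, $$Q(t)\le\Bigl(1+(1+K_\beta)\,\frac{C\,c_\beta+C_a\,c_\beta^{\,a}}{2-\alpha}\Bigr)t+Q(0),\qquad c_\beta=e^{-\beta\phi_{min}},$$ where the constant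 $C>0$ depends only on $A$, and $C_a$ depends only on $A$, $\alpha$ and $a$, with $0<C_a\le\frac{C}{3a-2\alpha}$. In particular the bound is uniform in $N$. -/

import Mathlib

open MeasureTheory ProbabilityTheory
open scoped ENNReal

noncomputable section

namespace NParticle

/-- Euclidean space `ℝ³`. -/
abbrev E3 := EuclideanSpace ℝ (Fin 3)

/-- The flat torus `𝕋³ = ℝ³ / ℤ³`; its `volume` is Lebesgue measure, of total mass one. -/
abbrev T3 := Fin 3 → UnitAddCircle

/-- The projection `ℝ³ → 𝕋³`. -/
def proj (x : E3) : T3 := fun k => (x k : UnitAddCircle)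

/-- The Euclidean length `|x|` of a point of the torus, i.e. the Euclidean distance to `0`
(the norm on `UnitAddCircle` is the distance to the nearest integer). -/
def tnorm (x : T3) : ℝ := √(∑ k, ‖x k‖ ^ 2)

/-- The phase space `𝕋^{3N} × ℝ^{3N}`: positions and velocities of `N` particles. -/
abbrev Phase (N : ℕ) := (Fin N → T3) × (Fin N → E3)

instance instSigmaFiniteT3 : SigmaFinite (volume : Measure T3) := inferInstance

instance instBorelSpaceT3 : BorelSpace T3 := inferInstance

instance instSecondCountableT3 : SecondCountableTopology T3 := inferInstance

instance instSigmaFinitePos (N : ℕ) : SigmaFinite (volume : Measure (Fin N → T3)) :=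
  Measure.pi.sigmaFinite _

instance instSigmaFiniteVel (N : ℕ) : SigmaFinite (volume : Measure (Fin N → E3)) :=
  Measure.pi.sigmaFinite _

instance instSigmaFinitePhase (N : ℕ) : SigmaFinite (volume : Measure (Phase N)) :=
  Measure.prod.instSigmaFinite

instance instBorelSpacePos (N : ℕ) : BorelSpace (Fin N → T3) := Pi.borelSpace

instance instBorelSpacePhase (N : ℕ) : BorelSpace (Phase N) := Prod.borelSpace

instance instMeasurableAddPhase (N : ℕ) : MeasurableAdd₂ (Phase N) :=
  ContinuousAdd.measurableMul₂

/-- `‖Z‖₁ = (1 / 2N) ∑ᵢ (|Xᵢ| + |Vᵢ|)`. -/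
def norm1 {N : ℕ} (Z : Phase N) : ℝ :=
  1 / (2 * (N : ℝ)) * ∑ i, (tnorm (Z.1 i) + ‖Z.2 i‖)

/-- A potential on the torus seen as a periodic function on `ℝ³`. -/
def periodic (φ : T3 → ℝ) (x : E3) : ℝ := φ (proj x)

/-- The force kernel `K = -∇φ`, as a periodic vector field on `ℝ³`. -/
def force (φ : T3 → ℝ) (x : E3) : E3 := -gradient (periodic φ) x

/-- The standing assumptions on the interaction potential: `φ` is even, of class `C²` away from
the origin, has zero average, and satisfies the pointwise bounds with constants `φmin`, `A` and
exponent `α`. The value of `φ` at the origin plays no role. -/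
structure Admissible (φ : T3 → ℝ) (φmin A α : ℝ) : Prop where
  even : ∀ x, φ (-x) = φ x
  contDiff : ContDiffOn ℝ 2 (periodic φ) {x | proj x ≠ 0}
  average : ∫ x, φ x = 0
  lower : ∀ x, x ≠ 0 → φmin ≤ φ x
  upper : ∀ x, x ≠ 0 → φ x ≤ A / tnorm x ^ (α - 1)
  grad : ∀ x : E3, proj x ≠ 0 → ‖gradient (periodic φ) x‖ ≤ A / tnorm (proj x) ^ α
  hess : ∀ x : E3, proj x ≠ 0 →
    ‖fderiv ℝ (gradient (periodic φ)) x‖ ≤ A / tnorm (proj x) ^ (α + 1)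

/-- `γ` is a global solution without collisions of the Newton system
`Ẋᵢ = Vᵢ`, `V̇ᵢ = (1/N) ∑_{j ≠ i} K(Xᵢ - Xⱼ)`. The positions are differentiated through a lift
`x` of the torus-valued paths to `ℝ³`. There is no self-interaction (`K(0) = 0` for even `φ`). -/
def IsTrajectory {N : ℕ} (φ : T3 → ℝ) (γ : ℝ → Phase N) : Prop :=
  ∃ x : ℝ → Fin N → E3,
    (∀ t i, (γ t).1 i = proj (x t i)) ∧
    (∀ t i j, i ≠ j → (γ t).1 i ≠ (γ t).1 j) ∧
    (∀ t i, HasDerivAt (fun s => x s i) ((γ t).2 i) t) ∧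
    (∀ t i, HasDerivAt (fun s => (γ s).2 i)
      ((1 / (N : ℝ)) • ∑ j ∈ Finset.univ.erase i, force φ (x t i - x t j)) t)

open Classical in
/-- The flow `Z(t, Z₀)` of the Newton system: the trajectory issued from `Z₀`, if there is a
global one (constant otherwise). -/
def flow {N : ℕ} (φ : T3 → ℝ) (t : ℝ) (Z₀ : Phase N) : Phase N :=
  if h : ∃ γ : ℝ → Phase N, IsTrajectory φ γ ∧ γ 0 = Z₀ then h.choose t else Z₀

/-- The energy `H_N[Z] = ∑ᵢ |Vᵢ|²/2 + (1/2N) ∑_{i ≠ j} φ(Xᵢ - Xⱼ)`. -/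
def energy {N : ℕ} (φ : T3 → ℝ) (Z : Phase N) : ℝ :=
  ∑ i, ‖Z.2 i‖ ^ 2 / 2 +
    1 / (2 * (N : ℝ)) * ∑ i, ∑ j ∈ Finset.univ.erase i, φ (Z.1 i - Z.1 j)

/-- The normalization constant `B_N(β) = ∫ exp(-β H_N)`. -/
def partitionFn (N : ℕ) (φ : T3 → ℝ) (β : ℝ) : ℝ≥0∞ :=
  ∫⁻ Z : Phase N, ENNReal.ofReal (Real.exp (-β * energy φ Z))

/-- The Gibbs measure `μ_N = B_N⁻¹ exp(-β H_N) dZ`. -/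
def gibbs (N : ℕ) (φ : T3 → ℝ) (β : ℝ) : Measure (Phase N) :=
  (partitionFn N φ β)⁻¹ •
    (volume : Measure (Phase N)).withDensity
      (fun Z => ENNReal.ofReal (Real.exp (-β * energy φ Z)))

instance instSFiniteGibbs (N : ℕ) (φ : T3 → ℝ) (β : ℝ) : SFinite (gibbs N φ β) := by
  unfold gibbs
  infer_instance

/-- The image measure of `μ_N` by the shift distribution `ψ`, i.e. the law of `Z₀ + δ` when `Z₀`
has law `μ_N` and, given `Z₀`, the shift `δ` has law `ψ(Z₀, ·)`. -/
def shifted {N : ℕ} (φ : T3 → ℝ) (β : ℝ) (ψ : Kernel (Phase N) (Phase N)) :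
    Measure (Phase N) :=
  ((gibbs N φ β) ⊗ₘ ψ).map (fun p => p.1 + p.2)

/-- `Q(t) = ∫ dμ_N(Z₀) ∫ ψ(Z₀, dδ) ln (1 + ‖Z(t,Z₀) - Z(t,Z₀+δ)‖₁ / δ_N)`, in `[0, ∞]`. -/
def Q {N : ℕ} (φ : T3 → ℝ) (β : ℝ) (ψ : Kernel (Phase N) (Phase N)) (δN t : ℝ) : ℝ≥0∞ :=
  ∫⁻ Z₀, ∫⁻ δ,
    ENNReal.ofReal (Real.log (1 + norm1 (flow φ t Z₀ - flow φ t (Z₀ + δ)) / δN))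
    ∂(ψ Z₀) ∂(gibbs N φ β)

end NParticle

end

open Set Filter Topology
open scoped NNReal

/-! Write `D(s)` for the `norm1` distance of two trajectories. The core is a differential inequality
`D' ≤ (1 + ρ(Z) + ρ(Z')) (D + δ)`, in which the rate is a sum of a function of one configuration and
the same function of the other (`KernelBound.separation_rate_le`). Logarithmic Grönwall bounds the
growth of `log (1 + D/δ)` by the time integral of the rate. The Gibbs measure does not increase
along the flow and the law of the shifted data is at most `K μ`, so averaging gives `Q(t) ≤ Q(0) + t
+ (1 + K) t E`, where `E` bounds the `μ`-mean of `ρ` (`Admissible.Q_le`). It remains to bound this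
mean uniformly in `N`.

The rate comes from a two-point bound of the force, with a Lipschitz weight `G` truncated at the
scale `r = N^(-1/3)` and a crude part `B` living on `|z| < 2r` (`Admissible.exists_kernelBound`).
The integral of `B` is of order `N^(-(1 - α/3))`, so dividing by `δ_N` is harmless exactly when `ε ≤
1 - α/3`. As `norm1` is an average over the particles, `G` enters through the maximum over `i` of
the mean of `G(Xᵢ - Xⱼ)` over `j`. With `κ ≥ sup G` this maximum is bounded through exponential
moments of `∑ⱼ G(Xᵢ - Xⱼ)/κ`. Given the other particles, one particle has a density at most `c = exp
(-β φmin)`, since the zero mean of `φ` and Jensen make the normalization at least one. The moments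
are then computed one particle at a time, and the outcome is of order `κ (log N + 1)/N + c ∫ G`,
hence `O(c/(2 - α))`.

For well-posedness, the force is replaced within distance `η` of the origin by a Lipschitz one. The
cut-off flow is a limit of symplectic Euler schemes, so it does not increase Lebesgue measure. While
particles stay `η`-separated it is the Newton flow and conserves energy, so it does not increase `μ`
either. Energy bounds the speeds, so coming from distance `η₀` to `η` costs a time integral of
inverse distances of order `log (η₀/η)`. That integral has a mean bounded independently of `η`,
because `1/|x|` is integrable in dimension three. Letting `η → 0` shows that collisions have
probability zero (`Admissible.ae_exists_safe`), and the cut-off curves glue into the unique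
trajectory. -/

namespace NParticle

/-! ### Geometry of the torus and integrals of powers of the distance -/

section Torus

lemma proj_add (x y : E3) : proj (x + y) = proj x + proj y := by
  ext k; simp [proj]

lemma proj_neg (x : E3) : proj (-x) = -proj x := by
  ext k; simp [proj]

lemma proj_sub (x y : E3) : proj (x - y) = proj x - proj y := by
  ext k; simp [proj]

lemma continuous_proj : Continuous proj := by
  unfold proj
  refine continuous_pi fun k => ?_
  exact (AddCircle.continuous_mk' 1).comp (by fun_prop)

lemma tnorm_nonneg (z : T3) : 0 ≤ tnorm z := Real.sqrt_nonneg _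

lemma tnorm_neg (z : T3) : tnorm (-z) = tnorm z := by
  simp [tnorm]

lemma tnorm_sub_comm (z w : T3) : tnorm (z - w) = tnorm (w - z) := by
  rw [← neg_sub, tnorm_neg]

lemma continuous_tnorm : Continuous tnorm := by
  unfold tnorm; fun_prop

lemma measurable_tnorm : Measurable tnorm := continuous_tnorm.measurable

lemma tnorm_proj_le (x : E3) : tnorm (proj x) ≤ ‖x‖ := by
  rw [EuclideanSpace.norm_eq, tnorm]
  refine Real.sqrt_le_sqrt (Finset.sum_le_sum fun k _ => ?_)
  have : ‖proj x k‖ ≤ ‖x k‖ := by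
    simpa [proj, UnitAddCircle.norm_eq] using round_le (x k) 0
  gcongr

/-- Subtracting the nearest integer from each coordinate gives a shortest lift. Properties of
`tnorm` are thereby reduced to those of the Euclidean norm. -/
lemma exists_lift (z : T3) : ∃ x : E3, proj x = z ∧ ‖x‖ = tnorm z := by
  have h : ∀ k, ∃ u : ℝ, (u : UnitAddCircle) = z k ∧ |u| = ‖z k‖ := by
    intro k
    obtain ⟨u, hu⟩ := QuotientAddGroup.mk_surjective (z k)
    refine ⟨u - round u, ?_, ?_⟩
    · rw [← hu, AddCircle.coe_sub]
      have : ((round u : ℝ) : UnitAddCircle) = 0 := by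
        rw [AddCircle.coe_eq_zero_iff]; exact ⟨round u, by simp⟩
      rw [this, sub_zero]
    · rw [← hu]; exact (UnitAddCircle.norm_eq).symm
  choose u hu hn using h
  refine ⟨WithLp.toLp 2 u, ?_, ?_⟩
  · ext k; simp [proj, hu]
  · rw [EuclideanSpace.norm_eq, tnorm]; simp [hn]

lemma proj_surjective : Function.Surjective proj := fun z =>
  (exists_lift z).imp fun _ h => h.1

lemma tnorm_add_le (z w : T3) : tnorm (z + w) ≤ tnorm z + tnorm w := by
  obtain ⟨x, rfl, hx⟩ := exists_lift z
  obtain ⟨y, rfl, hy⟩ := exists_lift w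
  rw [← proj_add, ← hx, ← hy]
  exact (tnorm_proj_le _).trans (norm_add_le _ _)

lemma tnorm_sub_le (z w : T3) : tnorm (z - w) ≤ tnorm z + tnorm w := by
  rw [sub_eq_add_neg, ← tnorm_neg w]; exact tnorm_add_le _ _

lemma tnorm_le_add_sub (z w : T3) : tnorm z ≤ tnorm w + tnorm (z - w) := by
  simpa using tnorm_add_le w (z - w)

lemma norm_le_tnorm (z : T3) : ‖z‖ ≤ tnorm z := by
  rw [pi_norm_le_iff_of_nonneg (tnorm_nonneg z)]
  intro k
  refine Real.le_sqrt_of_sq_le ?_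
  exact Finset.single_le_sum (f := fun k => ‖z k‖ ^ 2) (fun _ _ => by positivity)
    (Finset.mem_univ k)

lemma tnorm_le_two_mul_norm (z : T3) : tnorm z ≤ 2 * ‖z‖ := by
  unfold tnorm
  refine Real.sqrt_le_iff.2 ⟨by positivity, ?_⟩
  have : ∑ k, ‖z k‖ ^ 2 ≤ ∑ _k : Fin 3, ‖z‖ ^ 2 :=
    Finset.sum_le_sum fun k _ => by gcongr; exact norm_le_pi_norm z k
  simp at this
  nlinarith [sq_nonneg ‖z‖]

lemma tnorm_eq_zero {z : T3} : tnorm z = 0 ↔ z = 0 := by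
  constructor
  · intro h
    have := norm_le_tnorm z
    rw [h] at this
    simpa using this
  · rintro rfl; simp [tnorm]

lemma tnorm_pos {z : T3} : 0 < tnorm z ↔ z ≠ 0 := by
  rw [(tnorm_nonneg z).lt_iff_ne, ne_comm, Ne, tnorm_eq_zero]

lemma tnorm_sq_le (z : T3) : tnorm z ^ 2 ≤ 3 / 4 := by
  unfold tnorm
  rw [Real.sq_sqrt (by positivity)]
  have h : ∀ k, ‖z k‖ ^ 2 ≤ (1 / 2) ^ 2 := fun k => by
    have := AddCircle.norm_le_half_period (1 : ℝ) (x := z k) one_ne_zero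
    simp only [abs_one] at this
    gcongr
  have : ∑ k, ‖z k‖ ^ 2 ≤ ∑ _k : Fin 3, ((1 : ℝ) / 2) ^ 2 :=
    Finset.sum_le_sum fun k _ => h k
  norm_num at this ⊢
  linarith

lemma tnorm_lt_one (z : T3) : tnorm z < 1 := by
  have := tnorm_sq_le z
  nlinarith [tnorm_nonneg z]

/-- Shortest lifts of small displacements stay in a given ball. Together with continuity this
identifies neighbourhood filters, so continuity on the torus can be tested on lifts. -/
lemma isOpenMap_proj : IsOpenMap proj := by
  intro U hU
  rw [isOpen_iff_mem_nhds]
  rintro _ ⟨x, hx, rfl⟩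
  obtain ⟨r, hr, hb⟩ := Metric.isOpen_iff.1 hU x hx
  have : {z : T3 | tnorm (z - proj x) < r} ∈ 𝓝 (proj x) := by
    refine (isOpen_lt ?_ continuous_const).mem_nhds ?_
    · exact continuous_tnorm.comp (continuous_id.sub continuous_const)
    · simpa [tnorm_eq_zero.2 rfl] using hr
  refine mem_of_superset this fun z hz => ?_
  obtain ⟨y, hy, hn⟩ := exists_lift (z - proj x)
  refine ⟨x + y, hb ?_, ?_⟩
  · simpa [hn] using hz
  · rw [proj_add, hy]; abel

lemma map_proj_nhds (x : E3) : Filter.map proj (𝓝 x) = 𝓝 (proj x) :=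
  le_antisymm continuous_proj.continuousAt (isOpenMap_proj.nhds_le x)

/-- The Euclidean ball lies in the cube of side `2ρ`. -/
lemma volume_tnorm_lt_le (ρ : ℝ) :
    volume {z : T3 | tnorm z < ρ} ≤ ENNReal.ofReal (8 * ρ ^ 3) := by
  rcases le_or_gt ρ 0 with hρ | hρ
  · have : {z : T3 | tnorm z < ρ} = ∅ := by
      ext z; simpa using hρ.trans (tnorm_nonneg z)
    simp [this]
  have h1 : {z : T3 | tnorm z < ρ} ⊆ Set.pi univ fun _ => Metric.closedBall (0 : UnitAddCircle) ρ := by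
    intro z hz k _
    simp only [mem_ofPred_eq] at hz
    simpa using ((norm_le_pi_norm z k).trans (norm_le_tnorm z)).trans hz.le
  refine (measure_mono h1).trans ?_
  rw [volume_pi_pi]
  simp only [AddCircle.volume_closedBall, Finset.prod_const, Finset.card_univ, Fintype.card_fin]
  rw [show 8 * ρ ^ 3 = (2 * ρ) ^ 3 by ring, ENNReal.ofReal_pow (by positivity)]
  gcongr
  exact min_le_right _ _

lemma setLIntegral_tnorm_rpow_le_of_pos {q ρ : ℝ} (hq : 0 < q) (hq3 : q < 3) (hρ : 0 < ρ) :
    ∫⁻ z in {z : T3 | tnorm z < ρ}, ENNReal.ofReal (tnorm z ^ (-q)) ≤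
      ENNReal.ofReal (24 / (3 - q) * ρ ^ (3 - q)) := by
  have hS : MeasurableSet {z : T3 | tnorm z < ρ} := measurableSet_lt measurable_tnorm measurable_const
  rw [lintegral_eq_lintegral_meas_lt]
  rotate_left
  · exact ae_of_all _ fun z => Real.rpow_nonneg (tnorm_nonneg z) _
  · exact (measurable_tnorm.pow_const _).aemeasurable
  -- Layer-cake threshold: below `t₀` the superlevel set is bounded by the whole ball, above it by
  -- the ball of radius `t ^ (-1/q)`. The second range is integrable at infinity because `q < 3`.
  set t₀ : ℝ := ρ ^ (-q) with ht₀
  have ht₀pos : 0 < t₀ := Real.rpow_pos_of_pos hρ _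
  have hunion : Ioi (0 : ℝ) = Ioc 0 t₀ ∪ Ioi t₀ := (Ioc_union_Ioi_eq_Ioi ht₀pos.le).symm
  have ha : -(3 / q) < -1 := by
    rw [neg_lt_neg_iff, one_lt_div hq]; exact hq3
  rw [hunion]
  refine (lintegral_union_le _ _ _).trans ?_
  have h1 : ∫⁻ t in Ioc 0 t₀, (volume.restrict {z : T3 | tnorm z < ρ}) {z | t < tnorm z ^ (-q)} ≤
      ENNReal.ofReal (8 * ρ ^ (3 - q)) := by
    calc _ ≤ ∫⁻ t in Ioc 0 t₀, ENNReal.ofReal (8 * ρ ^ 3) := by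
          refine lintegral_mono fun t => ?_
          refine (measure_mono (subset_univ _)).trans ?_
          rw [Measure.restrict_apply_univ]
          exact volume_tnorm_lt_le ρ
      _ = ENNReal.ofReal (8 * ρ ^ (3 - q)) := by
          rw [setLIntegral_const, Real.volume_Ioc, ← ENNReal.ofReal_mul (by positivity), sub_zero]
          congr 1
          rw [ht₀, mul_assoc, ← Real.rpow_natCast, ← Real.rpow_add hρ]
          norm_num [sub_eq_add_neg]
  have h2 : ∫⁻ t in Ioi t₀, (volume.restrict {z : T3 | tnorm z < ρ}) {z | t < tnorm z ^ (-q)} ≤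
      ENNReal.ofReal (8 * (q / (3 - q)) * ρ ^ (3 - q)) := by
    calc _ ≤ ∫⁻ t in Ioi t₀, ENNReal.ofReal (8 * t ^ (-(3 / q))) := by
          refine setLIntegral_mono' measurableSet_Ioi fun t ht => ?_
          have htpos : 0 < t := ht₀pos.trans ht
          refine (Measure.restrict_apply_le _ _).trans ?_
          refine (measure_mono (t := {z : T3 | tnorm z < t ^ (-(1 / q))}) fun z hz => ?_).trans
            ((volume_tnorm_lt_le _).trans (le_of_eq ?_))
          · simp only [mem_ofPred_eq] at hz ⊢
            -- At the origin the real power takes the default value `0 ^ (-q) = 0`, which is not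
            -- above a positive level.
            rcases (tnorm_nonneg z).eq_or_lt with h0 | h0
            · rw [← h0, Real.zero_rpow (by linarith)] at hz; linarith
            · have := Real.rpow_lt_rpow_of_neg htpos hz (z := -(1 / q)) (by
                have := one_div_pos.2 hq; linarith)
              rwa [← Real.rpow_mul h0.le, show -q * -(1 / q) = 1 by field_simp, Real.rpow_one] at this
          · rw [← Real.rpow_natCast, ← Real.rpow_mul htpos.le]
            congr 3
            push_cast; ring
      _ = ENNReal.ofReal (8 * (q / (3 - q)) * ρ ^ (3 - q)) := by
          rw [← ofReal_integral_eq_lintegral_ofReal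
            ((integrableOn_Ioi_rpow_of_lt ha ht₀pos).const_mul 8)]
          · rw [integral_const_mul, integral_Ioi_rpow_of_lt ha ht₀pos, ht₀, ← Real.rpow_mul hρ.le]
            have e : -q * (-(3 / q) + 1) = 3 - q := by field_simp; ring
            have e2 : -(3 / q) + 1 = -((3 - q) / q) := by field_simp; ring
            rw [e, e2, neg_div_neg_eq]
            congr 1
            have : 3 - q ≠ 0 := by linarith
            field_simp
          · filter_upwards [ae_restrict_mem measurableSet_Ioi] with t ht
            have htpos : 0 < t := ht₀pos.trans ht
            positivity
  refine (add_le_add h1 h2).trans (le_of_eq ?_)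
  have : 0 < 3 - q := by linarith
  rw [← ENNReal.ofReal_add (by positivity) (by positivity)]
  congr 1
  field_simp
  ring

/-- Singular integrals on small balls of the torus; the constant covers `-1 < q`. -/
lemma setLIntegral_tnorm_rpow_le {q ρ : ℝ} (hq : -1 < q) (hq3 : q < 3) (hρ : 0 < ρ) :
    ∫⁻ z in {z : T3 | tnorm z < ρ}, ENNReal.ofReal (tnorm z ^ (-q)) ≤
      ENNReal.ofReal (32 / (3 - q) * ρ ^ (3 - q)) := by
  have h3 : 0 < 3 - q := by linarith
  rcases lt_or_ge 0 q with h | h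
  · refine (setLIntegral_tnorm_rpow_le_of_pos h hq3 hρ).trans (ENNReal.ofReal_le_ofReal ?_)
    gcongr
    norm_num
  · have hS : MeasurableSet {z : T3 | tnorm z < ρ} :=
      measurableSet_lt measurable_tnorm measurable_const
    calc _ ≤ ∫⁻ z in {z : T3 | tnorm z < ρ}, ENNReal.ofReal (ρ ^ (-q)) := by
          refine setLIntegral_mono' hS fun z hz => ENNReal.ofReal_le_ofReal ?_
          exact Real.rpow_le_rpow (tnorm_nonneg z) (le_of_lt hz) (by linarith)
      _ ≤ ENNReal.ofReal (ρ ^ (-q)) * ENNReal.ofReal (8 * ρ ^ 3) := by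
          rw [setLIntegral_const]; gcongr; exact volume_tnorm_lt_le ρ
      _ ≤ _ := by
          rw [← ENNReal.ofReal_mul (by positivity)]
          refine ENNReal.ofReal_le_ofReal ?_
          have : ρ ^ (-q) * (8 * ρ ^ 3) = 8 * ρ ^ (3 - q) := by
            rw [mul_left_comm, ← Real.rpow_natCast, ← Real.rpow_add hρ]
            norm_num; ring_nf
          rw [this]
          gcongr
          -- `q > -1` gives `3 - q < 4`, hence `8 ≤ 32 / (3 - q)`.
          rw [le_div_iff₀ h3]; linarith

lemma lintegral_tnorm_rpow_le {q : ℝ} (hq : -1 < q) (hq3 : q < 3) :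
    ∫⁻ z : T3, ENNReal.ofReal (tnorm z ^ (-q)) ≤ ENNReal.ofReal (32 / (3 - q)) := by
  have := setLIntegral_tnorm_rpow_le hq hq3 one_pos
  have hu : {z : T3 | tnorm z < 1} = univ := by ext z; simp [tnorm_lt_one]
  simpa [hu] using this

end Torus

end NParticle

namespace NParticle

/-! ### Newton's equation with a bounded Lipschitz force, and the symplectic Euler scheme -/

section SecondOrder

variable {E : Type*} [NormedAddCommGroup E]

/-- The vector field of the second order equation `x'' = F x` on position-velocity pairs. -/
def newtonField (F : E → E) (z : E × E) : E × E := (z.2, F z.1)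

lemma lipschitzWith_newtonField {F : E → E} {L : ℝ≥0} (hF : LipschitzWith L F) :
    LipschitzWith (max 1 L) (newtonField F) := by
  have h := LipschitzWith.prod_snd (α := E) (β := E) |>.prodMk
    (hF.comp (LipschitzWith.prod_fst (α := E) (β := E)))
  rw [mul_one] at h
  exact h

variable [NormedSpace ℝ E]

lemma hasDerivAt_fst {z : ℝ → E × E} {z' : E × E} {t : ℝ} (h : HasDerivAt z z' t) :
    HasDerivAt (fun t => (z t).1) z'.1 t :=
  (ContinuousLinearMap.fst ℝ E E).hasFDerivAt.comp_hasDerivAt t h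

lemma hasDerivAt_snd {z : ℝ → E × E} {z' : E × E} {t : ℝ} (h : HasDerivAt z z' t) :
    HasDerivAt (fun t => (z t).2) z'.2 t :=
  (ContinuousLinearMap.snd ℝ E E).hasFDerivAt.comp_hasDerivAt t h

lemma newton_unique {F : E → E} {L : ℝ≥0} (hF : LipschitzWith L F) {z w : ℝ → E × E} {a b : ℝ}
    (h0 : (0 : ℝ) ∈ Ioo a b) (hz : ∀ t ∈ Ioo a b, HasDerivAt z (newtonField F (z t)) t)
    (hw : ∀ t ∈ Ioo a b, HasDerivAt w (newtonField F (w t)) t) (heq : z 0 = w 0) :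
    EqOn z w (Ioo a b) :=
  ODE_solution_unique_of_mem_Ioo (v := fun _ => newtonField F) (s := fun _ => univ)
    (fun _ _ => (lipschitzWith_newtonField hF).lipschitzOnWith) h0
    (fun t ht => ⟨hz t ht, trivial⟩) (fun t ht => ⟨hw t ht, trivial⟩) heq

/-- The field is unbounded in the velocity, so Picard–Lindelöf on one ball would limit the time. In
the variables `x` and `(v - v₀)/μ` its size on a ball of radius `a` is at most `a/T`, so a single
application covers `[-T, T]`. -/
lemma newton_exists_Ioo [CompleteSpace E] {F : E → E} {L : ℝ≥0} (hF : LipschitzWith L F) {M : ℝ}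
    (hM : ∀ x, ‖F x‖ ≤ M) (z₀ : E × E) {T : ℝ} (hT : 0 < T) :
    ∃ z : ℝ → E × E, z 0 = z₀ ∧ ∀ t ∈ Ioo (-T) T, HasDerivAt z (newtonField F (z t)) t := by
  obtain ⟨x₀, v₀⟩ := z₀
  have hM0 : 0 ≤ M := (norm_nonneg _).trans (hM 0)
  set μ : ℝ := 1 / (2 * T) with hμ
  have hμpos : 0 < μ := by positivity
  let f : E × E → E × E := fun p => (v₀ + μ • p.2, μ⁻¹ • F p.1)
  have hf : LipschitzWith (max (‖μ‖₊ * 1) (‖μ⁻¹‖₊ * (L * 1))) f := by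
    refine LipschitzWith.prodMk ?_ ?_
    · have := ((lipschitzWith_smul μ).comp (LipschitzWith.prod_snd (α := E) (β := E)))
      exact LipschitzWith.of_dist_le_mul fun p q => by
        simpa [dist_add_left] using this.dist_le_mul p q
    · exact (lipschitzWith_smul μ⁻¹).comp (hF.comp (LipschitzWith.prod_fst (α := E) (β := E)))
  -- With `μ = 1/(2T)`, the first entry gives `‖v₀‖ + μ a ≤ a/T` and the second gives `μ⁻¹ M ≤ a/T`.
  let a : ℝ := max (2 * T * ‖v₀‖) (2 * T ^ 2 * M)
  have ha : 0 ≤ a := le_max_of_le_left (by positivity)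
  let t₀ : Icc (-T) T := ⟨0, by constructor <;> linarith⟩
  have hPL : IsPicardLindelof (fun _ => f) t₀ ((x₀, 0) : E × E) ⟨a, ha⟩ 0 ⟨a / T, by positivity⟩
      (max (‖μ‖₊ * 1) (‖μ⁻¹‖₊ * (L * 1))) := by
    refine IsPicardLindelof.of_time_independent ?_ hf.lipschitzOnWith ?_
    · rintro ⟨y, w⟩ hp
      have hw : ‖w‖ ≤ a := by
        have := (norm_snd_le ((y, w) - ((x₀, 0) : E × E))).trans (mem_closedBall_iff_norm.1 hp)
        rw [Prod.snd_sub, sub_zero] at this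
        exact this
      change ‖(v₀ + μ • w, μ⁻¹ • F y)‖ ≤ a / T
      rw [Prod.norm_def, max_le_iff]
      constructor
      · have h1 : 2 * T * ‖v₀‖ ≤ a := le_max_left _ _
        calc ‖v₀ + μ • w‖ ≤ ‖v₀‖ + μ * ‖w‖ := by
              refine (norm_add_le _ _).trans ?_
              rw [norm_smul, Real.norm_of_nonneg hμpos.le]
          _ ≤ a / (2 * T) + μ * a := by
              gcongr
              rw [le_div_iff₀ (by positivity)]; linarith
          _ = a / T := by rw [hμ]; field_simp; ring
      · have h1 : 2 * T ^ 2 * M ≤ a := le_max_right _ _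
        rw [norm_smul, Real.norm_of_nonneg (by positivity), hμ, one_div, inv_inv,
          le_div_iff₀ hT]
        calc 2 * T * ‖F y‖ * T ≤ 2 * T * M * T := by gcongr; exact hM y
          _ ≤ a := by linarith
    · have hm : max (T - (t₀ : ℝ)) ((t₀ : ℝ) - -T) = T := by simp [t₀]
      rw [hm]
      rw [NNReal.coe_zero, sub_zero]
      exact (div_mul_cancel₀ a hT.ne').le
  obtain ⟨α, hα0, hα⟩ := hPL.exists_eq_forall_mem_Icc_hasDerivWithinAt₀
  refine ⟨fun t => ((α t).1, v₀ + μ • (α t).2), ?_, fun t ht => ?_⟩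
  · have : α 0 = (x₀, 0) := hα0
    simp [this]
  · have h := (hα t (Ioo_subset_Icc_self ht)).hasDerivAt (Icc_mem_nhds ht.1 ht.2)
    have h1 : HasDerivAt (fun t => (α t).1) (v₀ + μ • (α t).2) t :=
      hasDerivAt_fst h
    have h2 : HasDerivAt (fun t => (α t).2) (μ⁻¹ • F (α t).1) t :=
      hasDerivAt_snd h
    have h3 := (h2.const_smul μ).const_add v₀
    rw [smul_inv_smul₀ hμpos.ne'] at h3
    exact h1.prodMk h3

lemma newton_exists [CompleteSpace E] {F : E → E} {L : ℝ≥0} (hF : LipschitzWith L F) {M : ℝ}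
    (hM : ∀ x, ‖F x‖ ≤ M) (z₀ : E × E) :
    ∃ z : ℝ → E × E, z 0 = z₀ ∧ ∀ t, HasDerivAt z (newtonField F (z t)) t := by
  have h : ∀ n : ℕ, ∃ z : ℝ → E × E, z 0 = z₀ ∧
      ∀ t ∈ Ioo (-((n : ℝ) + 1)) (n + 1), HasDerivAt z (newtonField F (z t)) t :=
    fun n => newton_exists_Ioo hF hM z₀ (by positivity)
  choose z hz0 hz using h
  have hagree : ∀ n m : ℕ, n ≤ m → EqOn (z n) (z m) (Ioo (-((n : ℝ) + 1)) (n + 1)) := by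
    intro n m hnm
    have hnm' : (n : ℝ) ≤ m := by exact_mod_cast hnm
    refine newton_unique hF ⟨by linarith [n.cast_nonneg (α := ℝ)], by positivity⟩ (hz n) ?_
      (by rw [hz0, hz0])
    exact fun t ht => hz m t ⟨by linarith [ht.1], by linarith [ht.2]⟩
  refine ⟨fun t => z ⌈|t|⌉₊ t, hz0 _, fun t => ?_⟩
  -- The extra unit makes one local solution represent the glued curve on a whole neighbourhood of
  -- `t`.
  set n := ⌈|t|⌉₊ + 1 with hn
  have hlt : ∀ s : ℝ, s ∈ Ioo (-((⌈|s|⌉₊ : ℝ) + 1)) (⌈|s|⌉₊ + 1) := by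
    intro s
    have h1 := Nat.le_ceil |s|
    constructor
    · linarith [neg_abs_le s]
    · linarith [le_abs_self s]
  have heq : (fun s => z ⌈|s|⌉₊ s) =ᶠ[𝓝 t] z n := by
    have : ∀ᶠ s in 𝓝 t, |s| < |t| + 1 :=
      (continuous_abs.tendsto t).eventually_lt_const (by linarith)
    filter_upwards [this] with s hs
    refine hagree _ _ ?_ (hlt s)
    rw [hn, Nat.ceil_le]
    push_cast
    linarith [Nat.le_ceil |t|]
  have hval : z ⌈|t|⌉₊ t = z n t := heq.self_of_nhds
  change HasDerivAt _ (newtonField F (z ⌈|t|⌉₊ t)) t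
  rw [hval]
  refine (hz n t ?_).congr_of_eventuallyEq heq
  have := hlt t
  rw [hn]; push_cast
  constructor <;> linarith [this.1, this.2]

/-- One step of the symplectic Euler scheme. -/
def eulerStep (F : E → E) (h : ℝ) (z : E × E) : E × E :=
  (z.1 + h • z.2, z.2 + h • F (z.1 + h • z.2))

/-- Stability of the scheme: a step expands by `1 + O(|h|)`, so all steps up to a fixed time expand
by a bounded factor. -/
lemma dist_eulerStep_le {F : E → E} {L : ℝ≥0} (hF : LipschitzWith L F) {h : ℝ} (hh : |h| ≤ 1)
    (z w : E × E) :
    dist (eulerStep F h z) (eulerStep F h w) ≤ (1 + |h| * (1 + 2 * L)) * dist z w := by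
  have h1 : dist z.1 w.1 ≤ dist z w := le_max_left _ _
  have h2 : dist z.2 w.2 ≤ dist z w := le_max_right _ _
  have hx : dist (z.1 + h • z.2) (w.1 + h • w.2) ≤ (1 + |h|) * dist z w := by
    refine (dist_add_add_le _ _ _ _).trans ?_
    rw [dist_smul₀, Real.norm_eq_abs]
    nlinarith [abs_nonneg h]
  have hd : 0 ≤ dist z w := dist_nonneg
  rw [Prod.dist_eq, max_le_iff]
  constructor
  · refine hx.trans ?_
    have : 0 ≤ |h| * (2 * L) * dist z w := by positivity
    nlinarith
  · refine (dist_add_add_le _ _ _ _).trans ?_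
    rw [dist_smul₀, Real.norm_eq_abs]
    have h3 := hF.dist_le_mul (z.1 + h • z.2) (w.1 + h • w.2)
    have h4 : (L : ℝ) * dist (z.1 + h • z.2) (w.1 + h • w.2) ≤ L * (2 * dist z w) := by
      gcongr
      refine hx.trans ?_
      gcongr
      linarith
    calc _ ≤ dist z w + |h| * (L * (2 * dist z w)) := by
          gcongr
          exact h3.trans h4
      _ ≤ _ := by
          have : 0 ≤ |h| * dist z w := by positivity
          nlinarith

lemma norm_sub_sub_smul_le {f f' : ℝ → E} (hf : ∀ t, HasDerivAt f (f' t) t) {s h C : ℝ} (w : E)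
    (hC : ∀ u ∈ uIcc s (s + h), ‖f' u - w‖ ≤ C) : ‖f (s + h) - f s - h • w‖ ≤ C * |h| := by
  have := (convex_uIcc s (s + h)).norm_image_sub_le_of_norm_hasDerivWithin_le
    (f := fun u => f u - u • w) (f' := fun u => f' u - w)
    (fun u _ => by
      have := (hf u).sub ((hasDerivAt_id u).smul_const w)
      rw [one_smul] at this
      exact this.hasDerivWithinAt) hC left_mem_uIcc right_mem_uIcc
  have e : f (s + h) - (s + h) • w - (f s - s • w) = f (s + h) - f s - h • w := by
    rw [add_smul]; abel
  rw [e] at this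
  simpa using this

/-- Consistency of the scheme: the velocity moves by at most `M|h|` and the position by at most
`V|h|` during a step, so freezing them costs `O(h²)`. -/
lemma dist_eulerStep_solution_le {F : E → E} {L : ℝ≥0} (hF : LipschitzWith L F) {M : ℝ}
    (hM : ∀ x, ‖F x‖ ≤ M) {z : ℝ → E × E} (hz : ∀ t, HasDerivAt z (newtonField F (z t)) t)
    {s h V : ℝ} (hV : ∀ u ∈ uIcc s (s + h), ‖(z u).2‖ ≤ V) :
    dist (eulerStep F h (z s)) (z (s + h)) ≤ (M + 2 * L * V) * h ^ 2 := by
  have hx : ∀ t, HasDerivAt (fun t => (z t).1) (z t).2 t := fun t =>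
    hasDerivAt_fst (hz t)
  have hv : ∀ t, HasDerivAt (fun t => (z t).2) (F (z t).1) t := fun t =>
    hasDerivAt_snd (hz t)
  have hM0 : 0 ≤ M := (norm_nonneg _).trans (hM 0)
  have hV0 : 0 ≤ V := (norm_nonneg _).trans (hV s left_mem_uIcc)
  have hu : ∀ u ∈ uIcc s (s + h), |u - s| ≤ |h| := fun u hu => by
    simpa using abs_sub_left_of_mem_uIcc hu
  have hsub : ∀ u ∈ uIcc s (s + h), uIcc s (s + (u - s)) ⊆ uIcc s (s + h) := fun u hu => by
    rw [add_sub_cancel]; exact uIcc_subset_uIcc_left hu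
  have hvd : ∀ u ∈ uIcc s (s + h), ‖(z u).2 - (z s).2‖ ≤ M * |h| := fun u huu => by
    have := norm_sub_sub_smul_le hv (s := s) (h := u - s) (C := M) 0
      (fun r _ => by simpa using hM _)
    rw [add_sub_cancel, smul_zero, sub_zero] at this
    exact this.trans (mul_le_mul_of_nonneg_left (hu u huu) (by assumption))
  have hxd : ∀ u ∈ uIcc s (s + h), ‖(z u).1 - (z s).1‖ ≤ V * |h| := fun u huu => by
    have := norm_sub_sub_smul_le hx (s := s) (h := u - s) (C := V) 0
      (fun r hr => by simpa using hV _ (hsub u huu hr))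
    rw [add_sub_cancel, smul_zero, sub_zero] at this
    exact this.trans (mul_le_mul_of_nonneg_left (hu u huu) (by assumption))
  have e1 := norm_sub_sub_smul_le hx (s := s) (h := h) (z s).2 hvd
  have e2 := norm_sub_sub_smul_le hv (s := s) (h := h) (C := L * (2 * V * |h|))
    (F ((z s).1 + h • (z s).2)) (fun u huu => by
      rw [← dist_eq_norm]
      refine (hF.dist_le_mul _ _).trans ?_
      gcongr
      rw [dist_eq_norm, ← sub_sub]
      refine (norm_sub_le _ _).trans ?_
      rw [norm_smul, Real.norm_eq_abs]
      have := hxd u huu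
      have h2 : |h| * ‖(z s).2‖ ≤ |h| * V := by gcongr; exact hV s left_mem_uIcc
      linarith)
  have hsq : |h| * |h| = h ^ 2 := by rw [abs_mul_abs_self, sq]
  rw [dist_comm, dist_eq_norm, Prod.norm_def, max_le_iff]
  constructor
  · have : (z (s + h) - eulerStep F h (z s)).1 = (z (s + h)).1 - (z s).1 - h • (z s).2 := by
      simp [eulerStep]; abel
    rw [this]
    refine e1.trans ?_
    have : 0 ≤ 2 * L * V * h ^ 2 := by positivity
    rw [mul_assoc, hsq]; linarith
  · have : (z (s + h) - eulerStep F h (z s)).2 =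
        (z (s + h)).2 - (z s).2 - h • F ((z s).1 + h • (z s).2) := by
      simp [eulerStep]; abel
    rw [this]
    refine e2.trans ?_
    have : 0 ≤ M * h ^ 2 := by positivity
    have e : L * (2 * V * |h|) * |h| = 2 * L * V * h ^ 2 := by rw [← hsq]; ring
    rw [e]; linarith

/-- The symplectic Euler scheme converges to the solution. -/
lemma tendsto_eulerStep_iterate {F : E → E} {L : ℝ≥0} (hF : LipschitzWith L F) {M : ℝ}
    (hM : ∀ x, ‖F x‖ ≤ M) {z : ℝ → E × E} (hz : ∀ t, HasDerivAt z (newtonField F (z t)) t)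
    (t : ℝ) :
    Tendsto (fun m : ℕ => (eulerStep F (t / (m + 1)))^[m + 1] (z 0)) atTop (𝓝 (z t)) := by
  have hv : ∀ t, HasDerivAt (fun t => (z t).2) (F (z t).1) t := fun t =>
    hasDerivAt_snd (hz t)
  have hM0 : 0 ≤ M := (norm_nonneg _).trans (hM 0)
  set V := ‖(z 0).2‖ + M * |t| with hVdef
  have hV0 : 0 ≤ V := by positivity
  have hV : ∀ u ∈ uIcc 0 t, ‖(z u).2‖ ≤ V := fun u hu => by
    have := norm_sub_sub_smul_le hv (s := 0) (h := u) (C := M) 0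
      (fun r _ => by simpa using hM _)
    rw [zero_add, smul_zero, sub_zero] at this
    have h2 : |u| ≤ |t| := by simpa using abs_sub_left_of_mem_uIcc hu
    have h3 : M * |u| ≤ M * |t| := by gcongr
    have := norm_le_norm_add_norm_sub' (z u).2 (z 0).2
    rw [hVdef]; linarith
  set C := M + 2 * L * V with hC
  have hC0 : 0 ≤ C := by positivity
  set c : ℝ := 1 + 2 * L with hc
  have hc0 : 0 ≤ c := by positivity
  have key : ∀ m : ℕ, |t| ≤ m + 1 → dist ((eulerStep F (t / (m + 1)))^[m + 1] (z 0)) (z t) ≤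
      C * t ^ 2 * Real.exp (c * |t|) / (m + 1) := by
    intro m hm
    set h := t / (m + 1 : ℝ) with hh
    have hm1 : (0 : ℝ) < m + 1 := by positivity
    have habs : |h| = |t| / (m + 1) := by rw [hh, abs_div, abs_of_pos hm1]
    have hh1 : |h| ≤ 1 := by rw [habs, div_le_one hm1]; exact hm
    -- At most `k` local errors, each amplified by no more than `k` steps. With `m + 1` steps of
    -- size `t/(m + 1)` the total is `O(1/(m + 1))`.
    have ind : ∀ k : ℕ, k ≤ m + 1 → dist ((eulerStep F h)^[k] (z 0)) (z (k * h)) ≤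
        k * (C * h ^ 2) * Real.exp (c * |h|) ^ k := by
      intro k
      induction k with
      | zero => simp
      | succ k ih =>
        intro hk
        have ih := ih (by omega)
        rw [Function.iterate_succ_apply']
        have hmem : ∀ j : ℕ, j ≤ m + 1 → (j : ℝ) * h ∈ uIcc 0 t := fun j hj => by
          have hj' : (j : ℝ) ≤ m + 1 := by exact_mod_cast hj
          have hr : (j : ℝ) * h = (j / (m + 1 : ℝ)) * t := by rw [hh]; ring
          rw [hr]
          have h0 : 0 ≤ (j / (m + 1 : ℝ)) := by positivity
          have h1 : (j / (m + 1 : ℝ)) ≤ 1 := by rw [div_le_one hm1]; exact hj'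
          rw [mem_uIcc]
          rcases le_total 0 t with ht | ht
          · left; constructor <;> nlinarith
          · right; constructor <;> nlinarith
        have e1 : dist (eulerStep F h (z (k * h))) (z ((k + 1 : ℕ) * h)) ≤ C * h ^ 2 := by
          have e : ((k + 1 : ℕ) : ℝ) * h = k * h + h := by push_cast; ring
          rw [e]
          refine dist_eulerStep_solution_le hF hM hz fun u hu => hV u ?_
          rw [← e] at hu
          exact uIcc_subset_uIcc (hmem k (by omega)) (hmem (k + 1) hk) hu
        have e2 := dist_eulerStep_le hF hh1 ((eulerStep F h)^[k] (z 0)) (z (k * h))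
        have e3 : 1 + |h| * (1 + 2 * L) ≤ Real.exp (c * |h|) := by
          have := Real.add_one_le_exp (c * |h|)
          rw [hc] at this ⊢; linarith
        have e4 : 1 ≤ Real.exp (c * |h|) := Real.one_le_exp (by positivity)
        calc _ ≤ Real.exp (c * |h|) * (k * (C * h ^ 2) * Real.exp (c * |h|) ^ k) + C * h ^ 2 := by
              refine (dist_triangle _ _ _).trans (add_le_add ?_ e1)
              refine e2.trans ?_
              gcongr
          _ ≤ k * (C * h ^ 2) * Real.exp (c * |h|) ^ (k + 1) +
                C * h ^ 2 * Real.exp (c * |h|) ^ (k + 1) := by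
              have : C * h ^ 2 * 1 ≤ C * h ^ 2 * Real.exp (c * |h|) ^ (k + 1) := by
                gcongr; exact one_le_pow₀ e4
              have e : Real.exp (c * |h|) * (k * (C * h ^ 2) * Real.exp (c * |h|) ^ k) =
                k * (C * h ^ 2) * Real.exp (c * |h|) ^ (k + 1) := by ring
              rw [e]; linarith
          _ = _ := by push_cast; ring
    have := ind (m + 1) le_rfl
    have ht : ((m + 1 : ℕ) : ℝ) * h = t := by rw [hh]; push_cast; field_simp
    rw [ht] at this
    refine this.trans (le_of_eq ?_)
    rw [← Real.exp_nat_mul]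
    have e5 : ((m + 1 : ℕ) : ℝ) * (c * |h|) = c * |t| := by
      rw [habs]; push_cast; field_simp
    rw [e5, hh]; push_cast; field_simp
  rw [tendsto_iff_dist_tendsto_zero]
  refine squeeze_zero' (Eventually.of_forall fun _ => dist_nonneg) ?_
    (g := fun m : ℕ => C * t ^ 2 * Real.exp (c * |t|) / (m + 1)) ?_
  · filter_upwards [eventually_ge_atTop ⌈|t|⌉₊] with m hm
    refine key m ?_
    have := Nat.ceil_le.1 hm
    linarith
  · exact (tendsto_const_div_atTop_nhds_zero_nat (C * t ^ 2 * Real.exp (c * |t|)) |>.comp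
      (tendsto_add_atTop_nat 1)).congr (fun m => by simp)

end SecondOrder

/-! ### Measurable flow of a Lipschitz force on the torus, not increasing Lebesgue measure -/

section TorusFlow

variable {N : ℕ}

/-- The projection `ℝ^{3N} → 𝕋^{3N}`. -/
def projN (x : Fin N → E3) : Fin N → T3 := fun i => proj (x i)

/-- The projection `ℝ^{3N} × ℝ^{3N} → 𝕋^{3N} × ℝ^{3N}`. -/
def projZ (z : (Fin N → E3) × (Fin N → E3)) : Phase N := (projN z.1, z.2)

lemma projN_add (x y : Fin N → E3) : projN (x + y) = projN x + projN y := by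
  ext i : 1; exact proj_add _ _

lemma dist_proj_le (x y : E3) : dist (proj x) (proj y) ≤ dist x y := by
  rw [dist_eq_norm, dist_eq_norm, ← proj_sub]
  exact (norm_le_tnorm _).trans (tnorm_proj_le _)

lemma lipschitzWith_projN : LipschitzWith 1 (projN (N := N)) :=
  LipschitzWith.of_dist_le_mul fun x y => by
    rw [NNReal.coe_one, one_mul, dist_pi_le_iff dist_nonneg]
    exact fun i => (dist_proj_le _ _).trans (dist_le_pi_dist x y i)

lemma continuous_projN : Continuous (projN (N := N)) := lipschitzWith_projN.continuous

lemma continuous_projZ : Continuous (projZ (N := N)) :=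
  (continuous_projN.comp continuous_fst).prodMk continuous_snd

lemma projZ_surjective : Function.Surjective (projZ (N := N)) := by
  rintro ⟨X, V⟩
  choose x hx using fun i => proj_surjective (X i)
  exact ⟨(x, V), by ext1 <;> [exact funext hx; rfl]⟩

/-- One step of the symplectic Euler scheme on the phase space of the torus. -/
def torusStep (F : (Fin N → T3) → (Fin N → E3)) (h : ℝ) (Z : Phase N) : Phase N :=
  (Z.1 + projN (h • Z.2), Z.2 + h • F (Z.1 + projN (h • Z.2)))

variable {F : (Fin N → T3) → (Fin N → E3)}

lemma semiconj_projZ (h : ℝ) :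
    Function.Semiconj projZ (eulerStep (F ∘ projN) h) (torusStep F h) := by
  intro z
  simp only [projZ, eulerStep, torusStep, Function.comp, projN_add]

lemma continuous_torusStep_iterate (hF : Continuous F) (k : ℕ) :
    Continuous fun p : ℝ × Phase N => (torusStep F p.1)^[k] p.2 := by
  induction k with
  | zero => exact continuous_snd
  | succ k ih =>
    simp only [Function.iterate_succ_apply']
    have h1 : Continuous fun p : ℝ × Phase N => ((torusStep F p.1)^[k] p.2).1 +
        projN (p.1 • ((torusStep F p.1)^[k] p.2).2) :=
      (continuous_fst.comp ih).add (continuous_projN.comp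
        (continuous_fst.smul (continuous_snd.comp ih)))
    exact h1.prodMk ((continuous_snd.comp ih).add (continuous_fst.smul (hF.comp h1)))

/-- The step composes two shears: positions translated by a function of the velocities, then
velocities translated by a function of the positions. Hence any continuous force will do, whether or
not it is a gradient. -/
lemma measurePreserving_torusStep (hF : Continuous F) (h : ℝ) :
    MeasurePreserving (torusStep F h) (volume : Measure (Phase N)) volume := by
  have h1 : MeasurePreserving
      (fun p : (Fin N → E3) × (Fin N → T3) => (p.1, p.2 + projN (h • p.1)))
      (volume.prod volume) (volume.prod volume) := by
    refine (MeasurePreserving.id volume).skew_product (g := fun V X => X + projN (h • V)) ?_ ?_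
    · exact (continuous_snd.add
        (continuous_projN.comp (continuous_fst.const_smul h))).measurable
    · exact ae_of_all _ fun V => map_add_right_eq_self volume _
  have h2 : MeasurePreserving
      (fun p : (Fin N → T3) × (Fin N → E3) => (p.1, p.2 + h • F p.1))
      (volume.prod volume) (volume.prod volume) := by
    refine (MeasurePreserving.id volume).skew_product (g := fun X V => V + h • F X) ?_ ?_
    · exact (continuous_snd.add ((hF.comp continuous_fst).const_smul h)).measurable
    · exact ae_of_all _ fun V => map_add_right_eq_self volume _
  exact h2.comp (Measure.measurePreserving_swap.comp (h1.comp Measure.measurePreserving_swap))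

lemma exists_bound_torus (hF : Continuous F) : ∃ M : ℝ, ∀ X, ‖F X‖ ≤ M := by
  obtain ⟨M, hM⟩ := isCompact_univ.exists_bound_of_continuousOn hF.continuousOn
  exact ⟨M, fun X => hM X trivial⟩

lemma lipschitzWith_comp_projN {L : ℝ≥0} (hF : LipschitzWith L F) :
    LipschitzWith L (F ∘ projN) := by
  simpa using hF.comp lipschitzWith_projN

/-- A globally Lipschitz force field on the torus has a global measurable flow that does not
increase Lebesgue measure. -/
theorem exists_torusFlow {L : ℝ≥0} (hF : LipschitzWith L F) :
    ∃ Φ : ℝ → Phase N → Phase N, Measurable (Function.uncurry Φ) ∧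
      (∀ t, Measure.map (Φ t) volume ≤ volume) ∧
      ∀ z : ℝ → (Fin N → E3) × (Fin N → E3),
        (∀ t, HasDerivAt z (newtonField (F ∘ projN) (z t)) t) →
        ∀ t, Φ t (projZ (z 0)) = projZ (z t) := by
  obtain ⟨M, hM⟩ := exists_bound_torus hF.continuous
  have hL := lipschitzWith_comp_projN hF
  have hM' : ∀ x, ‖(F ∘ projN) x‖ ≤ M := fun x => hM _
  have hex : ∀ Z : Phase N, ∃ z : ℝ → (Fin N → E3) × (Fin N → E3), projZ (z 0) = Z ∧
      ∀ t, HasDerivAt z (newtonField (F ∘ projN) (z t)) t := fun Z => by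
    obtain ⟨z₀, hz₀⟩ := projZ_surjective Z
    obtain ⟨z, h0, hz⟩ := newton_exists hL hM' z₀
    exact ⟨z, by rw [h0, hz₀], hz⟩
  choose y hy0 hy using hex
  let S : ℕ → ℝ × Phase N → Phase N := fun m p => (torusStep F (p.1 / (m + 1)))^[m + 1] p.2
  have hS : ∀ z : ℝ → (Fin N → E3) × (Fin N → E3),
      (∀ t, HasDerivAt z (newtonField (F ∘ projN) (z t)) t) →
      ∀ t, Tendsto (fun m => S m (t, projZ (z 0))) atTop (𝓝 (projZ (z t))) := by
    intro z hz t
    have := (continuous_projZ.tendsto (z t)).comp (tendsto_eulerStep_iterate hL hM' hz t)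
    refine this.congr fun m => ?_
    exact (semiconj_projZ _).iterate_right _ _
  have hlim : ∀ t Z, Tendsto (fun m => S m (t, Z)) atTop (𝓝 (projZ (y Z t))) := by
    intro t Z
    have := hS (y Z) (hy Z) t
    rwa [hy0] at this
  have hScont : ∀ m, Continuous (S m) := fun m => by
    have := (continuous_torusStep_iterate hF.continuous (m + 1)).comp
      (((continuous_fst (X := ℝ) (Y := Phase N)).div_const ((m : ℝ) + 1)).prodMk continuous_snd)
    exact this
  have hmeas : Measurable (Function.uncurry fun t Z => projZ (y Z t)) :=
    measurable_of_tendsto_metrizable (fun m => (hScont m).measurable)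
      (tendsto_pi_nhds.2 fun p => hlim p.1 p.2)
  refine ⟨fun t Z => projZ (y Z t), hmeas, fun t => ?_, fun z hz t => ?_⟩
  · have : IsLocallyFiniteMeasure (volume : Measure (Phase N)) :=
      Measure.prod.instIsLocallyFiniteMeasure
    have hm : Measurable fun Z => projZ (y Z t) := hmeas.of_uncurry_left
    -- Pointwise convergence only passes an inequality to the limit: the indicator of an open set is
    -- lower semicontinuous, so Fatou applies. Outer regularity then extends it to Borel sets.
    have hopen : ∀ U : Set (Phase N), IsOpen U →
        volume ((fun Z => projZ (y Z t)) ⁻¹' U) ≤ volume U := by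
      intro U hU
      have hmp : ∀ m, MeasurePreserving (fun Z => S m (t, Z)) (volume : Measure (Phase N)) volume :=
        fun m => (measurePreserving_torusStep hF.continuous (t / (m + 1))).iterate (m + 1)
      calc volume ((fun Z => projZ (y Z t)) ⁻¹' U)
          = ∫⁻ Z, U.indicator 1 (projZ (y Z t)) := by
            rw [← lintegral_indicator_one (hm hU.measurableSet)]; rfl
        _ ≤ ∫⁻ Z, liminf (fun m => U.indicator (1 : Phase N → ℝ≥0∞) (S m (t, Z))) atTop := by
            refine lintegral_mono fun Z => ?_
            by_cases h : projZ (y Z t) ∈ U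
            · refine le_liminf_of_le (by isBoundedDefault) ?_
              filter_upwards [(hlim t Z).eventually (hU.mem_nhds h)] with m hm
              rw [indicator_of_mem h, indicator_of_mem hm]
              rfl
            · rw [indicator_of_notMem h]; exact zero_le
        _ ≤ liminf (fun m => ∫⁻ Z, U.indicator (1 : Phase N → ℝ≥0∞) (S m (t, Z))) atTop :=
            lintegral_liminf_le fun m =>
              (measurable_one.indicator hU.measurableSet).comp (hmp m).measurable
        _ = volume U := by
            have : ∀ m, ∫⁻ Z, U.indicator (1 : Phase N → ℝ≥0∞) (S m (t, Z)) = volume U := by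
              intro m
              rw [(hmp m).lintegral_comp (measurable_one.indicator hU.measurableSet),
                lintegral_indicator_one hU.measurableSet]
            simp [this]
    refine Measure.le_iff.2 fun B hB => ?_
    rw [Measure.map_apply hm hB, B.measure_eq_iInf_isOpen]
    refine le_iInf₂ fun U hBU => le_iInf fun hU => ?_
    exact (measure_mono (preimage_mono hBU)).trans (hopen U hU)
  · refine tendsto_nhds_unique (hlim t (projZ (z 0))) (hS z hz t)

end TorusFlow

end NParticle

namespace NParticle

/-! ### The force on the torus and its two-point estimates -/

section Kernel

lemma periodic_add_of_proj_eq_zero (φ : T3 → ℝ) {c : E3} (hc : proj c = 0) (x : E3) :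
    periodic φ (x + c) = periodic φ x := by
  simp [periodic, proj_add, hc]

/-- Derivatives commute with the translation by a period. This makes `torusForce` independent of the
chosen lift. -/
lemma force_eq_of_proj_eq (φ : T3 → ℝ) {x y : E3} (h : proj x = proj y) :
    force φ x = force φ y := by
  have hc : proj (y - x) = 0 := by rw [proj_sub, h, sub_self]
  have h1 : (fun z => periodic φ (z + (y - x))) = periodic φ :=
    funext fun z => periodic_add_of_proj_eq_zero φ hc z
  have h2 := fderiv_comp_add_right (𝕜 := ℝ) (f := periodic φ) (x := x) (y - x)
  rw [h1, add_sub_cancel] at h2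
  simp [force, gradient, h2]

/-- The force kernel as a vector field on the torus. -/
noncomputable def torusForce (φ : T3 → ℝ) (z : T3) : E3 := force φ (Function.surjInv proj_surjective z)

lemma torusForce_proj (φ : T3 → ℝ) (x : E3) : torusForce φ (proj x) = force φ x :=
  force_eq_of_proj_eq φ (Function.surjInv_eq proj_surjective _)

variable {φ : T3 → ℝ} {φmin A α : ℝ}

lemma isOpen_proj_ne_zero : IsOpen {x : E3 | proj x ≠ 0} :=
  isOpen_compl_singleton.preimage continuous_proj

lemma Admissible.contDiffAt (hφ : Admissible φ φmin A α) {x : E3} (hx : proj x ≠ 0) :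
    ContDiffAt ℝ 2 (periodic φ) x :=
  hφ.contDiff.contDiffAt (isOpen_proj_ne_zero.mem_nhds hx)

lemma Admissible.hasGradientAt (hφ : Admissible φ φmin A α) {x : E3} (hx : proj x ≠ 0) :
    HasGradientAt (periodic φ) (-force φ x) x := by
  rw [force, neg_neg]
  exact ((hφ.contDiffAt hx).differentiableAt (by norm_num)).hasGradientAt

lemma Admissible.force_neg (hφ : Admissible φ φmin A α) (x : E3) : force φ (-x) = -force φ x := by
  have h1 : (fun z => periodic φ (-z)) = periodic φ :=
    funext fun z => by simp [periodic, proj_neg, hφ.even]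
  have h2 := (ContinuousLinearEquiv.neg ℝ (M := E3)).comp_right_fderiv (f := periodic φ) (x := x)
  have h3 : fderiv ℝ (periodic φ) (-x) = -fderiv ℝ (periodic φ) x := by
    change fderiv ℝ (fun z => periodic φ (-z)) x = _ at h2
    rw [h1] at h2
    rw [h2]
    ext v
    simp
  simp [force, gradient, h3]

lemma gradient_apply (f : E3 → ℝ) (x : E3) (i : Fin 3) :
    gradient f x i = fderiv ℝ f x (EuclideanSpace.single i 1) := by
  have := InnerProductSpace.toDual_symm_apply (𝕜 := ℝ) (E := E3)
    (x := EuclideanSpace.single i 1) (y := fderiv ℝ f x)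
  rw [← this, EuclideanSpace.inner_single_right]
  simp [gradient]

lemma Admissible.differentiableAt_force (hφ : Admissible φ φmin A α) {x : E3} (hx : proj x ≠ 0) :
    DifferentiableAt ℝ (gradient (periodic φ)) x := by
  rw [differentiableAt_euclidean]
  intro i
  simp only [gradient_apply]
  have : ContDiffAt ℝ 1 (fderiv ℝ (periodic φ)) x :=
    (hφ.contDiffAt hx).fderiv_right (by norm_num)
  exact (this.differentiableAt (by norm_num)).clm_apply (differentiableAt_const _)

lemma Admissible.continuousAt (hφ : Admissible φ φmin A α) {z : T3} (hz : z ≠ 0) :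
    ContinuousAt φ z := by
  obtain ⟨x, rfl⟩ := proj_surjective z
  have h := (hφ.contDiffAt hz).continuousAt
  rw [ContinuousAt, ← map_proj_nhds, tendsto_map'_iff]
  exact h

lemma Admissible.continuousAt_torusForce (hφ : Admissible φ φmin A α) {z : T3} (hz : z ≠ 0) :
    ContinuousAt (torusForce φ) z := by
  obtain ⟨x, rfl⟩ := proj_surjective z
  have h : ContinuousAt (force φ) x := (hφ.differentiableAt_force hz).continuousAt.neg
  rw [ContinuousAt, ← map_proj_nhds, tendsto_map'_iff, torusForce_proj]
  exact h.tendsto.congr (fun y => (torusForce_proj φ y).symm)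

lemma Admissible.measurable (hφ : Admissible φ φmin A α) : Measurable φ :=
  measurable_of_continuousOn_compl_singleton 0
    fun _ hz => (hφ.continuousAt hz).continuousWithinAt

lemma Admissible.norm_torusForce_le (hφ : Admissible φ φmin A α) {z : T3} (hz : z ≠ 0) :
    ‖torusForce φ z‖ ≤ A * tnorm z ^ (-α) := by
  obtain ⟨x, rfl⟩ := proj_surjective z
  rw [torusForce_proj, force, norm_neg, Real.rpow_neg (tnorm_nonneg _), ← div_eq_mul_inv]
  exact hφ.grad x hz

/-- Mean value estimate for two points close to each other compared to their distance to `0`. -/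
lemma Admissible.torusForce_sub_le_of_near (hφ : Admissible φ φmin A α) {z w : T3} (hz : z ≠ 0)
    (hzw : tnorm (z - w) ≤ tnorm z / 2) {H : ℝ}
    (hH : ∀ u : T3, tnorm z / 2 ≤ tnorm u → A / tnorm u ^ (α + 1) ≤ H) :
    ‖torusForce φ z - torusForce φ w‖ ≤ H * tnorm (z - w) := by
  obtain ⟨x, rfl⟩ := proj_surjective z
  obtain ⟨d, hd, hdn⟩ := exists_lift (proj x - w)
  have hw : w = proj (x - d) := by rw [proj_sub, hd]; abel
  have hzpos : 0 < tnorm (proj x) := tnorm_pos.2 hz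
  rw [← hdn, hw, torusForce_proj, torusForce_proj, force, force, ← norm_neg, neg_sub_neg, neg_sub]
  -- With the shortest lift `d` of the difference, the segment is no longer than half the distance
  -- of `z` to the origin, so it avoids the singularity.
  have hseg : ∀ y ∈ segment ℝ (x - d) x, tnorm (proj x) / 2 ≤ tnorm (proj y) := by
    intro y hy
    have h1 : ‖x - y‖ ≤ ‖d‖ := by
      have := norm_sub_le_of_mem_segment (segment_symm ℝ (x - d) x ▸ hy)
      rw [sub_sub_cancel_left, norm_neg] at this
      rwa [norm_sub_rev]
    have h2 := tnorm_le_add_sub (proj x) (proj y)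
    have h3 := tnorm_proj_le (x - y)
    rw [proj_sub] at h3
    rw [← hdn] at hzw
    linarith
  have hne : ∀ y ∈ segment ℝ (x - d) x, proj y ≠ 0 := fun y hy =>
    tnorm_pos.1 (lt_of_lt_of_le (by linarith) (hseg y hy))
  have := (convex_segment (x - d) x).norm_image_sub_le_of_norm_fderiv_le (𝕜 := ℝ)
    (fun y hy => hφ.differentiableAt_force (hne y hy))
    (fun y hy => (hφ.hess y (hne y hy)).trans (hH _ (hseg y hy)))
    (left_mem_segment ℝ _ _) (right_mem_segment ℝ _ _)
  rwa [sub_sub_cancel] at this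

/-- If one point is at least twice as far from `0` as from the other point, the mean value estimate
applies, and halving the distance costs `2 ^ (α + 1) ≤ 8`. Otherwise both `|z|` and `|w|` are at
most `2|z - w|`, and writing `|u|^(-α) = |u|^(-(α+1)) |u|` in the bound of the force itself
suffices. -/
lemma Admissible.torusForce_sub_le (hφ : Admissible φ φmin A α) (hA : 0 ≤ A) (hα : -1 ≤ α)
    (hα2 : α < 2) {z w : T3} (hz : z ≠ 0) (hw : w ≠ 0) :
    ‖torusForce φ z - torusForce φ w‖ ≤
      8 * A * (tnorm z ^ (-(α + 1)) + tnorm w ^ (-(α + 1))) * tnorm (z - w) := by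
  have hz0 := tnorm_pos.2 hz
  have hw0 := tnorm_pos.2 hw
  have hd0 := tnorm_nonneg (z - w)
  have key : ∀ {z w : T3}, z ≠ 0 → tnorm (z - w) ≤ tnorm z / 2 →
      ‖torusForce φ z - torusForce φ w‖ ≤
      8 * A * (tnorm z ^ (-(α + 1)) + tnorm w ^ (-(α + 1))) * tnorm (z - w) := by
    intro z w hz h
    have hz0 := tnorm_pos.2 hz
    refine (hφ.torusForce_sub_le_of_near hz h (H := 8 * A * tnorm z ^ (-(α + 1))) ?_).trans ?_
    · intro u hu
      have hu0 : 0 < tnorm u := lt_of_lt_of_le (by linarith) hu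
      rw [div_eq_mul_inv, ← Real.rpow_neg hu0.le, mul_comm 8 A, mul_assoc]
      gcongr
      calc tnorm u ^ (-(α + 1)) ≤ (tnorm z / 2) ^ (-(α + 1)) :=
            Real.rpow_le_rpow_of_nonpos (by linarith) hu (by linarith)
        _ = 2 ^ (α + 1) * tnorm z ^ (-(α + 1)) := by
            rw [Real.div_rpow hz0.le (by norm_num), Real.rpow_neg (by norm_num : (0 : ℝ) ≤ 2)]
            rw [div_inv_eq_mul, mul_comm]
        _ ≤ 8 * tnorm z ^ (-(α + 1)) := by
            gcongr
            calc (2 : ℝ) ^ (α + 1) ≤ 2 ^ (3 : ℝ) :=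
                  Real.rpow_le_rpow_of_exponent_le (by norm_num) (by linarith)
              _ = 8 := by norm_num
    · have : 0 ≤ tnorm w ^ (-(α + 1)) := Real.rpow_nonneg (tnorm_nonneg _) _
      gcongr
      · exact tnorm_nonneg _
      · linarith
  rcases le_or_gt (tnorm (z - w)) (tnorm z / 2) with h | h
  · exact key hz h
  rcases le_or_gt (tnorm (z - w)) (tnorm w / 2) with h' | h'
  · have := key hw (tnorm_sub_comm z w ▸ h')
    rwa [norm_sub_rev, tnorm_sub_comm, add_comm]
  have e : ∀ u : T3, u ≠ 0 → tnorm u ≤ 2 * tnorm (z - w) →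
      ‖torusForce φ u‖ ≤ 2 * A * tnorm u ^ (-(α + 1)) * tnorm (z - w) := by
    intro u hu h
    have hu0 := tnorm_pos.2 hu
    refine (hφ.norm_torusForce_le hu).trans ?_
    have e1 : tnorm u ^ (-α) = tnorm u ^ (-(α + 1)) * tnorm u := by
      nth_rw 3 [← Real.rpow_one (tnorm u)]
      rw [← Real.rpow_add hu0]; congr 1; ring
    have : 0 ≤ A * tnorm u ^ (-(α + 1)) := by positivity
    rw [e1]
    nlinarith
  have h1 := e z hz (by linarith)
  have h2 := e w hw (by linarith)
  have h3 : 0 ≤ A * tnorm z ^ (-(α + 1)) * tnorm (z - w) := by positivity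
  have h4 : 0 ≤ A * tnorm w ^ (-(α + 1)) * tnorm (z - w) := by positivity
  refine (norm_sub_le _ _).trans ?_
  linarith

/-- `√3/2 < 7/8`. A bound strictly below one provides the geometric decay that compensates `2 - α`
as `α → -∞`. -/
lemma tnorm_le_seven_eighths (z : T3) : tnorm z ≤ 7 / 8 := by
  have := tnorm_sq_le z
  nlinarith [tnorm_nonneg z]

/-- For `α ≤ -1` the Hessian bound is a nonnegative power of the distance, so it is bounded and no
truncation is needed. In the far case `|z| ≤ 2|z - w|` and `|w| ≤ 3|z - w|`, whence the factor 5. -/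
lemma Admissible.torusForce_sub_le_of_le_neg_one (hφ : Admissible φ φmin A α) (hA : 0 ≤ A)
    (hα : α ≤ -1) {z w : T3} (hz : z ≠ 0) (hw : w ≠ 0) :
    ‖torusForce φ z - torusForce φ w‖ ≤ 5 * A * (7 / 8) ^ (-(α + 1)) * tnorm (z - w) := by
  set κ : ℝ := (7 / 8) ^ (-(α + 1)) with hκ
  have hκ0 : 0 < κ := by positivity
  have hu : ∀ u : T3, u ≠ 0 → tnorm u ^ (-(α + 1)) ≤ κ := fun u _ =>
    Real.rpow_le_rpow (tnorm_nonneg u) (tnorm_le_seven_eighths u) (by linarith)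
  have hd0 := tnorm_nonneg (z - w)
  rcases le_or_gt (tnorm (z - w)) (tnorm z / 2) with h | h
  · have hz0 := tnorm_pos.2 hz
    refine (hφ.torusForce_sub_le_of_near hz h (H := A * κ) ?_).trans ?_
    · intro u h'
      have hu0 : 0 < tnorm u := lt_of_lt_of_le (by linarith) h'
      rw [div_eq_mul_inv, ← Real.rpow_neg hu0.le]
      gcongr
      exact hu u (tnorm_pos.1 hu0)
    · have : 0 ≤ A * κ * tnorm (z - w) := by positivity
      linarith
  · have e : ∀ u : T3, u ≠ 0 → ‖torusForce φ u‖ ≤ A * κ * tnorm u := by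
      intro u h'
      have hu0 := tnorm_pos.2 h'
      refine (hφ.norm_torusForce_le h').trans ?_
      have e1 : tnorm u ^ (-α) = tnorm u ^ (-(α + 1)) * tnorm u := by
        nth_rw 3 [← Real.rpow_one (tnorm u)]
        rw [← Real.rpow_add hu0]; congr 1; ring
      rw [e1, ← mul_assoc]
      gcongr
      exact hu u h'
    refine (norm_sub_le _ _).trans ((add_le_add (e z hz) (e w hw)).trans ?_)
    have h1 := tnorm_le_add_sub w z
    rw [tnorm_sub_comm] at h1
    have h2 : tnorm z + tnorm w ≤ 5 * tnorm (z - w) := by linarith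
    have : 0 ≤ A * κ := by positivity
    nlinarith

lemma Admissible.exists_lipschitz_away (hφ : Admissible φ φmin A α) (hA : 0 ≤ A) (hα2 : α < 2)
    {η : ℝ} (hη : 0 < η) : ∃ L : ℝ, 0 ≤ L ∧ ∀ z w : T3, η ≤ tnorm z → η ≤ tnorm w →
      ‖torusForce φ z - torusForce φ w‖ ≤ L * tnorm (z - w) := by
  have hne : ∀ z : T3, η ≤ tnorm z → z ≠ 0 := fun z hz => tnorm_pos.1 (hη.trans_le hz)
  rcases le_total (-1) α with h | h
  · refine ⟨8 * A * (η ^ (-(α + 1)) + η ^ (-(α + 1))), by positivity, fun z w hz hw => ?_⟩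
    refine (hφ.torusForce_sub_le hA h hα2 (hne z hz) (hne w hw)).trans ?_
    have e : ∀ u : T3, η ≤ tnorm u → tnorm u ^ (-(α + 1)) ≤ η ^ (-(α + 1)) := fun u hu =>
      Real.rpow_le_rpow_of_nonpos hη hu (by linarith)
    have h1 := e z hz
    have h2 := e w hw
    exact mul_le_mul_of_nonneg_right (mul_le_mul_of_nonneg_left (add_le_add h1 h2) (by positivity))
      (tnorm_nonneg _)
  · exact ⟨_, by positivity, fun z w hz hw =>
      hφ.torusForce_sub_le_of_le_neg_one hA h (hne z hz) (hne w hw)⟩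

instance isProbabilityMeasureT3 : IsProbabilityMeasure (volume : Measure T3) :=
  ⟨by rw [volume_pi, Measure.pi_univ]; simp⟩

lemma volume_singleton_zero : volume ({0} : Set T3) = 0 := by
  have h : ∀ ρ : ℝ, 0 < ρ → volume ({0} : Set T3) ≤ ENNReal.ofReal (8 * ρ ^ 3) := fun ρ hρ =>
    (measure_mono (by rintro _ rfl; simpa [tnorm_eq_zero.2 rfl] using hρ)).trans
      (volume_tnorm_lt_le ρ)
  have h0 : Tendsto (fun ρ : ℝ => ENNReal.ofReal (8 * ρ ^ 3)) (𝓝[>] 0) (𝓝 0) := by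
    have : Continuous fun ρ : ℝ => ENNReal.ofReal (8 * ρ ^ 3) :=
      ENNReal.continuous_ofReal.comp (by fun_prop)
    have := (this.tendsto 0).mono_left (nhdsWithin_le_nhds (s := Ioi 0))
    simpa using this
  refine le_antisymm (ge_of_tendsto h0 ?_) zero_le
  filter_upwards [self_mem_nhdsWithin] with ρ hρ using h ρ hρ

lemma ae_ne_zero : ∀ᵐ z : T3, z ≠ 0 := by
  rw [ae_iff]; simpa using volume_singleton_zero

lemma lintegral_tnorm_rpow_lt_top {q : ℝ} (hq3 : q < 3) :
    ∫⁻ z : T3, ENNReal.ofReal (tnorm z ^ (-q)) < ⊤ := by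
  rcases lt_or_ge (-1) q with h | h
  · exact (lintegral_tnorm_rpow_le h hq3).trans_lt ENNReal.ofReal_lt_top
  · calc ∫⁻ z : T3, ENNReal.ofReal (tnorm z ^ (-q)) ≤ ∫⁻ _ : T3, 1 := by
          refine lintegral_mono fun z => ?_
          rw [ENNReal.ofReal_le_one]
          exact Real.rpow_le_one (tnorm_nonneg z) (tnorm_lt_one z).le (by linarith)
      _ < ⊤ := by simp

lemma Admissible.integrable (hφ : Admissible φ φmin A α) (hA : 0 ≤ A) (hα2 : α < 2) :
    Integrable φ := by
  have h1 : Integrable fun z : T3 => tnorm z ^ (-(α - 1)) := by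
    refine ⟨(measurable_tnorm.pow_const _).aestronglyMeasurable, ?_⟩
    rw [hasFiniteIntegral_iff_ofReal (ae_of_all _ fun z => Real.rpow_nonneg (tnorm_nonneg z) _)]
    exact lintegral_tnorm_rpow_lt_top (by linarith)
  refine Integrable.mono' ((integrable_const |φmin|).add (h1.const_mul A))
    hφ.measurable.aestronglyMeasurable ?_
  filter_upwards [ae_ne_zero] with z hz
  have hu := hφ.upper z hz
  have hl := hφ.lower z hz
  rw [div_eq_mul_inv, ← Real.rpow_neg (tnorm_nonneg z)] at hu
  have h3 : 0 ≤ A * tnorm z ^ (-(α - 1)) := mul_nonneg hA (Real.rpow_nonneg (tnorm_nonneg z) _)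
  rw [Real.norm_eq_abs, Pi.add_apply, abs_le]
  constructor
  · linarith [neg_abs_le φmin]
  · linarith [abs_nonneg φmin]

/-- A two-point estimate of the force, with a Lipschitz part `G` and a crude part `B`. -/
structure KernelBound (φ : T3 → ℝ) (G B : T3 → ℝ) (κ : ℝ) : Prop where
  bound : ∀ z w : T3, z ≠ 0 → w ≠ 0 →
    ‖torusForce φ z - torusForce φ w‖ ≤ (G z + G w) * tnorm (z - w) + (B z + B w)
  G_nonneg : ∀ z, 0 ≤ G z
  G_le : ∀ z, G z ≤ κ
  B_nonneg : ∀ z, 0 ≤ B z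
  G_neg : ∀ z, G (-z) = G z
  continuousAt_G : ∀ z, z ≠ 0 → ContinuousAt G z
  continuousAt_B : ∀ z, z ≠ 0 → ContinuousAt B z

lemma KernelBound.measurable_G {G B : T3 → ℝ} {κ : ℝ} (h : KernelBound φ G B κ) : Measurable G :=
  measurable_of_continuousOn_compl_singleton 0
    fun z hz => (h.continuousAt_G z hz).continuousWithinAt

lemma KernelBound.measurable_B {G B : T3 → ℝ} {κ : ℝ} (h : KernelBound φ G B κ) : Measurable B :=
  measurable_of_continuousOn_compl_singleton 0
    fun z hz => (h.continuousAt_B z hz).continuousWithinAt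

lemma Admissible.kernelBound_of_le_neg_one (hφ : Admissible φ φmin A α) (hA : 0 ≤ A)
    (hα : α ≤ -1) : KernelBound φ (fun _ => 5 * A * (7 / 8) ^ (-(α + 1))) (fun _ => 0)
      (5 * A * (7 / 8) ^ (-(α + 1))) where
  bound z w hz hw := by
    refine (hφ.torusForce_sub_le_of_le_neg_one hA hα hz hw).trans ?_
    have : 0 ≤ 5 * A * (7 / 8 : ℝ) ^ (-(α + 1)) * tnorm (z - w) :=
      mul_nonneg (by positivity) (tnorm_nonneg _)
    linarith
  G_nonneg _ := by positivity
  G_le _ := le_rfl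
  B_nonneg _ := le_rfl
  G_neg _ := rfl
  continuousAt_G _ _ := continuousAt_const
  continuousAt_B _ _ := continuousAt_const

/-- Capping the Lipschitz weight at distance `r` makes it bounded, and the forces of pairs closer
than `r` go into the crude part. The last factor of the crude part is at least 1 for `|z| < r`,
vanishes beyond `2r` and is continuous, so the rate is continuous along trajectories. -/
lemma Admissible.kernelBound (hφ : Admissible φ φmin A α) (hA : 0 ≤ A) (hα : -1 < α) (hα2 : α < 2)
    {r : ℝ} (hr : 0 < r) :
    KernelBound φ (fun z => 8 * A * max (tnorm z) r ^ (-(α + 1)))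
      (fun z => 3 * A * tnorm z ^ (-α) * max 0 (2 - tnorm z / r)) (8 * A * r ^ (-(α + 1))) where
  bound := by
    set G : T3 → ℝ := fun z => 8 * A * max (tnorm z) r ^ (-(α + 1)) with hG
    set B : T3 → ℝ := fun z => 3 * A * tnorm z ^ (-α) * max 0 (2 - tnorm z / r) with hB
    have hGn : ∀ z, 0 ≤ G z := fun z => by positivity
    have hBn : ∀ z, 0 ≤ B z := fun z => by
      have := Real.rpow_nonneg (tnorm_nonneg z) (-α)
      positivity
    have hBr : ∀ z, tnorm z < r → 3 * A * tnorm z ^ (-α) ≤ B z := fun z hz => by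
      have h1 : 0 ≤ 3 * A * tnorm z ^ (-α) := by
        have := Real.rpow_nonneg (tnorm_nonneg z) (-α)
        positivity
      have h2 : 1 ≤ max 0 (2 - tnorm z / r) := by
        refine le_max_of_le_right ?_
        have := (div_lt_one hr).2 hz
        linarith
      exact le_mul_of_one_le_right h1 h2
    have key : ∀ z w : T3, z ≠ 0 → w ≠ 0 → tnorm z ≤ tnorm w →
        ‖torusForce φ z - torusForce φ w‖ ≤ (G z + G w) * tnorm (z - w) + (B z + B w) := by
      intro z w hz hw hzw
      have hz0 := tnorm_pos.2 hz
      have hw0 := tnorm_pos.2 hw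
      have hd0 := tnorm_nonneg (z - w)
      rcases le_or_gt r (tnorm z) with h | h
      · refine (hφ.torusForce_sub_le hA hα.le hα2 hz hw).trans ?_
        simp only [hG, max_eq_left h, max_eq_left (h.trans hzw)]
        have := hBn z
        have := hBn w
        linarith
      have hKz := hφ.norm_torusForce_le hz
      have hKw := hφ.norm_torusForce_le hw
      have hBz := hBr z h
      have hzα : 0 ≤ A * tnorm z ^ (-α) := by positivity
      have hGd : 0 ≤ (G z + G w) * tnorm (z - w) :=
        mul_nonneg (add_nonneg (hGn z) (hGn w)) hd0
      have htri := norm_sub_le (torusForce φ z) (torusForce φ w)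
      rcases lt_or_ge (tnorm w) r with h' | h'
      · have hBw := hBr w h'
        have : 0 ≤ A * tnorm w ^ (-α) := by positivity
        linarith
      -- Here `|z| < r ≤ |w|`. For comparable distances the force at `w` is at most twice the bound
      -- at `z`, which explains the 3 in the crude part. Otherwise `|w| ≤ 2|z - w|` and the force at
      -- `w` is absorbed by its Lipschitz weight.
      rcases le_or_gt (tnorm w) (2 * tnorm z) with h2 | h2
      · have e : tnorm w ^ (-α) ≤ 2 * tnorm z ^ (-α) := by
          rcases le_total 0 α with h0 | h0
          · have := Real.rpow_le_rpow_of_nonpos hz0 hzw (neg_nonpos.2 h0)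
            have : 0 ≤ tnorm z ^ (-α) := by positivity
            linarith
          · calc tnorm w ^ (-α) ≤ (2 * tnorm z) ^ (-α) :=
                  Real.rpow_le_rpow hw0.le h2 (by linarith)
              _ = 2 ^ (-α) * tnorm z ^ (-α) := Real.mul_rpow (by norm_num) hz0.le
              _ ≤ 2 * tnorm z ^ (-α) := by
                  gcongr
                  calc (2 : ℝ) ^ (-α) ≤ 2 ^ (1 : ℝ) :=
                        Real.rpow_le_rpow_of_exponent_le (by norm_num) (by linarith)
                    _ = 2 := by norm_num
        have e2 : A * tnorm w ^ (-α) ≤ A * (2 * tnorm z ^ (-α)) := by gcongr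
        have := hBn w
        linarith
      · have e1 : tnorm w ^ (-α) = tnorm w ^ (-(α + 1)) * tnorm w := by
          nth_rw 3 [← Real.rpow_one (tnorm w)]
          rw [← Real.rpow_add hw0]; congr 1; ring
        have h3 : tnorm w ≤ 2 * tnorm (z - w) := by
          have := tnorm_le_add_sub w z
          rw [tnorm_sub_comm] at this
          linarith
        have hp : 0 ≤ A * tnorm w ^ (-(α + 1)) := by positivity
        have e2 : A * tnorm w ^ (-α) ≤ 2 * (A * tnorm w ^ (-(α + 1))) * tnorm (z - w) := by
          rw [e1]; nlinarith
        have e3 : G w = 8 * (A * tnorm w ^ (-(α + 1))) := by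
          simp only [hG, max_eq_left h']; ring
        have e4 : 2 * (A * tnorm w ^ (-(α + 1))) * tnorm (z - w) ≤
            (G z + G w) * tnorm (z - w) := by
          gcongr
          rw [e3]; linarith [hGn z]
        have := hBn w
        linarith
    intro z w hz hw
    rcases le_total (tnorm z) (tnorm w) with h | h
    · exact key z w hz hw h
    · have := key w z hw hz h
      rw [norm_sub_rev, tnorm_sub_comm]
      linarith
  G_nonneg z := by positivity
  G_le z := by
    have := Real.rpow_le_rpow_of_nonpos hr (le_max_right (tnorm z) r)
      (by linarith : -(α + 1) ≤ 0)
    gcongr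
  B_nonneg z := by
    have := Real.rpow_nonneg (tnorm_nonneg z) (-α)
    positivity
  G_neg z := by simp only [tnorm_neg]
  continuousAt_G z hz := by
    refine continuousAt_const.mul (ContinuousAt.rpow_const ?_ (Or.inl ?_))
    · exact (continuous_tnorm.max continuous_const).continuousAt
    · exact (lt_max_of_lt_right hr).ne'
  continuousAt_B z hz := by
    refine (continuousAt_const.mul (continuous_tnorm.continuousAt.rpow_const
      (Or.inl (tnorm_pos.2 hz).ne'))).mul ?_
    exact (continuous_const.max (continuous_const.sub
      (continuous_tnorm.div_const r))).continuousAt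

/-- The quantitative two-point estimate of the force used for `N` particles. -/
theorem Admissible.exists_kernelBound (hφ : Admissible φ φmin A α) (hA : 0 < A) (hα2 : α < 2)
    {N : ℕ} (hN : 1 ≤ N) :
    ∃ (G B : T3 → ℝ) (κ : ℝ), KernelBound φ G B κ ∧ 0 < κ ∧
      κ * (Real.log N + 1) / N ≤ 40 * A / (2 - α) ∧
      ∫⁻ z, ENNReal.ofReal (G z) ≤ ENNReal.ofReal (256 * A / (2 - α)) ∧
      ∫⁻ z, ENNReal.ofReal (B z) ≤
        ENNReal.ofReal (3072 * A / (2 - α) * (N : ℝ) ^ (-(1 - α / 3))) := by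
  have hN0 : (0 : ℝ) < N := by exact_mod_cast hN
  have hN1 : (1 : ℝ) ≤ N := by exact_mod_cast hN
  have h2α : 0 < 2 - α := by linarith
  rcases le_or_gt α (-1) with h | h
  · have hκ : 5 * A * (7 / 8 : ℝ) ^ (-(α + 1)) ≤ 40 * A / (2 - α) := by
      set q := -(α + 1) with hq
      have hq0 : 0 ≤ q := by linarith
      have h1 : (7 / 8 : ℝ) ^ q ≤ Real.exp (-(q / 8)) := by
        rw [Real.rpow_def_of_pos (by norm_num)]
        refine Real.exp_le_exp.2 ?_
        have := Real.log_le_sub_one_of_pos (x := 7 / 8) (by norm_num)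
        nlinarith
      have h2 : Real.exp (-(q / 8)) ≤ 8 / (2 - α) := by
        rw [Real.exp_neg, inv_eq_one_div, div_le_div_iff₀ (Real.exp_pos _) h2α]
        have := Real.add_one_le_exp (q / 8)
        linarith
      calc 5 * A * (7 / 8 : ℝ) ^ q ≤ 5 * A * (8 / (2 - α)) := by gcongr; exact h1.trans h2
        _ = _ := by ring
    refine ⟨_, _, _, hφ.kernelBound_of_le_neg_one hA.le h, by positivity, ?_, ?_, ?_⟩
    · refine le_trans ?_ hκ
      rw [div_le_iff₀ hN0]
      have := Real.log_le_sub_one_of_pos hN0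
      gcongr
      linarith
    · simp only [lintegral_const, measure_univ, mul_one]
      refine ENNReal.ofReal_le_ofReal (hκ.trans ?_)
      gcongr
      norm_num
    · simp
  -- Scale of the mean interparticle distance. It gives `r^(3-α) = N^(-(1-α/3))` for the crude part
  -- and `κ/N` proportional to `N^(-(2-α)/3)`.
  · set r : ℝ := (N : ℝ) ^ (-(1 / 3) : ℝ) with hr
    have hr0 : 0 < r := Real.rpow_pos_of_pos hN0 _
    refine ⟨_, _, _, hφ.kernelBound hA.le h hα2 hr0, by positivity, ?_, ?_, ?_⟩
    · set q := (2 - α) / 3 with hq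
      have hq0 : 0 < q := by positivity
      have e1 : r ^ (-(α + 1)) / N = (N : ℝ) ^ (-q) := by
        rw [hr, ← Real.rpow_mul hN0.le, ← Real.rpow_sub_one hN0.ne']
        congr 1; rw [hq]; ring
      have e2 : 8 * A * r ^ (-(α + 1)) * (Real.log N + 1) / N =
          8 * A * ((N : ℝ) ^ (-q) * (Real.log N + 1)) := by
        rw [← e1]; ring
      rw [e2]
      -- The logarithm is absorbed by `1 + q log N ≤ N^q` at the price `1/q = 3/(2 - α)`, uniformly
      -- in `N`.
      have e3 : (N : ℝ) ^ (-q) * (Real.log N + 1) ≤ 5 / (2 - α) := by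
        have hx : 1 + q * Real.log N ≤ (N : ℝ) ^ q := by
          rw [Real.rpow_def_of_pos hN0, mul_comm]
          linarith [Real.add_one_le_exp (Real.log N * q)]
        have hl := Real.log_nonneg hN1
        rw [Real.rpow_neg hN0.le, inv_mul_eq_div, div_le_div_iff₀ (by positivity) h2α]
        have : Real.log N * (2 - α) = 3 * (q * Real.log N) := by rw [hq]; ring
        nlinarith
      calc _ ≤ 8 * A * (5 / (2 - α)) := by gcongr
        _ = _ := by ring
    · calc ∫⁻ z, ENNReal.ofReal (8 * A * max (tnorm z) r ^ (-(α + 1)))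
          ≤ ∫⁻ z, ENNReal.ofReal (8 * A) * ENNReal.ofReal (tnorm z ^ (-(α + 1))) := by
            refine lintegral_mono_ae ?_
            filter_upwards [ae_ne_zero] with z hz
            rw [← ENNReal.ofReal_mul (by positivity)]
            refine ENNReal.ofReal_le_ofReal ?_
            have := Real.rpow_le_rpow_of_nonpos (tnorm_pos.2 hz) (le_max_left (tnorm z) r)
              (by linarith : -(α + 1) ≤ 0)
            gcongr
        _ ≤ ENNReal.ofReal (8 * A) * ENNReal.ofReal (32 / (3 - (α + 1))) := by
            rw [lintegral_const_mul _ (measurable_tnorm.pow_const _).ennreal_ofReal]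
            gcongr
            exact lintegral_tnorm_rpow_le (by linarith) (by linarith)
        _ = _ := by
            rw [← ENNReal.ofReal_mul (by positivity)]
            congr 1
            rw [show 3 - (α + 1) = 2 - α by ring]; ring
    · have hS : MeasurableSet {z : T3 | tnorm z < 2 * r} :=
        measurableSet_lt measurable_tnorm measurable_const
      calc ∫⁻ z, ENNReal.ofReal (3 * A * tnorm z ^ (-α) * max 0 (2 - tnorm z / r))
          ≤ ∫⁻ z in {z : T3 | tnorm z < 2 * r},
              ENNReal.ofReal (6 * A) * ENNReal.ofReal (tnorm z ^ (-α)) := by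
            rw [← lintegral_indicator hS]
            refine lintegral_mono fun z => ?_
            have h0 := Real.rpow_nonneg (tnorm_nonneg z) (-α)
            by_cases hz : tnorm z < 2 * r
            · rw [indicator_of_mem (show z ∈ {z : T3 | tnorm z < 2 * r} from hz),
                ← ENNReal.ofReal_mul (by positivity)]
              refine ENNReal.ofReal_le_ofReal ?_
              have : max 0 (2 - tnorm z / r) ≤ 2 := by
                refine max_le (by norm_num) ?_
                have : 0 ≤ tnorm z / r := div_nonneg (tnorm_nonneg z) hr0.le
                linarith
              calc _ ≤ 3 * A * tnorm z ^ (-α) * 2 := by gcongr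
                _ = _ := by ring
            · have : max 0 (2 - tnorm z / r) = 0 := by
                refine max_eq_left ?_
                have : 2 ≤ tnorm z / r := (le_div_iff₀ hr0).2 (not_lt.1 hz)
                linarith
              rw [this, mul_zero, ENNReal.ofReal_zero]
              exact zero_le
        _ ≤ ENNReal.ofReal (6 * A) * ENNReal.ofReal (32 / (3 - α) * (2 * r) ^ (3 - α)) := by
            rw [lintegral_const_mul _ (measurable_tnorm.pow_const _).ennreal_ofReal]
            gcongr
            exact setLIntegral_tnorm_rpow_le h (by linarith) (by positivity)
        _ ≤ _ := by
            rw [← ENNReal.ofReal_mul (by positivity)]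
            refine ENNReal.ofReal_le_ofReal ?_
            have e1 : (2 * r) ^ (3 - α) = 2 ^ (3 - α) * (N : ℝ) ^ (-(1 - α / 3)) := by
              rw [Real.mul_rpow (by norm_num) hr0.le, hr, ← Real.rpow_mul hN0.le]
              congr 2; ring
            have e2 : (2 : ℝ) ^ (3 - α) ≤ 16 := by
              calc (2 : ℝ) ^ (3 - α) ≤ 2 ^ (4 : ℝ) :=
                    Real.rpow_le_rpow_of_exponent_le (by norm_num) (by linarith)
                _ = 16 := by norm_num
            rw [e1]
            have e3 : 32 / (3 - α) ≤ 32 / (2 - α) := by gcongr; linarith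
            calc 6 * A * (32 / (3 - α) * (2 ^ (3 - α) * (N : ℝ) ^ (-(1 - α / 3))))
                ≤ 6 * A * (32 / (2 - α) * (16 * (N : ℝ) ^ (-(1 - α / 3)))) := by gcongr
              _ = _ := by ring

end Kernel

end NParticle

namespace NParticle

/-! ### Moments under the Gibbs measure and the mean stability rate -/

section Gibbs

variable {N : ℕ} {φ : T3 → ℝ} {φmin A α β : ℝ}

/-- The interaction energy of a configuration of positions. -/
noncomputable def interaction (φ : T3 → ℝ) (X : Fin N → T3) : ℝ :=
  1 / (2 * (N : ℝ)) * ∑ i, ∑ j ∈ Finset.univ.erase i, φ (X i - X j)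

/-- The configurational Gibbs weight. -/
noncomputable def posWeight (φ : T3 → ℝ) (β : ℝ) (X : Fin N → T3) : ℝ≥0∞ :=
  ENNReal.ofReal (Real.exp (-β * interaction φ X))

lemma measurable_interaction (hφ : Measurable φ) : Measurable (interaction (N := N) φ) := by
  unfold interaction
  refine measurable_const.mul ?_
  refine Finset.measurable_sum _ fun i _ => Finset.measurable_sum _ fun j _ => ?_
  exact hφ.comp ((measurable_pi_apply i).sub (measurable_pi_apply j))

lemma measurable_posWeight (hφ : Measurable φ) : Measurable (posWeight (N := N) φ β) :=
  (Real.measurable_exp.comp ((measurable_interaction hφ).const_mul _)).ennreal_ofReal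

/-- The part of the interaction energy that does not involve the particle `i`. -/
noncomputable def interactionWithout (φ : T3 → ℝ) (i : Fin N) (X : Fin N → T3) : ℝ :=
  1 / (2 * (N : ℝ)) * ∑ k ∈ Finset.univ.erase i,
    ∑ j ∈ (Finset.univ.erase k).erase i, φ (X k - X j)

/-- Each pair containing `i` occurs twice in the double sum, with equal contributions by evenness;
this turns `1/(2N)` into `1/N`. -/
lemma interaction_update (heven : ∀ x, φ (-x) = φ x) (i : Fin N) (X : Fin N → T3) (x : T3) :
    interaction φ (Function.update X i x) =
      1 / (N : ℝ) * ∑ j ∈ Finset.univ.erase i, φ (x - X j) + interactionWithout φ i X := by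
  have h1 : ∑ k, ∑ j ∈ Finset.univ.erase k,
      φ (Function.update X i x k - Function.update X i x j) =
      ∑ j ∈ Finset.univ.erase i, φ (x - X j) + ∑ k ∈ Finset.univ.erase i,
        (φ (x - X k) + ∑ j ∈ (Finset.univ.erase k).erase i, φ (X k - X j)) := by
    rw [← Finset.add_sum_erase _ _ (Finset.mem_univ i)]
    congr 1
    · refine Finset.sum_congr rfl fun j hj => ?_
      rw [Function.update_self, Function.update_of_ne (Finset.ne_of_mem_erase hj)]
    · refine Finset.sum_congr rfl fun k hk => ?_
      have hki := Finset.ne_of_mem_erase hk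
      rw [← Finset.add_sum_erase _ _ (Finset.mem_erase.2 ⟨hki.symm, Finset.mem_univ i⟩)]
      congr 1
      · rw [Function.update_self, Function.update_of_ne hki, ← heven, neg_sub]
      · refine Finset.sum_congr rfl fun j hj => ?_
        rw [Function.update_of_ne hki, Function.update_of_ne (Finset.ne_of_mem_erase hj)]
  rw [interaction, h1, Finset.sum_add_distrib, interactionWithout]
  ring

lemma ae_ne_all (X : Fin N → T3) : ∀ᵐ x : T3, ∀ j, x - X j ≠ 0 := by
  rw [ae_all_iff]
  intro j
  have : MeasurePreserving (fun x : T3 => x - X j) volume volume :=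
    measurePreserving_sub_right volume (X j)
  exact this.quasiMeasurePreserving.ae ae_ne_zero

lemma Admissible.weight_le (hφ : Admissible φ φmin A α) (hmin : φmin ≤ 0) (hβ : 0 < β)
    (i : Fin N) (X : Fin N → T3) {x : T3} (hx : ∀ j, x - X j ≠ 0) :
    Real.exp (-β * (1 / (N : ℝ) * ∑ j ∈ Finset.univ.erase i, φ (x - X j))) ≤
      Real.exp (-β * φmin) := by
  refine Real.exp_le_exp.2 (mul_le_mul_of_nonpos_left ?_ (by linarith))
  have hN : (0 : ℝ) < N := by exact_mod_cast i.pos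
  have h1 : ∑ j ∈ Finset.univ.erase i, φmin ≤ ∑ j ∈ Finset.univ.erase i, φ (x - X j) :=
    Finset.sum_le_sum fun j _ => hφ.lower _ (hx j)
  have h2 : (N : ℝ) * φmin ≤ ∑ j ∈ Finset.univ.erase i, φmin := by
    rw [Finset.sum_const, nsmul_eq_mul]
    refine mul_le_mul_of_nonpos_right ?_ hmin
    have := Finset.card_le_univ (Finset.univ.erase i)
    rw [Fintype.card_fin] at this
    exact_mod_cast this
  rw [one_div, inv_mul_eq_div, le_div_iff₀ hN]
  linarith

/-- Jensen in the form `exp y ≥ 1 + y`: the exponent has zero integral because `φ` has zero average,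
and the torus has mass one. -/
lemma Admissible.one_le_lintegral_weight (hφ : Admissible φ φmin A α) (hA : 0 ≤ A) (hα2 : α < 2)
    (hmin : φmin ≤ 0) (hβ : 0 < β) (i : Fin N) (X : Fin N → T3) :
    1 ≤ ∫⁻ x, ENNReal.ofReal
      (Real.exp (-β * (1 / (N : ℝ) * ∑ j ∈ Finset.univ.erase i, φ (x - X j)))) := by
  have hint : ∀ j, Integrable fun x => φ (x - X j) := fun j =>
    (hφ.integrable hA hα2).comp_sub_right (X j)
  have hsum : Integrable fun x => -β * (1 / (N : ℝ) * ∑ j ∈ Finset.univ.erase i, φ (x - X j)) :=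
    ((integrable_finsetSum _ fun j _ => hint j).const_mul _).const_mul _
  have hexp : Integrable fun x =>
      Real.exp (-β * (1 / (N : ℝ) * ∑ j ∈ Finset.univ.erase i, φ (x - X j))) := by
    refine Integrable.mono' (integrable_const (Real.exp (-β * φmin)))
      (Real.continuous_exp.comp_aestronglyMeasurable hsum.1) ?_
    filter_upwards [ae_ne_all X] with x hx
    rw [Real.norm_of_nonneg (Real.exp_nonneg _)]
    exact hφ.weight_le hmin hβ i X hx
  rw [← ofReal_integral_eq_lintegral_ofReal hexp (ae_of_all _ fun x => Real.exp_nonneg _),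
    ENNReal.one_le_ofReal]
  have h0 : ∫ x, -β * (1 / (N : ℝ) * ∑ j ∈ Finset.univ.erase i, φ (x - X j)) = 0 := by
    rw [integral_const_mul, integral_const_mul, integral_finsetSum _ fun j _ => hint j]
    have : ∀ j, ∫ x, φ (x - X j) = 0 := fun j => by
      rw [integral_sub_right_eq_self (μ := volume) φ (X j), hφ.average]
    simp [this]
  calc (1 : ℝ) = ∫ x, (-β * (1 / (N : ℝ) * ∑ j ∈ Finset.univ.erase i, φ (x - X j)) + 1) := by
        rw [integral_add hsum (integrable_const _), h0]; simp
    _ ≤ _ := integral_mono (hsum.add (integrable_const _)) hexp fun x => Real.add_one_le_exp _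

/-- Given the other particles, the law of one particle has a density at most `exp (-β φmin)`. -/
lemma Admissible.lintegral_update_le (hφ : Admissible φ φmin A α) (hA : 0 ≤ A) (hα2 : α < 2)
    (hmin : φmin ≤ 0) (hβ : 0 < β) (i : Fin N) (X : Fin N → T3) {h : T3 → ℝ≥0∞}
    (hh : Measurable h) :
    ∫⁻ x, h x * posWeight φ β (Function.update X i x) ≤
      ENNReal.ofReal (Real.exp (-β * φmin)) * (∫⁻ x, h x) *
        ∫⁻ x, posWeight φ β (Function.update X i x) := by
  set W : T3 → ℝ≥0∞ := fun x => ENNReal.ofReal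
      (Real.exp (-β * (1 / (N : ℝ) * ∑ j ∈ Finset.univ.erase i, φ (x - X j)))) with hW
  set e₀ : ℝ≥0∞ := ENNReal.ofReal (Real.exp (-β * interactionWithout φ i X)) with he₀
  set c := ENNReal.ofReal (Real.exp (-β * φmin)) with hc
  have hpos : ∀ x, posWeight φ β (Function.update X i x) = W x * e₀ := fun x => by
    rw [posWeight, interaction_update hφ.even, mul_add, Real.exp_add,
      ENNReal.ofReal_mul (Real.exp_nonneg _)]
  have hWm : Measurable W := by
    refine (Real.measurable_exp.comp (Measurable.const_mul (Measurable.const_mul ?_ _) _)).ennreal_ofReal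
    exact Finset.measurable_sum _ fun j _ => hφ.measurable.comp (measurable_id.sub_const _)
  simp only [hpos]
  rw [lintegral_mul_const _ hWm]
  calc ∫⁻ x, h x * (W x * e₀) ≤ ∫⁻ x, h x * (c * e₀) := by
        refine lintegral_mono_ae ?_
        filter_upwards [ae_ne_all X] with x hx
        gcongr
        exact ENNReal.ofReal_le_ofReal (hφ.weight_le hmin hβ i X hx)
    _ = c * (∫⁻ x, h x) * (1 * e₀) := by rw [lintegral_mul_const _ hh]; ring
    _ ≤ _ := by
        gcongr
        exact hφ.one_le_lintegral_weight hA hα2 hmin hβ i X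

instance isNegInvariantT3 : (volume : Measure T3).IsNegInvariant :=
  Measure.IsAddHaarMeasure.isNegInvariant_of_regular _

/-- Only particle `j` is integrated out, by the one-particle density bound. The spectator factor
`P`, blind to particle `j`, allows iteration over several particles. -/
lemma Admissible.lintegral_pair_le (hφ : Admissible φ φmin A α) (hA : 0 ≤ A) (hα2 : α < 2)
    (hmin : φmin ≤ 0) (hβ : 0 < β) {i j : Fin N} (hij : i ≠ j) {h : T3 → ℝ≥0∞}
    (hh : Measurable h) {P : (Fin N → T3) → ℝ≥0∞} (hP : Measurable P)
    (hPj : ∀ X x, P (Function.update X j x) = P X) :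
    ∫⁻ X, P X * (h (X i - X j) * posWeight φ β X) ≤
      ENNReal.ofReal (Real.exp (-β * φmin)) * (∫⁻ x, h x) * ∫⁻ X, P X * posWeight φ β X := by
  set c := ENNReal.ofReal (Real.exp (-β * φmin)) with hc
  have hw : Measurable (posWeight (N := N) φ β) := measurable_posWeight hφ.measurable
  have hhij : Measurable fun X : Fin N → T3 => h (X i - X j) :=
    hh.comp ((measurable_pi_apply i).sub (measurable_pi_apply j))
  have hPw : Measurable fun X => P X * posWeight φ β X := hP.mul hw
  rw [← lintegral_const_mul _ hPw]
  refine lintegral_le_of_lmarginal_le (μ := fun _ => (volume : Measure T3)) {j}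
    (hP.mul (hhij.mul hw)) (hPw.const_mul _) ?_
  intro X
  rw [lmarginal_singleton, lmarginal_singleton]
  simp only [hPj, Function.update_self, Function.update_of_ne hij]
  have hwu : Measurable fun x => posWeight φ β (Function.update X j x) :=
    hw.comp (measurable_update X)
  have hhx : Measurable fun x => h (X i - x) := hh.comp (measurable_id.const_sub _)
  have hhw : Measurable fun x => h (X i - x) * posWeight φ β (Function.update X j x) :=
    hhx.mul hwu
  rw [lintegral_const_mul _ hhw, lintegral_const_mul _ (hwu.const_mul _),
    lintegral_const_mul _ hwu]
  have h1 := hφ.lintegral_update_le hA hα2 hmin hβ j X hhx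
  rw [lintegral_sub_left_eq_self h (X i)] at h1
  calc _ ≤ P X * (c * (∫⁻ x, h x) * ∫⁻ x, posWeight φ β (Function.update X j x)) := by gcongr
    _ = _ := by ring

lemma Admissible.lintegral_pair_weight_le (hφ : Admissible φ φmin A α) (hA : 0 ≤ A) (hα2 : α < 2)
    (hmin : φmin ≤ 0) (hβ : 0 < β) {i j : Fin N} (hij : i ≠ j) {h : T3 → ℝ≥0∞}
    (hh : Measurable h) :
    ∫⁻ X : Fin N → T3, h (X i - X j) * posWeight φ β X ≤
      ENNReal.ofReal (Real.exp (-β * φmin)) * (∫⁻ x, h x) * ∫⁻ X : Fin N → T3, posWeight φ β X := by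
  simpa using hφ.lintegral_pair_le hA hα2 hmin hβ hij hh (P := fun _ => 1) measurable_const
    (fun _ _ => rfl)

/-- The Gibbs weight does not factor over the particles, yet the factors can be peeled off one by
one: the remaining product does not see the particle just integrated out. -/
lemma Admissible.lintegral_prod_weight_le (hφ : Admissible φ φmin A α) (hA : 0 ≤ A) (hα2 : α < 2)
    (hmin : φmin ≤ 0) (hβ : 0 < β) (i : Fin N) {h : T3 → ℝ≥0∞} (hh : Measurable h)
    (s : Finset (Fin N)) (hs : i ∉ s) :
    ∫⁻ X : Fin N → T3, (∏ j ∈ s, (1 + h (X i - X j))) * posWeight φ β X ≤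
      (1 + ENNReal.ofReal (Real.exp (-β * φmin)) * ∫⁻ x, h x) ^ s.card *
        ∫⁻ X : Fin N → T3, posWeight φ β X := by
  set c := ENNReal.ofReal (Real.exp (-β * φmin)) with hc
  have hw : Measurable (posWeight (N := N) φ β) := measurable_posWeight hφ.measurable
  have hhm : ∀ j, Measurable fun X : Fin N → T3 => h (X i - X j) := fun j =>
    hh.comp ((measurable_pi_apply i).sub (measurable_pi_apply j))
  have hPm : ∀ s : Finset (Fin N), Measurable fun X : Fin N → T3 =>
      ∏ j ∈ s, (1 + h (X i - X j)) := fun s =>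
    Finset.measurable_prod _ fun j _ => (hhm j).const_add _
  have hPw : ∀ s : Finset (Fin N), Measurable fun X : Fin N → T3 =>
      (∏ j ∈ s, (1 + h (X i - X j))) * posWeight φ β X := fun s => (hPm s).mul hw
  induction s using Finset.induction_on with
  | empty => simp
  | insert j s hj ih =>
    rw [Finset.mem_insert, not_or] at hs
    have hPj : ∀ (X : Fin N → T3) x, ∏ k ∈ s,
        (1 + h (Function.update X j x i - Function.update X j x k)) =
        ∏ k ∈ s, (1 + h (X i - X k)) := fun X x => by
      refine Finset.prod_congr rfl fun k hk => ?_
      rw [Function.update_of_ne hs.1, Function.update_of_ne (ne_of_mem_of_not_mem hk hj)]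
    have hpair := hφ.lintegral_pair_le hA hα2 hmin hβ hs.1 hh (hPm s) hPj
    rw [← hc] at hpair
    calc ∫⁻ X : Fin N → T3, (∏ k ∈ insert j s, (1 + h (X i - X k))) * posWeight φ β X
        = (∫⁻ X : Fin N → T3, (∏ k ∈ s, (1 + h (X i - X k))) * posWeight φ β X) +
          ∫⁻ X : Fin N → T3, (∏ k ∈ s, (1 + h (X i - X k))) *
            (h (X i - X j) * posWeight φ β X) := by
          rw [← lintegral_add_left (hPw s)]
          refine lintegral_congr fun X => ?_
          rw [Finset.prod_insert hj]; ring
      _ ≤ (1 + c * ∫⁻ x, h x) *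
          ∫⁻ X : Fin N → T3, (∏ k ∈ s, (1 + h (X i - X k))) * posWeight φ β X := by
          rw [add_mul, one_mul]; gcongr
      _ ≤ (1 + c * ∫⁻ x, h x) * ((1 + c * ∫⁻ x, h x) ^ s.card * _) := by
          exact mul_le_mul_right (ih hs.2) _
      _ = _ := by rw [Finset.card_insert_of_notMem hj, pow_succ]; ring

/-- The kinetic Gibbs weight. -/
noncomputable def velWeight (β : ℝ) (V : Fin N → E3) : ℝ≥0∞ :=
  ENNReal.ofReal (Real.exp (-β * ∑ i, ‖V i‖ ^ 2 / 2))

lemma measurable_velWeight : Measurable (velWeight (N := N) β) := by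
  unfold velWeight; fun_prop

lemma energy_eq (Z : Phase N) :
    energy φ Z = ∑ i, ‖Z.2 i‖ ^ 2 / 2 + interaction φ Z.1 := rfl

lemma exp_energy_eq (Z : Phase N) :
    ENNReal.ofReal (Real.exp (-β * energy φ Z)) = posWeight φ β Z.1 * velWeight β Z.2 := by
  rw [energy_eq, mul_add, Real.exp_add, ENNReal.ofReal_mul (Real.exp_nonneg _), mul_comm]; rfl

lemma measurable_energy (hφ : Measurable φ) : Measurable (energy (N := N) φ) := by
  have h1 : Measurable fun Z : Phase N => ∑ i, ‖Z.2 i‖ ^ 2 / 2 := by fun_prop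
  exact h1.add ((measurable_interaction hφ).comp measurable_fst)

lemma measurable_gibbsWeight (hφ : Measurable φ) :
    Measurable fun Z : Phase N => ENNReal.ofReal (Real.exp (-β * energy φ Z)) :=
  (Real.measurable_exp.comp ((measurable_energy hφ).const_mul _)).ennreal_ofReal

lemma lintegral_gibbs (hφ : Measurable φ) {f : Phase N → ℝ≥0∞} (hf : Measurable f) :
    ∫⁻ Z, f Z ∂(gibbs N φ β) = (partitionFn N φ β)⁻¹ *
      ∫⁻ Z, ENNReal.ofReal (Real.exp (-β * energy φ Z)) * f Z := by
  rw [gibbs, lintegral_smul_measure, lintegral_withDensity_eq_lintegral_mul _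
    (measurable_gibbsWeight hφ) hf]
  rfl

lemma lintegral_gibbsWeight_pos (hφ : Measurable φ) {f : (Fin N → T3) → ℝ≥0∞}
    (hf : Measurable f) :
    ∫⁻ Z : Phase N, ENNReal.ofReal (Real.exp (-β * energy φ Z)) * f Z.1 =
      (∫⁻ X, f X * posWeight φ β X) * ∫⁻ V : Fin N → E3, velWeight β V := by
  have hfw : Measurable fun X => f X * posWeight φ β X := hf.mul (measurable_posWeight hφ)
  rw [← lintegral_prod_mul hfw.aemeasurable measurable_velWeight.aemeasurable]
  refine lintegral_congr fun Z => ?_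
  rw [exp_energy_eq]; ring

/-- The velocity integral appears in both numerator and normalization. Since `x⁻¹ * x ≤ 1` always
holds in `ℝ≥0∞`, the partition function need not be shown finite or nonzero. -/
lemma lintegral_gibbs_le_of_pos (hφ : Measurable φ) {f : (Fin N → T3) → ℝ≥0∞}
    (hf : Measurable f) {b : ℝ≥0∞}
    (h : ∫⁻ X, f X * posWeight φ β X ≤ b * ∫⁻ X : Fin N → T3, posWeight φ β X) :
    ∫⁻ Z, f Z.1 ∂(gibbs N φ β) ≤ b := by
  have hf1 : Measurable fun Z : Phase N => f Z.1 := hf.comp measurable_fst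
  rw [lintegral_gibbs hφ hf1, lintegral_gibbsWeight_pos hφ hf]
  have hB : partitionFn N φ β =
      (∫⁻ X : Fin N → T3, posWeight φ β X) * ∫⁻ V : Fin N → E3, velWeight β V := by
    have := lintegral_gibbsWeight_pos (N := N) (β := β) hφ (f := fun _ => 1) measurable_const
    unfold partitionFn
    simpa only [mul_one, one_mul] using this
  calc _ ≤ (partitionFn N φ β)⁻¹ * (b * partitionFn N φ β) := by
        rw [hB, ← mul_assoc b]; gcongr
    _ = b * ((partitionFn N φ β)⁻¹ * partitionFn N φ β) := by ring
    _ ≤ b * 1 := by gcongr; exact ENNReal.inv_mul_le_one _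
    _ = b := mul_one b

lemma gibbs_univ_le_one (hφ : Measurable φ) : gibbs N φ β univ ≤ 1 := by
  have := lintegral_gibbs_le_of_pos (N := N) (β := β) hφ (f := fun _ => 1) (b := 1)
    measurable_const (by simp)
  simpa using this

/-- The rate of growth of the logarithmic distance between two trajectories. The exponential
sum is a smooth upper bound of the maximum over the particles. -/
noncomputable def stabilityRate (G B : T3 → ℝ) (κ L δ : ℝ) (X : Fin N → T3) : ℝ :=
  2 * (κ / N * (L + Real.exp (-L) *
    ∑ i, Real.exp (∑ j ∈ Finset.univ.erase i, G (X i - X j) / κ))) +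
  1 / (2 * (N : ℝ) ^ 2 * δ) * ∑ i, ∑ j ∈ Finset.univ.erase i, B (X i - X j)

lemma measurable_stabilityRate {G B : T3 → ℝ} (hG : Measurable G) (hB : Measurable B)
    (κ L δ : ℝ) : Measurable (stabilityRate (N := N) G B κ L δ) := by
  have hsub : ∀ i j, Measurable fun X : Fin N → T3 => X i - X j := fun i j =>
    (measurable_pi_apply i).sub (measurable_pi_apply j)
  unfold stabilityRate
  refine Measurable.add ?_ ?_
  · refine (((Measurable.const_mul ?_ _).const_add _).const_mul _).const_mul _
    refine Finset.measurable_sum _ fun i _ => Real.measurable_exp.comp ?_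
    exact Finset.measurable_sum _ fun j _ => (hG.comp (hsub i j)).div_const _
  · refine Measurable.const_mul ?_ _
    exact Finset.measurable_sum _ fun i _ => Finset.measurable_sum _ fun j _ => hB.comp (hsub i j)

lemma stabilityRate_nonneg {G B : T3 → ℝ} {κ L δ : ℝ} (hκ : 0 ≤ κ) (hL : 0 ≤ L) (hδ : 0 ≤ δ)
    (hB : ∀ z, 0 ≤ B z) (X : Fin N → T3) : 0 ≤ stabilityRate G B κ L δ X := by
  have h1 : 0 ≤ ∑ i, ∑ j ∈ Finset.univ.erase i, B (X i - X j) :=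
    Finset.sum_nonneg fun i _ => Finset.sum_nonneg fun j _ => hB _
  unfold stabilityRate
  positivity

/-- From `T ≤ L + exp (T - L)`: the right-hand side no longer depends on `i`, so it bounds the
maximum by a quantity whose mean is computable. -/
lemma sum_div_le_of_exp_sum {G : T3 → ℝ} {κ L : ℝ} (hκ : 0 < κ) (X : Fin N → T3) (i : Fin N) :
    1 / (N : ℝ) * ∑ j ∈ Finset.univ.erase i, G (X i - X j) ≤
      κ / N * (L + Real.exp (-L) *
        ∑ i, Real.exp (∑ j ∈ Finset.univ.erase i, G (X i - X j) / κ)) := by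
  set T : Fin N → ℝ := fun i => ∑ j ∈ Finset.univ.erase i, G (X i - X j) / κ with hT
  have h1 : T i ≤ L + Real.exp (-L) * Real.exp (T i) := by
    rw [← Real.exp_add]
    linarith [Real.add_one_le_exp (-L + T i)]
  have h2 : Real.exp (T i) ≤ ∑ i, Real.exp (T i) :=
    Finset.single_le_sum (f := fun i => Real.exp (T i)) (fun _ _ => Real.exp_nonneg _)
      (Finset.mem_univ i)
  have h3 : ∑ j ∈ Finset.univ.erase i, G (X i - X j) = κ * T i := by
    simp only [hT]
    rw [← Finset.sum_div]; field_simp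
  rw [h3]
  calc 1 / (N : ℝ) * (κ * T i) = κ / N * T i := by ring
    _ ≤ _ := by
      gcongr
      refine h1.trans ?_
      gcongr

/-- Dividing by `κ ≥ sup G` puts the exponents in `[0, 1]`, where `exp y - 1 ≤ 2y`. The exponential
of the sum is a product of `1 + h`, so its mean is at most `(1 + 2cI/κ)^N`. -/
lemma Admissible.lintegral_exp_sum_le (hφ : Admissible φ φmin A α) (hA : 0 ≤ A) (hα2 : α < 2)
    (hmin : φmin ≤ 0) (hβ : 0 < β) (i : Fin N) {G : T3 → ℝ} (hG : Measurable G) {κ I : ℝ}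
    (hκ : 0 < κ) (hI : 0 ≤ I) (hG0 : ∀ z, 0 ≤ G z) (hGκ : ∀ z, G z ≤ κ)
    (hGI : ∫⁻ z, ENNReal.ofReal (G z) ≤ ENNReal.ofReal I) :
    ∫⁻ Z : Phase N, ENNReal.ofReal
      (Real.exp (∑ j ∈ Finset.univ.erase i, G (Z.1 i - Z.1 j) / κ)) ∂(gibbs N φ β) ≤
      ENNReal.ofReal (Real.exp (2 * N * Real.exp (-β * φmin) * I / κ)) := by
  have hsub : ∀ i j, Measurable fun X : Fin N → T3 => X i - X j := fun i j =>
    (measurable_pi_apply i).sub (measurable_pi_apply j)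
  set h : T3 → ℝ≥0∞ := fun z => ENNReal.ofReal (Real.exp (G z / κ) - 1) with hh
  have hhm : Measurable h :=
    ((Real.measurable_exp.comp (hG.div_const κ)).sub_const 1).ennreal_ofReal
  have hhI : ∫⁻ z, h z ≤ ENNReal.ofReal (2 * I / κ) := by
    calc ∫⁻ z, h z ≤ ∫⁻ z, ENNReal.ofReal (2 / κ) * ENNReal.ofReal (G z) := by
          refine lintegral_mono fun z => ?_
          rw [← ENNReal.ofReal_mul (by positivity)]
          refine ENNReal.ofReal_le_ofReal ?_
          have h0 : 0 ≤ G z / κ := div_nonneg (hG0 z) hκ.le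
          have h1 : G z / κ ≤ 1 := (div_le_one hκ).2 (hGκ z)
          have := Real.abs_exp_sub_one_le (x := G z / κ) (by rwa [abs_of_nonneg h0])
          rw [abs_of_nonneg h0] at this
          calc _ ≤ _ := le_abs_self _
            _ ≤ _ := this
            _ = _ := by ring
      _ ≤ ENNReal.ofReal (2 / κ) * ENNReal.ofReal I := by
          rw [lintegral_const_mul _ hG.ennreal_ofReal]; gcongr
      _ = _ := by rw [← ENNReal.ofReal_mul (by positivity)]; congr 1; ring
  have hprod : ∀ X : Fin N → T3,
      ENNReal.ofReal (Real.exp (∑ j ∈ Finset.univ.erase i, G (X i - X j) / κ)) =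
      ∏ j ∈ Finset.univ.erase i, (1 + h (X i - X j)) := fun X => by
    rw [Real.exp_sum, ENNReal.ofReal_prod_of_nonneg fun _ _ => Real.exp_nonneg _]
    refine Finset.prod_congr rfl fun j _ => ?_
    have h0 : 0 ≤ G (X i - X j) / κ := div_nonneg (hG0 _) hκ.le
    rw [hh, ← ENNReal.ofReal_one, ← ENNReal.ofReal_add zero_le_one
      (by linarith [Real.one_le_exp h0])]
    congr 1; ring
  set c := Real.exp (-β * φmin) with hc
  have hc0 : 0 ≤ c := Real.exp_nonneg _
  have hcard : ((Finset.univ.erase i).card : ℝ) ≤ N := by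
    have := Finset.card_le_univ (Finset.univ.erase i)
    rw [Fintype.card_fin] at this
    exact_mod_cast this
  have hfin : (1 + ENNReal.ofReal c * ∫⁻ z, h z) ^ (Finset.univ.erase i).card ≤
      ENNReal.ofReal (Real.exp (2 * N * c * I / κ)) := by
    calc _ ≤ (1 + ENNReal.ofReal c * ENNReal.ofReal (2 * I / κ)) ^ (Finset.univ.erase i).card := by
          gcongr
      _ = ENNReal.ofReal ((1 + c * (2 * I / κ)) ^ (Finset.univ.erase i).card) := by
          rw [← ENNReal.ofReal_mul hc0, ← ENNReal.ofReal_one,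
            ← ENNReal.ofReal_add zero_le_one (by positivity), ENNReal.ofReal_pow (by positivity)]
      _ ≤ _ := by
          refine ENNReal.ofReal_le_ofReal ?_
          calc _ ≤ Real.exp (c * (2 * I / κ)) ^ (Finset.univ.erase i).card := by
                gcongr
                linarith [Real.add_one_le_exp (c * (2 * I / κ))]
            _ = Real.exp ((Finset.univ.erase i).card * (c * (2 * I / κ))) := by
                rw [← Real.exp_nat_mul]
            _ ≤ Real.exp (N * (c * (2 * I / κ))) := by gcongr
            _ = _ := by congr 1; ring
  refine lintegral_gibbs_le_of_pos hφ.measurable (f := fun X => ENNReal.ofReal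
      (Real.exp (∑ j ∈ Finset.univ.erase i, G (X i - X j) / κ))) ?_ ?_
  · exact (Real.measurable_exp.comp (Finset.measurable_sum _ fun j _ =>
      (hG.comp (hsub i j)).div_const _)).ennreal_ofReal
  · simp only [hprod]
    refine (hφ.lintegral_prod_weight_le hA hα2 hmin hβ i hhm _ (Finset.notMem_erase i _)).trans ?_
    gcongr

lemma Admissible.lintegral_gibbs_pair_le (hφ : Admissible φ φmin A α) (hA : 0 ≤ A) (hα2 : α < 2)
    (hmin : φmin ≤ 0) (hβ : 0 < β) {i j : Fin N} (hij : i ≠ j) {h : T3 → ℝ≥0∞}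
    (hh : Measurable h) :
    ∫⁻ Z : Phase N, h (Z.1 i - Z.1 j) ∂(gibbs N φ β) ≤
      ENNReal.ofReal (Real.exp (-β * φmin)) * ∫⁻ x, h x :=
  lintegral_gibbs_le_of_pos hφ.measurable
    (hh.comp ((measurable_pi_apply i).sub (measurable_pi_apply j)))
    (hφ.lintegral_pair_weight_le hA hα2 hmin hβ hij hh)

/-- The level `L` is the logarithm of the bound for the summed exponential moments, so their
contribution after the factor `exp (-L)` is one, and `κ L/N` produces the logarithm together with
the integral of `G`. -/
theorem Admissible.lintegral_stabilityRate_le (hφ : Admissible φ φmin A α) (hA : 0 ≤ A)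
    (hα2 : α < 2) (hmin : φmin ≤ 0) (hβ : 0 < β) (hN : 1 ≤ N) {G B : T3 → ℝ} {κ I J δ L : ℝ}
    (hK : KernelBound φ G B κ) (hκ : 0 < κ) (hI : 0 ≤ I) (hJ : 0 ≤ J) (hδ : 0 < δ)
    (hGI : ∫⁻ z, ENNReal.ofReal (G z) ≤ ENNReal.ofReal I)
    (hBJ : ∫⁻ z, ENNReal.ofReal (B z) ≤ ENNReal.ofReal J)
    (hL : L = Real.log N + 2 * N * Real.exp (-β * φmin) * I / κ) :
    ∫⁻ Z : Phase N, ENNReal.ofReal (stabilityRate G B κ L δ Z.1) ∂(gibbs N φ β) ≤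
      ENNReal.ofReal (2 * (κ * (Real.log N + 1) / N + 2 * Real.exp (-β * φmin) * I) +
        Real.exp (-β * φmin) * J / (2 * δ)) := by
  have hN0 : (0 : ℝ) < N := by exact_mod_cast hN
  have hN1 : (1 : ℝ) ≤ N := by exact_mod_cast hN
  set c := Real.exp (-β * φmin) with hc
  have hc0 : 0 < c := Real.exp_pos _
  have hlog : 0 ≤ Real.log N := Real.log_nonneg hN1
  have hL0 : 0 ≤ L := by rw [hL]; positivity
  have hG := hK.measurable_G
  have hB := hK.measurable_B
  have hsub : ∀ i j, Measurable fun Z : Phase N => Z.1 i - Z.1 j := fun i j =>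
    ((measurable_pi_apply i).comp measurable_fst).sub ((measurable_pi_apply j).comp measurable_fst)
  have hexpm : ∀ i, Measurable fun Z : Phase N => ENNReal.ofReal
      (Real.exp (∑ j ∈ Finset.univ.erase i, G (Z.1 i - Z.1 j) / κ)) := fun i =>
    (Real.measurable_exp.comp (Finset.measurable_sum _ fun j _ =>
      (hG.comp (hsub i j)).div_const _)).ennreal_ofReal
  have hBm : ∀ i j, Measurable fun Z : Phase N => ENNReal.ofReal (B (Z.1 i - Z.1 j)) := fun i j =>
    (hB.comp (hsub i j)).ennreal_ofReal
  have hsplit : ∀ Z : Phase N, ENNReal.ofReal (stabilityRate G B κ L δ Z.1) =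
      (ENNReal.ofReal (2 * (κ / N * L)) + ENNReal.ofReal (2 * (κ / N * Real.exp (-L))) *
        ∑ i, ENNReal.ofReal (Real.exp (∑ j ∈ Finset.univ.erase i, G (Z.1 i - Z.1 j) / κ))) +
      ENNReal.ofReal (1 / (2 * (N : ℝ) ^ 2 * δ)) *
        ∑ i, ∑ j ∈ Finset.univ.erase i, ENNReal.ofReal (B (Z.1 i - Z.1 j)) := by
    intro Z
    have h1 : ∀ i, ∑ j ∈ Finset.univ.erase i, ENNReal.ofReal (B (Z.1 i - Z.1 j)) =
        ENNReal.ofReal (∑ j ∈ Finset.univ.erase i, B (Z.1 i - Z.1 j)) := fun i =>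
      (ENNReal.ofReal_sum_of_nonneg fun j _ => hK.B_nonneg _).symm
    have h2 : ∀ i, 0 ≤ ∑ j ∈ Finset.univ.erase i, B (Z.1 i - Z.1 j) := fun i =>
      Finset.sum_nonneg fun j _ => hK.B_nonneg _
    have h3 : 0 ≤ ∑ i, ∑ j ∈ Finset.univ.erase i, B (Z.1 i - Z.1 j) :=
      Finset.sum_nonneg fun i _ => h2 i
    simp only [h1]
    rw [← ENNReal.ofReal_sum_of_nonneg fun i _ => h2 i,
      ← ENNReal.ofReal_sum_of_nonneg fun i _ => Real.exp_nonneg _,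
      ← ENNReal.ofReal_mul (by positivity), ← ENNReal.ofReal_mul (by positivity),
      ← ENNReal.ofReal_add (by positivity) (by positivity),
      ← ENNReal.ofReal_add (by positivity) (by positivity), stabilityRate]
    congr 1; ring
  simp only [hsplit]
  rw [lintegral_add_right _ (Measurable.const_mul (Finset.measurable_sum _ fun i _ =>
      Finset.measurable_sum _ fun j _ => hBm i j) _),
    lintegral_add_left measurable_const, lintegral_const,
    lintegral_const_mul _ (Finset.measurable_sum _ fun i _ => hexpm i),
    lintegral_const_mul _ (Finset.measurable_sum _ fun i _ =>
      Finset.measurable_sum _ fun j _ => hBm i j),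
    lintegral_finsetSum _ fun i _ => hexpm i,
    lintegral_finsetSum _ fun i _ => Finset.measurable_sum _ fun j _ => hBm i j]
  simp only [lintegral_finsetSum _ fun j _ => hBm _ j]
  have hcard : ∀ i : Fin N, ((Finset.univ.erase i).card : ℝ) ≤ N := fun i => by
    have := Finset.card_le_univ (Finset.univ.erase i)
    rw [Fintype.card_fin] at this
    exact_mod_cast this
  have e1 : ∑ i : Fin N, ∫⁻ Z : Phase N, ENNReal.ofReal
      (Real.exp (∑ j ∈ Finset.univ.erase i, G (Z.1 i - Z.1 j) / κ)) ∂(gibbs N φ β) ≤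
      ENNReal.ofReal (Real.exp L) := by
    calc _ ≤ ∑ i : Fin N, ENNReal.ofReal (Real.exp (2 * N * c * I / κ)) :=
          Finset.sum_le_sum fun i _ =>
            hφ.lintegral_exp_sum_le hA hα2 hmin hβ i hG hκ hI hK.G_nonneg hK.G_le hGI
      _ = ENNReal.ofReal (N * Real.exp (2 * N * c * I / κ)) := by
          rw [ENNReal.ofReal_mul hN0.le]; simp
      _ = _ := by rw [hL, Real.exp_add, Real.exp_log hN0]
  have e2 : ∑ i : Fin N, ∑ j ∈ Finset.univ.erase i,
      ∫⁻ Z : Phase N, ENNReal.ofReal (B (Z.1 i - Z.1 j)) ∂(gibbs N φ β) ≤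
      ENNReal.ofReal ((N : ℝ) ^ 2 * (c * J)) := by
    calc _ ≤ ∑ i : Fin N, ∑ j ∈ Finset.univ.erase i, ENNReal.ofReal (c * J) := by
          refine Finset.sum_le_sum fun i _ => Finset.sum_le_sum fun j hj => ?_
          refine (hφ.lintegral_gibbs_pair_le hA hα2 hmin hβ (Finset.ne_of_mem_erase hj).symm
            hB.ennreal_ofReal).trans ?_
          rw [ENNReal.ofReal_mul hc0.le]
          gcongr
      _ ≤ ∑ i : Fin N, ENNReal.ofReal (N * (c * J)) := by
          refine Finset.sum_le_sum fun i _ => ?_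
          rw [Finset.sum_const, nsmul_eq_mul, ← ENNReal.ofReal_natCast,
            ← ENNReal.ofReal_mul (by positivity)]
          refine ENNReal.ofReal_le_ofReal ?_
          have := hcard i
          gcongr
      _ = _ := by
          rw [Finset.sum_const, nsmul_eq_mul, Finset.card_univ, Fintype.card_fin,
            ← ENNReal.ofReal_natCast, ← ENNReal.ofReal_mul (by positivity)]
          congr 1; ring
  have hmass := gibbs_univ_le_one (N := N) (β := β) hφ.measurable
  calc _ ≤ (ENNReal.ofReal (2 * (κ / N * L)) * 1 +
        ENNReal.ofReal (2 * (κ / N * Real.exp (-L))) * ENNReal.ofReal (Real.exp L)) +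
        ENNReal.ofReal (1 / (2 * (N : ℝ) ^ 2 * δ)) * ENNReal.ofReal ((N : ℝ) ^ 2 * (c * J)) := by
        gcongr
    _ = _ := by
        rw [mul_one, ← ENNReal.ofReal_mul (by positivity), ← ENNReal.ofReal_mul (by positivity),
          ← ENNReal.ofReal_add (by positivity) (by positivity),
          ← ENNReal.ofReal_add (by positivity) (by positivity)]
        congr 1
        have h1 : 2 * (κ / N * Real.exp (-L)) * Real.exp L = 2 * (κ / N) := by
          have : Real.exp (-L) * Real.exp L = 1 := by rw [← Real.exp_add]; simp
          calc _ = 2 * (κ / N) * (Real.exp (-L) * Real.exp L) := by ring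
            _ = _ := by rw [this, mul_one]
        rw [h1, hL]
        field_simp
        ring

end Gibbs

end NParticle

namespace NParticle

/-! ### Cut-off flows, conservation of energy and of the Gibbs measure -/

section Cutoff

variable {N : ℕ} {φ : T3 → ℝ} {φmin A α β : ℝ}

/-- The acceleration of the particles at given positions. -/
noncomputable def meanForce (φ : T3 → ℝ) (X : Fin N → T3) : Fin N → E3 := fun i =>
  (1 / (N : ℝ)) • ∑ j ∈ Finset.univ.erase i, torusForce φ (X i - X j)

/-- All pairs of particles are at distance at least `η`. -/
def Separated (η : ℝ) (X : Fin N → T3) : Prop := ∀ i j, i ≠ j → η ≤ tnorm (X i - X j)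

lemma Separated.mono {η η' : ℝ} {X : Fin N → T3} (h : Separated η X) (hη : η' ≤ η) :
    Separated η' X := fun i j hij => hη.trans (h i j hij)

lemma Separated.sub_ne_zero {η : ℝ} {X : Fin N → T3} (h : Separated η X) (hη : 0 < η) {i j : Fin N}
    (hij : i ≠ j) : X i - X j ≠ 0 := tnorm_pos.1 (hη.trans_le (h i j hij))

lemma isClosed_separated (η : ℝ) : IsClosed {X : Fin N → T3 | Separated η X} := by
  have : {X : Fin N → T3 | Separated η X} =
      ⋂ i, ⋂ j, ⋂ _ : i ≠ j, {X | η ≤ tnorm (X i - X j)} := by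
    ext X; simp [Separated]
  rw [this]
  refine isClosed_iInter fun i => isClosed_iInter fun j => isClosed_iInter fun _ => ?_
  exact isClosed_le continuous_const
    (continuous_tnorm.comp ((continuous_apply i).sub (continuous_apply j)))

/-- The force is Lipschitz away from the origin and is extended across it as a Lipschitz map. The
extension need not be odd or a gradient, since only separated configurations use the energy. -/
lemma Admissible.exists_cutoffKernel (hφ : Admissible φ φmin A α) (hA : 0 ≤ A) (hα2 : α < 2)
    {η : ℝ} (hη : 0 < η) : ∃ (k : T3 → E3) (L : ℝ≥0), LipschitzWith L k ∧
      ∀ z, η ≤ tnorm z → k z = torusForce φ z := by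
  obtain ⟨L, hL0, hL⟩ := hφ.exists_lipschitz_away hA hα2 hη
  have h : LipschitzOnWith (L.toNNReal * 2) (torusForce φ) {z | η ≤ tnorm z} :=
    LipschitzOnWith.of_dist_le_mul fun z hz w hw => by
      rw [dist_eq_norm, dist_eq_norm]
      refine (hL z w hz hw).trans ?_
      have := tnorm_le_two_mul_norm (z - w)
      calc L * tnorm (z - w) ≤ L * (2 * ‖z - w‖) := by gcongr
        _ = _ := by rw [NNReal.coe_mul, NNReal.coe_ofNat, Real.coe_toNNReal _ hL0, mul_assoc]
  obtain ⟨k, hk, hkeq⟩ := h.extend_finite_dimension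
  exact ⟨k, _, hk, fun z hz => (hkeq hz).symm⟩

lemma lipschitzWith_mean {k : T3 → E3} {L : ℝ≥0} (hk : LipschitzWith L k) :
    LipschitzWith (L * 2) fun (X : Fin N → T3) (i : Fin N) =>
      (1 / (N : ℝ)) • ∑ j ∈ Finset.univ.erase i, k (X i - X j) := by
  refine LipschitzWith.of_dist_le_mul fun X Y => ?_
  rw [dist_pi_le_iff (by positivity)]
  intro i
  have hN : (0 : ℝ) < N := by exact_mod_cast i.pos
  have hcard : ((Finset.univ.erase i).card : ℝ) ≤ N := by
    have := Finset.card_le_univ (Finset.univ.erase i)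
    rw [Fintype.card_fin] at this
    exact_mod_cast this
  rw [dist_smul₀, Real.norm_of_nonneg (by positivity)]
  have h1 : dist (∑ j ∈ Finset.univ.erase i, k (X i - X j))
      (∑ j ∈ Finset.univ.erase i, k (Y i - Y j)) ≤
      ∑ j ∈ Finset.univ.erase i, (L * 2 : ℝ) * dist X Y := by
    refine (dist_sum_sum_le _ _ _).trans (Finset.sum_le_sum fun j _ => ?_)
    refine (hk.dist_le_mul _ _).trans ?_
    rw [mul_assoc]
    gcongr
    refine (dist_sub_sub_le _ _ _ _).trans ?_
    linarith [dist_le_pi_dist X Y i, dist_le_pi_dist X Y j]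
  rw [Finset.sum_const, nsmul_eq_mul] at h1
  calc _ ≤ 1 / (N : ℝ) * ((Finset.univ.erase i).card * ((L * 2 : ℝ) * dist X Y)) := by gcongr
    _ ≤ 1 / (N : ℝ) * (N * ((L * 2 : ℝ) * dist X Y)) := by gcongr
    _ = _ := by rw [← mul_assoc, one_div_mul_cancel hN.ne', one_mul]; push_cast; ring

/-- A global flow that agrees with the Newton system as long as the particles are at
distances at least `η`. -/
structure CutoffFlow (N : ℕ) (φ : T3 → ℝ) (η : ℝ) where
  F : (Fin N → T3) → (Fin N → E3)
  L : ℝ≥0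
  lipschitz : LipschitzWith L F
  eq_meanForce : ∀ X, Separated η X → F X = meanForce φ X
  Φ : ℝ → Phase N → Phase N
  measurable : Measurable (Function.uncurry Φ)
  map_le : ∀ t, Measure.map (Φ t) volume ≤ volume
  apply_curve : ∀ z : ℝ → (Fin N → E3) × (Fin N → E3),
    (∀ t, HasDerivAt z (newtonField (F ∘ projN) (z t)) t) → ∀ t, Φ t (projZ (z 0)) = projZ (z t)

lemma Admissible.nonempty_cutoffFlow (hφ : Admissible φ φmin A α) (hA : 0 ≤ A) (hα2 : α < 2)
    (N : ℕ) {η : ℝ} (hη : 0 < η) : Nonempty (CutoffFlow N φ η) := by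
  obtain ⟨k, L, hk, hkeq⟩ := hφ.exists_cutoffKernel hA hα2 hη
  have hF := lipschitzWith_mean (N := N) hk
  obtain ⟨Φ, h1, h2, h3⟩ := exists_torusFlow hF
  refine ⟨⟨_, _, hF, fun X hX => ?_, Φ, h1, h2, h3⟩⟩
  ext1 i
  simp only [meanForce]
  congr 1
  exact Finset.sum_congr rfl fun j hj => hkeq _ (hX i j (Finset.ne_of_mem_erase hj).symm)

variable {η : ℝ}

namespace CutoffFlow

variable (R : CutoffFlow N φ η)

lemma exists_curve (z₀ : (Fin N → E3) × (Fin N → E3)) :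
    ∃ z : ℝ → (Fin N → E3) × (Fin N → E3), z 0 = z₀ ∧
      ∀ t, HasDerivAt z (newtonField (R.F ∘ projN) (z t)) t := by
  obtain ⟨M, hM⟩ := exists_bound_torus R.lipschitz.continuous
  exact newton_exists (lipschitzWith_comp_projN R.lipschitz) (fun x => hM _) z₀

lemma exists_curve_of (Z : Phase N) :
    ∃ z : ℝ → (Fin N → E3) × (Fin N → E3), projZ (z 0) = Z ∧
      (∀ t, HasDerivAt z (newtonField (R.F ∘ projN) (z t)) t) ∧ ∀ t, R.Φ t Z = projZ (z t) := by
  obtain ⟨z₀, hz₀⟩ := projZ_surjective Z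
  obtain ⟨z, h0, hz⟩ := R.exists_curve z₀
  rw [← h0] at hz₀
  exact ⟨z, hz₀, hz, fun t => by rw [← hz₀]; exact R.apply_curve z hz t⟩

lemma continuous_apply (Z : Phase N) : Continuous fun t => R.Φ t Z := by
  obtain ⟨z, -, hz, h⟩ := R.exists_curve_of Z
  simp only [h]
  exact continuous_projZ.comp (continuous_iff_continuousAt.2 fun t => (hz t).continuousAt)

lemma apply_zero (Z : Phase N) : R.Φ 0 Z = Z := by
  obtain ⟨z, h0, hz, h⟩ := R.exists_curve_of Z
  rw [h, h0]

lemma measurable_apply (t : ℝ) : Measurable (R.Φ t) := R.measurable.of_uncurry_left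

/-- The initial data whose cut-off trajectory stays `η`-separated between the times `0` and `t`. -/
def safe (t : ℝ) : Set (Phase N) := {Z | ∀ u ∈ Icc (0 : ℝ) 1, Separated η (R.Φ (u * t) Z).1}

/-- Separation is a closed condition and trajectories are continuous, so countably many times
suffice; this yields measurability. Times are written `u * t` with `u ∈ [0, 1]` to treat both signs
of `t` at once. -/
lemma mem_safe_iff {t : ℝ} {Z : Phase N} : Z ∈ R.safe t ↔
    ∀ k, Separated η (R.Φ ((TopologicalSpace.denseSeq (Icc (0 : ℝ) 1) k : ℝ) * t) Z).1 := by
  constructor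
  · intro h k
    exact h _ (TopologicalSpace.denseSeq (Icc (0 : ℝ) 1) k).2
  · intro h u hu
    have hc : Continuous fun u : Icc (0 : ℝ) 1 => (R.Φ ((u : ℝ) * t) Z).1 :=
      continuous_fst.comp ((R.continuous_apply Z).comp (continuous_subtype_val.mul_const t))
    exact (TopologicalSpace.denseRange_denseSeq (Icc (0 : ℝ) 1)).induction_on
      (p := fun u : Icc (0 : ℝ) 1 => Separated η (R.Φ ((u : ℝ) * t) Z).1) ⟨u, hu⟩
      ((isClosed_separated η).preimage hc) h

lemma measurableSet_safe_prod : MeasurableSet {p : ℝ × Phase N | p.2 ∈ R.safe p.1} := by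
  simp only [mem_safe_iff, ofPred_forall]
  refine MeasurableSet.iInter fun k => ?_
  have : Measurable fun p : ℝ × Phase N =>
      (R.Φ ((TopologicalSpace.denseSeq (Icc (0 : ℝ) 1) k : ℝ) * p.1) p.2).1 :=
    measurable_fst.comp (R.measurable.comp ((measurable_fst.const_mul _).prodMk measurable_snd))
  exact this (isClosed_separated η).measurableSet

lemma measurableSet_safe (t : ℝ) : MeasurableSet (R.safe t) :=
  measurable_prodMk_left R.measurableSet_safe_prod

lemma safe_subset_of_mul {t u : ℝ} (hu : u ∈ Icc (0 : ℝ) 1) : R.safe t ⊆ R.safe (u * t) :=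
  fun Z hZ w hw => by
    rw [← mul_assoc]
    exact hZ _ ⟨mul_nonneg hw.1 hu.1, mul_le_one₀ hw.2 hu.1 hu.2⟩

end CutoffFlow

lemma sum_erase_swap (f : Fin N → Fin N → ℝ) :
    ∑ i, ∑ j ∈ Finset.univ.erase i, f i j = ∑ i, ∑ j ∈ Finset.univ.erase i, f j i := by
  refine Finset.sum_comm' fun x y => ?_
  simp [ne_comm]

lemma torusForce_neg (hφ : Admissible φ φmin A α) (z : T3) :
    torusForce φ (-z) = -torusForce φ z := by
  obtain ⟨x, rfl⟩ := proj_surjective z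
  rw [← proj_neg, torusForce_proj, torusForce_proj, hφ.force_neg]

/-- Action and reaction: the pair forces are antisymmetric, so the power of the forces cancels the
change of the interaction energy. -/
lemma Admissible.hasDerivAt_energy (hφ : Admissible φ φmin A α) {x v : ℝ → Fin N → E3} {t : ℝ}
    (hx : HasDerivAt x (v t) t) (hv : HasDerivAt v (meanForce φ (projN (x t))) t)
    (hne : ∀ i j, i ≠ j → proj (x t i - x t j) ≠ 0) :
    HasDerivAt (fun s => energy φ ((projN (x s), v s) : Phase N)) 0 t := by
  have hxi : ∀ i, HasDerivAt (fun s => x s i) (v t i) t := fun i => hasDerivAt_pi.1 hx i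
  have hvi : ∀ i, HasDerivAt (fun s => v s i) (meanForce φ (projN (x t)) i) t := fun i =>
    hasDerivAt_pi.1 hv i
  have h1 : ∀ i, HasDerivAt (fun s => ‖v s i‖ ^ 2 / 2)
      (inner ℝ (v t i) (meanForce φ (projN (x t)) i)) t := fun i => by
    have := ((hvi i).norm_sq).div_const 2
    simpa using this
  have h2 : ∀ i j, i ≠ j → HasDerivAt (fun s => φ (projN (x s) i - projN (x s) j))
      (inner ℝ (-torusForce φ (projN (x t) i - projN (x t) j)) (v t i - v t j)) t := fun i j hij => by
    have h3 := (hφ.hasGradientAt (hne i j hij)).hasFDerivAt.comp_hasDerivAt t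
      ((hxi i).sub (hxi j))
    have e : projN (x t) i - projN (x t) j = proj (x t i - x t j) := (proj_sub _ _).symm
    rw [e, torusForce_proj]
    refine (h3.congr_of_eventuallyEq (Eventually.of_forall fun s => ?_)).congr_deriv ?_
    · simp [periodic, projN, proj_sub]
    · simp
  have h4 := (HasDerivAt.fun_sum fun i (_ : i ∈ Finset.univ) => h1 i).add
    ((HasDerivAt.fun_sum fun i (_ : i ∈ Finset.univ) => HasDerivAt.fun_sum
      fun j (hj : j ∈ Finset.univ.erase i) => h2 i j (Finset.ne_of_mem_erase hj).symm).const_mul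
        (1 / (2 * (N : ℝ))))
  refine h4.congr_deriv ?_
  set K : Fin N → Fin N → E3 := fun i j => torusForce φ (projN (x t) i - projN (x t) j) with hK
  have hKs : ∀ i j, K j i = -K i j := fun i j => by
    simp only [hK]
    rw [← torusForce_neg hφ, neg_sub]
  have e1 : ∑ i, inner ℝ (v t i) (meanForce φ (projN (x t)) i) =
      1 / (N : ℝ) * ∑ i, ∑ j ∈ Finset.univ.erase i, inner ℝ (K i j) (v t i) := by
    rw [Finset.mul_sum]
    refine Finset.sum_congr rfl fun i _ => ?_
    rw [meanForce, inner_smul_right, inner_sum]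
    congr 1
    exact Finset.sum_congr rfl fun j _ => real_inner_comm _ _
  have e2 : ∑ i, ∑ j ∈ Finset.univ.erase i, inner ℝ (-K i j) (v t i - v t j) =
      -2 * ∑ i, ∑ j ∈ Finset.univ.erase i, inner ℝ (K i j) (v t i) := by
    have e3 : ∑ i, ∑ j ∈ Finset.univ.erase i, inner ℝ (K i j) (v t j) =
        -∑ i, ∑ j ∈ Finset.univ.erase i, inner ℝ (K i j) (v t i) := by
      rw [sum_erase_swap, ← Finset.sum_neg_distrib]
      refine Finset.sum_congr rfl fun i _ => ?_
      rw [← Finset.sum_neg_distrib]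
      exact Finset.sum_congr rfl fun j _ => by rw [hKs i j, inner_neg_left]
    simp only [inner_neg_left, inner_sub_right, Finset.sum_sub_distrib, Finset.sum_neg_distrib]
    rw [e3]; ring
  rw [e1, e2]
  ring

namespace CutoffFlow

variable (R : CutoffFlow N φ η)

lemma hasDerivAt_of_separated {z : ℝ → (Fin N → E3) × (Fin N → E3)}
    (hz : ∀ t, HasDerivAt z (newtonField (R.F ∘ projN) (z t)) t) {t : ℝ}
    (h : Separated η (projN (z t).1)) :
    HasDerivAt z (newtonField (meanForce φ ∘ projN) (z t)) t := by
  have := hz t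
  rwa [newtonField, Function.comp, R.eq_meanForce _ h] at this

lemma energy_eq_of_mem_safe (hφ : Admissible φ φmin A α) (hη : 0 < η) {t : ℝ} {Z : Phase N}
    (hZ : Z ∈ R.safe t) : energy φ (R.Φ t Z) = energy φ Z := by
  obtain ⟨z, h0, hz, h⟩ := R.exists_curve_of Z
  have hd : ∀ u ∈ Icc (0 : ℝ) 1, HasDerivAt (fun u => energy φ (R.Φ (u * t) Z)) 0 u := by
    intro u hu
    have hsep := hZ u hu
    rw [h] at hsep
    have h1 := R.hasDerivAt_of_separated hz hsep
    have h2 := hφ.hasDerivAt_energy (x := fun s => (z s).1) (v := fun s => (z s).2)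
      (hasDerivAt_fst h1) (hasDerivAt_snd h1) (fun i j hij => by
        rw [proj_sub]; exact hsep.sub_ne_zero hη hij)
    have h3 := h2.scomp u ((hasDerivAt_id u).mul_const t)
    rw [smul_zero] at h3
    simp only [h]
    exact h3
  have hc : ContinuousOn (fun u => energy φ (R.Φ (u * t) Z)) (Icc 0 1) := fun u hu =>
    (hd u hu).continuousAt.continuousWithinAt
  have := constant_of_has_deriv_right_zero hc
    (fun u hu => (hd u (Ico_subset_Icc_self hu)).hasDerivWithinAt) 1 (right_mem_Icc.2 zero_le_one)
  simpa [R.apply_zero] using this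

/-- Along safe trajectories the Gibbs measure does not increase. -/
lemma lintegral_safe_le (hφ : Admissible φ φmin A α) (hη : 0 < η) (t : ℝ) {f : Phase N → ℝ≥0∞}
    (hf : Measurable f) :
    ∫⁻ Z, (R.safe t).indicator (fun Z => f (R.Φ t Z)) Z ∂(gibbs N φ β) ≤
      ∫⁻ Z, f Z ∂(gibbs N φ β) := by
  have hfΦ : Measurable fun Z => f (R.Φ t Z) := hf.comp (R.measurable_apply t)
  have he := measurable_gibbsWeight (N := N) (β := β) hφ.measurable
  rw [lintegral_gibbs hφ.measurable (hfΦ.indicator (R.measurableSet_safe t)),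
    lintegral_gibbs hφ.measurable hf]
  refine mul_le_mul' le_rfl ?_
  set g : Phase N → ℝ≥0∞ := fun Z => ENNReal.ofReal (Real.exp (-β * energy φ Z)) * f Z with hg
  have hgm : Measurable g := he.mul hf
  calc _ ≤ ∫⁻ Z, g (R.Φ t Z) := by
        refine lintegral_mono fun Z => ?_
        by_cases hZ : Z ∈ R.safe t
        · rw [indicator_of_mem hZ]
          simp only [hg]
          rw [R.energy_eq_of_mem_safe hφ hη hZ]
        · rw [indicator_of_notMem hZ, mul_zero]
          exact zero_le
    _ = ∫⁻ Z, g Z ∂(Measure.map (R.Φ t) volume) := (lintegral_map hgm (R.measurable_apply t)).symm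
    _ ≤ _ := lintegral_mono' (R.map_le t) le_rfl

/-- Uniqueness: a curve that solves the Newton system and stays separated is the cut-off curve. -/
lemma curve_eq {z w : ℝ → (Fin N → E3) × (Fin N → E3)}
    (hz : ∀ t, HasDerivAt z (newtonField (R.F ∘ projN) (z t)) t) {T : ℝ}
    (hw : ∀ u ∈ Icc (0 : ℝ) 1,
      HasDerivAt w (newtonField (meanForce φ ∘ projN) (w (u * T))) (u * T))
    (hsep : ∀ u ∈ Icc (0 : ℝ) 1, Separated η (projN (w (u * T)).1)) (h0 : z 0 = w 0) :
    ∀ u ∈ Icc (0 : ℝ) 1, z (u * T) = w (u * T) := by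
  have hL := lipschitzWith_newtonField (lipschitzWith_comp_projN R.lipschitz)
  have hz' : ∀ u, HasDerivAt (fun u => z (u * T))
      (T • newtonField (R.F ∘ projN) (z (u * T))) u := fun u => by
    have := (hz (u * T)).scomp u ((hasDerivAt_id u).mul_const T)
    rwa [one_mul] at this
  have hw' : ∀ u ∈ Icc (0 : ℝ) 1, HasDerivAt (fun u => w (u * T))
      (T • newtonField (R.F ∘ projN) (w (u * T))) u := fun u hu => by
    have h1 := hw u hu
    rw [newtonField, Function.comp, ← R.eq_meanForce _ (hsep u hu)] at h1
    have := h1.scomp u ((hasDerivAt_id u).mul_const T)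
    rwa [one_mul] at this
  refine ODE_solution_unique (v := fun _ p => T • newtonField (R.F ∘ projN) p)
    (K := ‖T‖₊ * max 1 R.L) (fun _ => (lipschitzWith_smul T).comp hL)
    (fun u _ => (hz' u).continuousAt.continuousWithinAt) (fun u _ => (hz' u).hasDerivWithinAt)
    (fun u hu => (hw' u hu).continuousAt.continuousWithinAt)
    (fun u hu => (hw' u (Ico_subset_Icc_self hu)).hasDerivWithinAt) ?_
  simpa using h0

lemma apply_eq_of_curve {w : ℝ → (Fin N → E3) × (Fin N → E3)} {T : ℝ}
    (hw : ∀ u ∈ Icc (0 : ℝ) 1,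
      HasDerivAt w (newtonField (meanForce φ ∘ projN) (w (u * T))) (u * T))
    (hsep : ∀ u ∈ Icc (0 : ℝ) 1, Separated η (projN (w (u * T)).1)) :
    ∀ u ∈ Icc (0 : ℝ) 1, R.Φ (u * T) (projZ (w 0)) = projZ (w (u * T)) := by
  intro u hu
  obtain ⟨z, h0, hz⟩ := R.exists_curve (w 0)
  rw [← h0, R.apply_curve z hz, R.curve_eq hz hw hsep h0 u hu]

end CutoffFlow

end Cutoff

end NParticle

namespace NParticle

/-! ### Near-collisions are improbable -/

section Collisions

variable {N : ℕ} {φ : T3 → ℝ} {φmin A α β η : ℝ}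

/-- For a pair reaching distance `η` at time `τ` with relative speed at most `V`, the integrand
bounds the inverse distance from below; the divergence as `η → 0` is logarithmic. -/
lemma ofReal_log_le_setLIntegral {η V τ : ℝ} (hη : 0 < η) (hV : 0 < V) (hτ : 0 ≤ τ) :
    ENNReal.ofReal (1 / V * Real.log ((η + V * τ) / η)) ≤
      ∫⁻ u in Ico 0 τ, ENNReal.ofReal ((η + V * (τ - u))⁻¹) := by
  have hpos : ∀ u ∈ uIcc 0 τ, 0 < η + V * (τ - u) := fun u hu => by
    rw [uIcc_of_le hτ] at hu
    have : 0 ≤ V * (τ - u) := mul_nonneg hV.le (by linarith [hu.2])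
    linarith
  have hcont : ContinuousOn (fun u => (η + V * (τ - u))⁻¹) (uIcc 0 τ) :=
    ContinuousOn.inv₀ (by fun_prop) fun u hu => (hpos u hu).ne'
  have hint : IntervalIntegrable (fun u => (η + V * (τ - u))⁻¹) volume 0 τ :=
    hcont.intervalIntegrable
  have hftc : ∫ u in (0 : ℝ)..τ, (η + V * (τ - u))⁻¹ = 1 / V * Real.log ((η + V * τ) / η) := by
    rw [intervalIntegral.integral_eq_sub_of_hasDerivAt
      (f := fun u => -(1 / V) * Real.log (η + V * (τ - u))) (fun u hu => ?_) hint]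
    · rw [Real.log_div (by positivity) hη.ne']
      simp only [sub_self, mul_zero, add_zero, sub_zero]
      ring
    · have h1 : HasDerivAt (fun u => η + V * (τ - u)) (-V) u := by
        simpa using (((hasDerivAt_id u).const_sub τ).const_mul V).const_add η
      refine ((h1.log (hpos u hu).ne').const_mul (-(1 / V))).congr_deriv ?_
      field_simp
  rw [← hftc, intervalIntegral.integral_of_le hτ, Measure.restrict_congr_set Ico_ae_eq_Ioc]
  rw [ofReal_integral_eq_lintegral_ofReal]
  · exact (intervalIntegrable_iff_integrableOn_Ioc_of_le hτ).1 hint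
  · filter_upwards [ae_restrict_mem measurableSet_Ioc] with u hu
    exact (inv_pos.2 (hpos u (by rw [uIcc_of_le hτ]; exact Ioc_subset_Icc_self hu))).le

/-- The sum of the inverse distances of all pairs. -/
noncomputable def inverseDistances (X : Fin N → T3) : ℝ≥0∞ :=
  ∑ i, ∑ j ∈ Finset.univ.erase i, ENNReal.ofReal (tnorm (X i - X j) ^ (-1 : ℝ))

lemma measurable_inverseDistances : Measurable (inverseDistances (N := N)) := by
  unfold inverseDistances
  refine Finset.measurable_sum _ fun i _ => Finset.measurable_sum _ fun j _ => ?_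
  exact ((measurable_tnorm.comp
    ((measurable_pi_apply i).sub (measurable_pi_apply j))).pow_const _).ennreal_ofReal

lemma Admissible.lintegral_inverseDistances_lt_top (hφ : Admissible φ φmin A α) (hA : 0 ≤ A)
    (hα2 : α < 2) (hmin : φmin ≤ 0) (hβ : 0 < β) :
    ∫⁻ Z : Phase N, inverseDistances Z.1 ∂(gibbs N φ β) < ⊤ := by
  have hh : Measurable fun z : T3 => ENNReal.ofReal (tnorm z ^ (-1 : ℝ)) :=
    (measurable_tnorm.pow_const _).ennreal_ofReal
  have hm : ∀ i j, Measurable fun Z : Phase N =>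
      ENNReal.ofReal (tnorm (Z.1 i - Z.1 j) ^ (-1 : ℝ)) := fun i j =>
    hh.comp (((measurable_pi_apply i).comp measurable_fst).sub
      ((measurable_pi_apply j).comp measurable_fst))
  unfold inverseDistances
  rw [lintegral_finsetSum _ fun i _ => Finset.measurable_sum _ fun j _ => hm i j]
  refine ENNReal.sum_lt_top.2 fun i _ => ?_
  rw [lintegral_finsetSum _ fun j _ => hm i j]
  refine ENNReal.sum_lt_top.2 fun j hj => ?_
  refine (hφ.lintegral_gibbs_pair_le hA hα2 hmin hβ (Finset.ne_of_mem_erase hj).symm hh).trans_lt ?_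
  exact ENNReal.mul_lt_top ENNReal.ofReal_lt_top (lintegral_tnorm_rpow_lt_top (by norm_num))

/-- The potential is bounded below, so energy controls each kinetic term. The form of the bound
comes from `v ≤ 1 + v²`, which avoids a square root. -/
lemma Admissible.norm_velocity_le (hφ : Admissible φ φmin A α) {M : ℝ} {Z : Phase N}
    (hM : energy φ Z ≤ M) (hne : ∀ i j, i ≠ j → Z.1 i - Z.1 j ≠ 0) (i : Fin N) :
    ‖Z.2 i‖ ≤ 1 + 2 * (|M| + N * |φmin|) := by
  have hN : (0 : ℝ) < N := by exact_mod_cast i.pos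
  have h1 : ∀ k, (N : ℝ) * -|φmin| ≤ ∑ j ∈ Finset.univ.erase k, φ (Z.1 k - Z.1 j) := fun k => by
    have hcard : ((Finset.univ.erase k).card : ℝ) ≤ N := by
      have := Finset.card_le_univ (Finset.univ.erase k)
      rw [Fintype.card_fin] at this
      exact_mod_cast this
    have h2 : ∑ j ∈ Finset.univ.erase k, -|φmin| ≤ ∑ j ∈ Finset.univ.erase k, φ (Z.1 k - Z.1 j) :=
      Finset.sum_le_sum fun j hj => (neg_abs_le φmin).trans
        (hφ.lower _ (hne k j (Finset.ne_of_mem_erase hj).symm))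
    rw [Finset.sum_const, nsmul_eq_mul] at h2
    have := mul_le_mul_of_nonpos_right hcard (neg_nonpos.2 (abs_nonneg φmin))
    linarith
  have h2 : (N : ℝ) * (N * -|φmin|) ≤
      ∑ k, ∑ j ∈ Finset.univ.erase k, φ (Z.1 k - Z.1 j) := by
    have := Finset.sum_le_sum fun k (_ : k ∈ Finset.univ) => h1 k
    rwa [Finset.sum_const, nsmul_eq_mul, Finset.card_univ, Fintype.card_fin] at this
  have h3 : -(N * |φmin|) ≤ interaction φ Z.1 := by
    have h4 : 1 / (2 * (N : ℝ)) * (N * (N * -|φmin|)) ≤ interaction φ Z.1 := by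
      unfold interaction; gcongr
    have h5 : 1 / (2 * (N : ℝ)) * (N * (N * -|φmin|)) = -(N * |φmin|) / 2 := by field_simp
    have : 0 ≤ N * |φmin| := by positivity
    linarith
  have h4 : ‖Z.2 i‖ ^ 2 / 2 ≤ ∑ k, ‖Z.2 k‖ ^ 2 / 2 :=
    Finset.single_le_sum (f := fun k => ‖Z.2 k‖ ^ 2 / 2) (fun _ _ => by positivity)
      (Finset.mem_univ i)
  rw [energy_eq] at hM
  have h5 : ‖Z.2 i‖ ^ 2 ≤ 2 * (|M| + N * |φmin|) := by linarith [le_abs_self M]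
  have h6 : 0 ≤ |M| + N * |φmin| := by positivity
  nlinarith [norm_nonneg (Z.2 i)]

namespace CutoffFlow

variable (R : CutoffFlow N φ η)

/-- A trajectory that reaches small distances has a large time integral of the inverse
distances. -/
lemma log_le_lintegral_inverseDistances (hφ : Admissible φ φmin A α) (hη : 0 < η) {T M η₀ : ℝ}
    (hη₀ : 0 < η₀) {Z : Phase N} (hM : energy φ Z ≤ M) (hsep : Separated η₀ Z.1)
    (hZ : Z ∉ R.safe T) :
    ENNReal.ofReal (1 / (2 * |T| * (1 + 2 * (|M| + N * |φmin|)) + 1) * Real.log (η₀ / η)) ≤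
      ∫⁻ u in Icc (0 : ℝ) 1,
        (R.safe (u * T)).indicator (fun Z => inverseDistances (R.Φ (u * T) Z).1) Z := by
  obtain ⟨z, h0, hz, hΦ⟩ := R.exists_curve_of Z
  set V₀ := 1 + 2 * (|M| + N * |φmin|) with hV₀
  have hV₀pos : 0 < V₀ := by positivity
  -- Bound on the relative speed in the rescaled time `u`; the added 1 keeps it positive when `T =
  -- 0`.
  set V := 2 * |T| * V₀ + 1 with hV
  have hVpos : 0 < V := by positivity
  let d : Fin N → Fin N → ℝ → ℝ := fun i j u => tnorm ((R.Φ (u * T) Z).1 i - (R.Φ (u * T) Z).1 j)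
  have hd : ∀ i j, Continuous (d i j) := fun i j => by
    have hc : Continuous fun u => (R.Φ (u * T) Z).1 :=
      continuous_fst.comp ((R.continuous_apply Z).comp (continuous_mul_const T))
    exact continuous_tnorm.comp (((_root_.continuous_apply i).comp hc).sub
      ((_root_.continuous_apply j).comp hc))
  let S : Set ℝ := Icc 0 1 ∩ ⋃ i, ⋃ j, {u | i ≠ j ∧ d i j u ≤ η}
  have hS : IsCompact S := by
    refine isCompact_Icc.inter_right ?_
    refine isClosed_iUnion_of_finite fun i => isClosed_iUnion_of_finite fun j => ?_
    by_cases hij : i = j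
    · simp [hij]
    · simpa [hij] using isClosed_le (hd i j) continuous_const
  have hSne : S.Nonempty := by
    simp only [safe, Separated, mem_ofPred_eq, not_forall, not_le] at hZ
    obtain ⟨u, hu, i, j, hij, h⟩ := hZ
    exact ⟨u, hu, mem_iUnion.2 ⟨i, mem_iUnion.2 ⟨j, hij, h.le⟩⟩⟩
  -- First time at which some pair is within `η`. Before it the trajectory is safe, so energy
  -- conservation bounds the speeds up to `τ`.
  obtain ⟨τ, ⟨hτ, hτS⟩, hτmin⟩ := hS.exists_isLeast hSne
  obtain ⟨i, hi⟩ := mem_iUnion.1 hτS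
  obtain ⟨j, hij, hdτ⟩ := mem_iUnion.1 hi
  have hsafe : ∀ u ∈ Ico 0 τ, Z ∈ R.safe (u * T) := by
    intro u hu w hw k l hkl
    by_contra hlt
    rw [not_le] at hlt
    have hwu : w * u ∈ S := by
      refine ⟨⟨mul_nonneg hw.1 hu.1, mul_le_one₀ hw.2 hu.1 (hu.2.le.trans hτ.2)⟩,
        mem_iUnion.2 ⟨k, mem_iUnion.2 ⟨l, hkl, ?_⟩⟩⟩
      simp only [d]
      rw [mul_assoc]
      exact hlt.le
    have h1 := hτmin hwu
    have h2 : w * u ≤ u := mul_le_of_le_one_left hu.1 hw.2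
    linarith [hu.2]
  have hsep' : ∀ u ∈ Ico 0 τ, Separated η (R.Φ (u * T) Z).1 := fun u hu => by
    simpa using hsafe u hu 1 (right_mem_Icc.2 zero_le_one)
  have hspeed : ∀ u ∈ Ico 0 τ, ∀ k, ‖(z (u * T)).2 k‖ ≤ V₀ := fun u hu k => by
    have h1 := R.energy_eq_of_mem_safe hφ hη (hsafe u hu)
    have h2 := hφ.norm_velocity_le (h1.trans_le hM) (fun i j hij => (hsep' u hu).sub_ne_zero hη hij) k
    rwa [hΦ] at h2
  have hg : ∀ u, HasDerivAt (fun u => (z (u * T)).1 i - (z (u * T)).1 j)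
      (T • ((z (u * T)).2 i - (z (u * T)).2 j)) u := fun u => by
    have h1 := hasDerivAt_fst (hz (u * T))
    have h2 := (hasDerivAt_pi.1 h1 i).sub (hasDerivAt_pi.1 h1 j)
    have h3 := h2.scomp u ((hasDerivAt_id u).mul_const T)
    rwa [one_mul] at h3
  have hdle : ∀ u ∈ Icc 0 τ, d i j u ≤ η + V * (τ - u) := by
    intro u hu
    have h1 := norm_image_sub_le_of_norm_deriv_right_le_segment
      (f := fun u => (z (u * T)).1 i - (z (u * T)).1 j) (a := u) (b := τ) (C := V)
      (fun s _ => (hg s).continuousAt.continuousWithinAt) (fun s _ => (hg s).hasDerivWithinAt)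
      (fun s hs => by
        have hs' : s ∈ Ico 0 τ := ⟨hu.1.trans hs.1, hs.2⟩
        rw [norm_smul, Real.norm_eq_abs]
        have h2 := (norm_sub_le ((z (s * T)).2 i) ((z (s * T)).2 j)).trans
          (add_le_add (hspeed s hs' i) (hspeed s hs' j))
        have h3 := mul_le_mul_of_nonneg_left h2 (abs_nonneg T)
        rw [hV]
        linarith) τ (right_mem_Icc.2 hu.2)
    have h2 : ∀ s, d i j s = tnorm (proj ((z (s * T)).1 i - (z (s * T)).1 j)) := fun s => by
      simp only [d]
      rw [hΦ, proj_sub]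
      rfl
    have h3 := tnorm_le_add_sub (proj ((z (u * T)).1 i - (z (u * T)).1 j))
      (proj ((z (τ * T)).1 i - (z (τ * T)).1 j))
    rw [← proj_sub _ ((z (τ * T)).1 i - (z (τ * T)).1 j), ← h2, ← h2] at h3
    have h4 := tnorm_proj_le ((z (u * T)).1 i - (z (u * T)).1 j -
      ((z (τ * T)).1 i - (z (τ * T)).1 j))
    rw [norm_sub_rev] at h4
    have : d i j τ ≤ η := hdτ
    linarith
  have hη₀le : η₀ ≤ η + V * τ := by
    have h1 := hdle 0 (left_mem_Icc.2 hτ.1)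
    have h2 : d i j 0 = tnorm (Z.1 i - Z.1 j) := by
      simp only [d, zero_mul, R.apply_zero]
    have := hsep i j hij
    rw [sub_zero] at h1
    linarith
  calc ENNReal.ofReal (1 / V * Real.log (η₀ / η))
      ≤ ENNReal.ofReal (1 / V * Real.log ((η + V * τ) / η)) := by
        refine ENNReal.ofReal_le_ofReal ?_
        gcongr
    _ ≤ ∫⁻ u in Ico 0 τ, ENNReal.ofReal ((η + V * (τ - u))⁻¹) :=
        ofReal_log_le_setLIntegral hη hVpos hτ.1
    _ ≤ ∫⁻ u in Ico 0 τ,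
        (R.safe (u * T)).indicator (fun Z => inverseDistances (R.Φ (u * T) Z).1) Z := by
        refine setLIntegral_mono' measurableSet_Ico fun u hu => ?_
        rw [indicator_of_mem (hsafe u hu), inverseDistances]
        have hdpos : 0 < d i j u := hη.trans_le (hsep' u hu i j hij)
        calc ENNReal.ofReal ((η + V * (τ - u))⁻¹) ≤ ENNReal.ofReal (d i j u ^ (-1 : ℝ)) := by
              rw [Real.rpow_neg_one]
              refine ENNReal.ofReal_le_ofReal ?_
              gcongr
              exact hdle u (Ico_subset_Icc_self hu)
          _ ≤ ∑ l ∈ Finset.univ.erase i, ENNReal.ofReal (d i l u ^ (-1 : ℝ)) :=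
              Finset.single_le_sum (f := fun l => ENNReal.ofReal (d i l u ^ (-1 : ℝ)))
                (fun _ _ => zero_le) (Finset.mem_erase.2 ⟨hij.symm, Finset.mem_univ j⟩)
          _ ≤ ∑ k, ∑ l ∈ Finset.univ.erase k, ENNReal.ofReal (d k l u ^ (-1 : ℝ)) :=
              Finset.single_le_sum
                (f := fun k => ∑ l ∈ Finset.univ.erase k, ENNReal.ofReal (d k l u ^ (-1 : ℝ)))
                (fun _ _ => zero_le) (Finset.mem_univ i)
    _ ≤ _ := lintegral_mono_set
        (show Ico 0 τ ⊆ Icc 0 1 from fun u hu => ⟨hu.1, hu.2.le.trans hτ.2⟩)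

lemma measurable_safe_indicator {f : Phase N → ℝ≥0∞} (hf : Measurable f) :
    Measurable fun p : ℝ × Phase N => (R.safe p.1).indicator (fun Z => f (R.Φ p.1 Z)) p.2 := by
  have h1 : Measurable fun p : ℝ × Phase N => f (R.Φ p.1 p.2) := hf.comp R.measurable
  have h2 := h1.indicator R.measurableSet_safe_prod
  convert h2 using 2 with p
  by_cases hp : p.2 ∈ R.safe p.1
  · rw [indicator_of_mem hp, indicator_of_mem (by exact hp)]
  · rw [indicator_of_notMem hp, indicator_of_notMem (by exact hp)]

lemma measurable_safe_indicator_mul {f : Phase N → ℝ≥0∞} (hf : Measurable f) (T : ℝ) :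
    Measurable fun p : Phase N × ℝ =>
      (R.safe (p.2 * T)).indicator (fun Z => f (R.Φ (p.2 * T) Z)) p.1 := by
  have h0 : Measurable fun p : Phase N × ℝ => p.2 * T := measurable_snd.mul_const T
  have h1 : Measurable fun p : Phase N × ℝ => (p.2 * T, p.1) := h0.prodMk measurable_fst
  have h2 := R.measurable_safe_indicator hf
  set g : ℝ × Phase N → ℝ≥0∞ := fun p => (R.safe p.1).indicator (fun Z => f (R.Φ p.1 Z)) p.2
    with hg
  have h3 : Measurable fun p : Phase N × ℝ => g (p.2 * T, p.1) := h2.comp h1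
  simpa only [hg] using h3

/-- Markov's inequality for the time integral of the inverse distances, then Tonelli and the
non-increase of the Gibbs measure on safe data. The right-hand side is independent of `η`. -/
lemma measure_not_safe_le (hφ : Admissible φ φmin A α) (hη : 0 < η) {T M η₀ : ℝ} (hη₀ : 0 < η₀) :
    ENNReal.ofReal (1 / (2 * |T| * (1 + 2 * (|M| + N * |φmin|)) + 1) * Real.log (η₀ / η)) *
      gibbs N φ β {Z | energy φ Z ≤ M ∧ Separated η₀ Z.1 ∧ Z ∉ R.safe T} ≤
      ∫⁻ Z : Phase N, inverseDistances Z.1 ∂(gibbs N φ β) := by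
  set a := ENNReal.ofReal (1 / (2 * |T| * (1 + 2 * (|M| + N * |φmin|)) + 1) * Real.log (η₀ / η))
    with ha
  have hI : Measurable fun Z : Phase N => inverseDistances Z.1 :=
    measurable_inverseDistances.comp measurable_fst
  have hm' := R.measurable_safe_indicator_mul hI T
  set f : Phase N → ℝ≥0∞ := fun Z => ∫⁻ u in Icc (0 : ℝ) 1,
    (R.safe (u * T)).indicator (fun Z => inverseDistances (R.Φ (u * T) Z).1) Z with hf
  have hfm : Measurable f := hm'.lintegral_prod_right'
  calc _ ≤ a * gibbs N φ β {Z | a ≤ f Z} := by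
        refine mul_le_mul' le_rfl (measure_mono ?_)
        rintro Z ⟨h1, h2, h3⟩
        exact R.log_le_lintegral_inverseDistances hφ hη hη₀ h1 h2 h3
    _ ≤ ∫⁻ Z, f Z ∂(gibbs N φ β) := mul_meas_ge_le_lintegral hfm a
    _ = ∫⁻ u in Icc (0 : ℝ) 1, ∫⁻ Z, (R.safe (u * T)).indicator
          (fun Z => inverseDistances (R.Φ (u * T) Z).1) Z ∂(gibbs N φ β) :=
        lintegral_lintegral_swap hm'.aemeasurable
    _ ≤ ∫⁻ _ in Icc (0 : ℝ) 1, ∫⁻ Z : Phase N, inverseDistances Z.1 ∂(gibbs N φ β) :=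
        lintegral_mono fun u => R.lintegral_safe_le hφ hη _ hI
    _ = _ := by simp

end CutoffFlow

/-- The cut-off distances used to approximate the Newton system. -/
noncomputable def cutoffDist (n : ℕ) : ℝ := 1 / ((n : ℝ) + 1)

lemma cutoffDist_pos (n : ℕ) : 0 < cutoffDist n := by unfold cutoffDist; positivity

lemma cutoffDist_anti : Antitone cutoffDist := fun n m h => by
  unfold cutoffDist
  have : (n : ℝ) ≤ m := by exact_mod_cast h
  gcongr

lemma tendsto_cutoffDist : Tendsto cutoffDist atTop (𝓝 0) :=
  tendsto_one_div_add_atTop_nhds_zero_nat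

lemma Admissible.ae_sub_ne_zero (hφ : Admissible φ φmin A α) (hA : 0 ≤ A)
    (hα2 : α < 2) (hmin : φmin ≤ 0) (hβ : 0 < β) :
    ∀ᵐ Z ∂(gibbs N φ β), ∀ i j, i ≠ j → Z.1 i - Z.1 j ≠ 0 := by
  rw [ae_all_iff]; intro i
  rw [ae_all_iff]; intro j
  by_cases hij : i = j
  · simp [hij]
  have h0 : MeasurableSet ({0} : Set T3) := measurableSet_singleton 0
  have := hφ.lintegral_gibbs_pair_le hA hα2 hmin hβ hij
    (h := ({0} : Set T3).indicator 1) (measurable_one.indicator h0)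
  rw [lintegral_indicator_one h0, volume_singleton_zero, mul_zero, nonpos_iff_eq_zero] at this
  have hm : Measurable fun Z : Phase N => Z.1 i - Z.1 j :=
    ((measurable_pi_apply i).comp measurable_fst).sub ((measurable_pi_apply j).comp measurable_fst)
  have hm' : Measurable fun Z : Phase N =>
      ({0} : Set T3).indicator (1 : T3 → ℝ≥0∞) (Z.1 i - Z.1 j) :=
    (measurable_one.indicator h0).comp hm
  rw [lintegral_eq_zero_iff hm'] at this
  filter_upwards [this] with Z hZ _ hcontra
  simp [hcontra] at hZ

/-- Almost every trajectory stays separated on every bounded time interval. -/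
lemma Admissible.ae_exists_safe (hφ : Admissible φ φmin A α) (hA : 0 ≤ A)
    (hα2 : α < 2) (hmin : φmin ≤ 0) (hβ : 0 < β) (R : ∀ n, CutoffFlow N φ (cutoffDist n)) :
    ∀ᵐ Z ∂(gibbs N φ β), ∀ T : ℤ, ∃ n, Z ∈ (R n).safe T := by
  rw [ae_all_iff]
  intro T
  have hnull : ∀ m : ℕ, gibbs N φ β
      {Z | energy φ Z ≤ m ∧ Separated (cutoffDist m) Z.1 ∧ ∀ n, Z ∉ (R n).safe T} = 0 := by
    intro m
    set E := {Z : Phase N | energy φ Z ≤ m ∧ Separated (cutoffDist m) Z.1 ∧ ∀ n, Z ∉ (R n).safe T}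
      with hE
    set b : ℝ := 1 / (2 * |(T : ℝ)| * (1 + 2 * (|(m : ℝ)| + N * |φmin|)) + 1) with hb
    have hbpos : 0 < b := by positivity
    have hle : ∀ n, ENNReal.ofReal (b * Real.log (cutoffDist m / cutoffDist n)) * gibbs N φ β E ≤
        ∫⁻ Z : Phase N, inverseDistances Z.1 ∂(gibbs N φ β) := fun n => by
      refine le_trans ?_ ((R n).measure_not_safe_le hφ (cutoffDist_pos n) (T := T) (M := m)
        (cutoffDist_pos m))
      gcongr
      exact fun Z hZ => ⟨hZ.1, hZ.2.1, hZ.2.2 n⟩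
    -- The coefficient tends to infinity with `n` while the right-hand side of `hle` is fixed and
    -- finite, which forces the measure to vanish.
    have htend : Tendsto (fun n => ENNReal.ofReal (b * Real.log (cutoffDist m / cutoffDist n)))
        atTop (𝓝 ⊤) := by
      refine ENNReal.tendsto_ofReal_atTop.comp (Tendsto.const_mul_atTop hbpos ?_)
      refine Real.tendsto_log_atTop.comp ?_
      have : (fun n => cutoffDist m / cutoffDist n) = fun n : ℕ => cutoffDist m * ((n : ℝ) + 1) := by
        ext n; simp [cutoffDist]
      rw [this]
      exact Tendsto.const_mul_atTop (cutoffDist_pos m)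
        (tendsto_atTop_add_const_right _ _ tendsto_natCast_atTop_atTop)
    by_contra hne
    have h1 := ENNReal.Tendsto.mul_const htend (b := gibbs N φ β E) (Or.inl ENNReal.top_ne_zero)
    rw [ENNReal.top_mul hne] at h1
    have h2 := le_of_tendsto h1 (Eventually.of_forall hle)
    exact absurd (top_le_iff.1 h2) (hφ.lintegral_inverseDistances_lt_top hA hα2 hmin hβ).ne
  have hae : ∀ᵐ Z ∂(gibbs N φ β), ∀ m : ℕ,
      ¬ (energy φ Z ≤ m ∧ Separated (cutoffDist m) Z.1 ∧ ∀ n, Z ∉ (R n).safe T) := by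
    rw [ae_all_iff]
    intro m
    rw [ae_iff]
    simpa only [not_not] using hnull m
  filter_upwards [hae, hφ.ae_sub_ne_zero hA hα2 hmin hβ] with Z hZ hne
  have hsep : ∀ᶠ m in atTop, Separated (cutoffDist m) Z.1 := by
    simp only [Separated, eventually_all]
    intro i j hij
    exact (tendsto_cutoffDist.eventually_lt_const (tnorm_pos.2 (hne i j hij))).mono
      fun m hm => hm.le
  have hen : ∀ᶠ m : ℕ in atTop, energy φ Z ≤ m :=
    tendsto_natCast_atTop_atTop.eventually_ge_atTop _
  obtain ⟨m, h1, h2⟩ := (hsep.and hen).exists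
  have := hZ m
  by_contra hcon
  exact this ⟨h2, h1, not_exists.1 hcon⟩

end Collisions

end NParticle

namespace NParticle

/-! ### Existence and uniqueness of collision-free trajectories -/

section Trajectories

variable {N : ℕ} {φ : T3 → ℝ} {φmin A α β : ℝ}

lemma meanForce_projN (φ : T3 → ℝ) (x : Fin N → E3) (i : Fin N) :
    meanForce φ (projN x) i = (1 / (N : ℝ)) • ∑ j ∈ Finset.univ.erase i, force φ (x i - x j) := by
  simp only [meanForce, projN, ← proj_sub, torusForce_proj]

lemma isTrajectory_of_curve {w : ℝ → (Fin N → E3) × (Fin N → E3)}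
    (hw : ∀ t, HasDerivAt w (newtonField (meanForce φ ∘ projN) (w t)) t)
    (hne : ∀ t i j, i ≠ j → projN (w t).1 i ≠ projN (w t).1 j) :
    IsTrajectory φ fun t => (projZ (w t) : Phase N) := by
  refine ⟨fun t => (w t).1, fun t i => rfl, hne, fun t i => ?_, fun t i => ?_⟩
  · exact hasDerivAt_pi.1 (hasDerivAt_fst (hw t)) i
  · rw [← meanForce_projN]
    exact hasDerivAt_pi.1 (hasDerivAt_snd (hw t)) i

namespace IsTrajectory

variable {γ γ' : ℝ → Phase N}

lemma exists_curve (h : IsTrajectory φ γ) :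
    ∃ w : ℝ → (Fin N → E3) × (Fin N → E3), (∀ t, projZ (w t) = γ t) ∧
      ∀ t, HasDerivAt w (newtonField (meanForce φ ∘ projN) (w t)) t := by
  obtain ⟨x, h1, -, h2, h3⟩ := h
  have hp : ∀ t, projN (x t) = (γ t).1 := fun t => funext fun i => (h1 t i).symm
  refine ⟨fun t => (x t, (γ t).2), fun t => Prod.ext (hp t) rfl, fun t => ?_⟩
  refine HasDerivAt.prodMk (hasDerivAt_pi.2 fun i => h2 t i) (hasDerivAt_pi.2 fun i => ?_)
  simp only [Function.comp, meanForce_projN]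
  exact h3 t i

lemma continuous (h : IsTrajectory φ γ) : Continuous γ := by
  obtain ⟨w, hw, hd⟩ := h.exists_curve
  have : γ = fun t => projZ (w t) := funext fun t => (hw t).symm
  rw [this]
  exact continuous_projZ.comp (continuous_iff_continuousAt.2 fun t => (hd t).continuousAt)

lemma sub_ne_zero (h : IsTrajectory φ γ) (t : ℝ) {i j : Fin N} (hij : i ≠ j) :
    (γ t).1 i - (γ t).1 j ≠ 0 := by
  obtain ⟨x, -, h1, -⟩ := h
  exact _root_.sub_ne_zero.2 (h1 t i j hij)

/-- On a compact time interval each of the finitely many pair distances has a positive minimum. -/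
lemma eventually_separated (h : IsTrajectory φ γ) (T : ℝ) :
    ∀ᶠ n in atTop, ∀ u ∈ Icc (0 : ℝ) 1, Separated (cutoffDist n) (γ (u * T)).1 := by
  have key : ∀ i j, i ≠ j → ∀ᶠ n in atTop, ∀ u ∈ Icc (0 : ℝ) 1,
      cutoffDist n ≤ tnorm ((γ (u * T)).1 i - (γ (u * T)).1 j) := by
    intro i j hij
    have hc : Continuous fun u : ℝ => tnorm ((γ (u * T)).1 i - (γ (u * T)).1 j) := by
      have h1 : Continuous fun u : ℝ => (γ (u * T)).1 :=
        continuous_fst.comp (h.continuous.comp (continuous_id.mul continuous_const))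
      exact continuous_tnorm.comp
        (((continuous_apply i).comp h1).sub ((continuous_apply j).comp h1))
    obtain ⟨u₀, -, hu₀⟩ := (isCompact_Icc (a := (0 : ℝ)) (b := 1)).exists_isMinOn
      ⟨0, left_mem_Icc.2 zero_le_one⟩ hc.continuousOn
    refine (tendsto_cutoffDist.eventually_lt_const
      (tnorm_pos.2 (h.sub_ne_zero (u₀ * T) hij))).mono fun n hn u hu => ?_
    exact hn.le.trans (hu₀ hu)
  have : ∀ᶠ n in atTop, ∀ i j, i ≠ j → ∀ u ∈ Icc (0 : ℝ) 1,
      cutoffDist n ≤ tnorm ((γ (u * T)).1 i - (γ (u * T)).1 j) := by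
    simp only [eventually_all]
    exact key
  exact this.mono fun n hn u hu i j hij => hn i j hij u hu

lemma cutoff_apply_eq (h : IsTrajectory φ γ) {η : ℝ} (R : CutoffFlow N φ η) {T : ℝ}
    (hsep : ∀ u ∈ Icc (0 : ℝ) 1, Separated η (γ (u * T)).1) :
    ∀ u ∈ Icc (0 : ℝ) 1, R.Φ (u * T) (γ 0) = γ (u * T) := by
  obtain ⟨w, hw, hd⟩ := h.exists_curve
  have hsep' : ∀ u ∈ Icc (0 : ℝ) 1, Separated η (projN (w (u * T)).1) := fun u hu => by
    have := hsep u hu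
    rwa [← hw] at this
  intro u hu
  have := R.apply_eq_of_curve (fun u _ => hd (u * T)) hsep' u hu
  rwa [hw, hw] at this

lemma eventually_safe (h : IsTrajectory φ γ) (R : ∀ n, CutoffFlow N φ (cutoffDist n)) (T : ℝ) :
    ∀ᶠ n in atTop, γ 0 ∈ (R n).safe T ∧ (R n).Φ T (γ 0) = γ T := by
  filter_upwards [h.eventually_separated T] with n hn
  have h1 := h.cutoff_apply_eq (R n) hn
  refine ⟨fun u hu => by rw [h1 u hu]; exact hn u hu, ?_⟩
  have := h1 1 (right_mem_Icc.2 zero_le_one)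
  rwa [one_mul] at this

/-- At any given time both trajectories coincide with one common cut-off flow once the cut-off is
small enough. -/
lemma unique (h : IsTrajectory φ γ) (h' : IsTrajectory φ γ')
    (R : ∀ n, CutoffFlow N φ (cutoffDist n)) (h0 : γ 0 = γ' 0) : γ = γ' := by
  ext1 t
  obtain ⟨n, h1, h2⟩ := ((h.eventually_safe R t).and (h'.eventually_safe R t)).exists
  rw [← h1.2, ← h2.2, h0]

end IsTrajectory

/-- A curve safe for one cut-off is also the curve of every smaller cut-off. Fixing one lift of the
initial datum makes the cut-off curves agree in `ℝ^{3N}` itself, so they can be glued. -/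
lemma exists_isTrajectory (R : ∀ n, CutoffFlow N φ (cutoffDist n)) {Z : Phase N}
    (hZ : ∀ T : ℤ, ∃ n, Z ∈ (R n).safe T) : ∃ γ, IsTrajectory φ γ ∧ γ 0 = Z := by
  obtain ⟨z₀, rfl⟩ := projZ_surjective Z
  choose z hz0 hz using fun n => (R n).exists_curve z₀
  have happ : ∀ n t, (R n).Φ t (projZ z₀) = projZ (z n t) := fun n t => by
    rw [← hz0 n]; exact (R n).apply_curve (z n) (hz n) t
  have hagree : ∀ n m T, n ≤ m → projZ z₀ ∈ (R n).safe T →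
      ∀ u ∈ Icc (0 : ℝ) 1, z m (u * T) = z n (u * T) := by
    intro n m T hnm hs
    have hsep : ∀ u ∈ Icc (0 : ℝ) 1, Separated (cutoffDist n) (projN (z n (u * T)).1) :=
      fun u hu => by
        have := hs u hu
        rwa [happ] at this
    exact (R m).curve_eq (hz m) (fun u hu => (R n).hasDerivAt_of_separated (hz n) (hsep u hu))
      (fun u hu => (hsep u hu).mono (cutoffDist_anti hnm)) ((hz0 m).trans (hz0 n).symm)
  have hmono : ∀ n m T, n ≤ m → projZ z₀ ∈ (R n).safe T → projZ z₀ ∈ (R m).safe T := by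
    intro n m T hnm hs u hu
    have h1 := hs u hu
    rw [happ] at h1 ⊢
    rw [hagree n m T hnm hs u hu]
    exact h1.mono (cutoffDist_anti hnm)
  have hk : ∀ k : ℕ, ∃ n, projZ z₀ ∈ (R n).safe k ∧ projZ z₀ ∈ (R n).safe (-(k : ℝ)) := by
    intro k
    obtain ⟨n, hn⟩ := hZ k
    obtain ⟨m, hm⟩ := hZ (-k)
    push_cast at hn hm
    exact ⟨max n m, hmono _ _ _ (le_max_left _ _) hn, hmono _ _ _ (le_max_right _ _) hm⟩
  choose ν hν1 hν2 using hk
  have hsafe : ∀ (k : ℕ) (s : ℝ), |s| ≤ k → projZ z₀ ∈ (R (ν k)).safe s := by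
    intro k s hs
    have hmem : |s| / k ∈ Icc (0 : ℝ) 1 :=
      ⟨by positivity, div_le_one_of_le₀ hs (by positivity)⟩
    have hcancel : |s| / k * k = |s| := by
      refine div_mul_cancel_of_imp fun h0 => ?_
      rw [h0] at hs
      exact le_antisymm hs (abs_nonneg s)
    rcases le_total 0 s with h0 | h0
    · have := (R (ν k)).safe_subset_of_mul hmem (hν1 k)
      rwa [hcancel, abs_of_nonneg h0] at this
    · have := (R (ν k)).safe_subset_of_mul hmem (hν2 k)
      rwa [mul_neg, hcancel, abs_of_nonpos h0, neg_neg] at this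
  -- `ν k` is a cut-off index safe on `[-k, k]`. By `hweq` any `k ≥ |s|` gives the same value, so
  -- near each time `w` is a single cut-off curve.
  set w : ℝ → (Fin N → E3) × (Fin N → E3) := fun s => z (ν ⌈|s|⌉₊) s with hw
  have hweq : ∀ (k : ℕ) (s : ℝ), |s| ≤ k → w s = z (ν k) s := by
    intro k s hs
    have h1 := hagree _ (max (ν ⌈|s|⌉₊) (ν k)) s (le_max_left _ _)
      (hsafe ⌈|s|⌉₊ s (Nat.le_ceil _)) 1 (right_mem_Icc.2 zero_le_one)
    have h2 := hagree _ (max (ν ⌈|s|⌉₊) (ν k)) s (le_max_right _ _)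
      (hsafe k s hs) 1 (right_mem_Icc.2 zero_le_one)
    rw [one_mul] at h1 h2
    exact h1.symm.trans h2
  have hwsep : ∀ t : ℝ, ∃ k : ℕ, |t| < k ∧ Separated (cutoffDist (ν k)) (projN (z (ν k) t).1) := by
    intro t
    obtain ⟨k, hk⟩ := exists_nat_gt |t|
    have := hsafe k t hk.le 1 (right_mem_Icc.2 zero_le_one)
    rw [one_mul, happ] at this
    exact ⟨k, hk, this⟩
  refine ⟨fun t => projZ (w t), isTrajectory_of_curve (fun t => ?_) (fun t i j hij => ?_), ?_⟩
  · obtain ⟨k, hk, hsep⟩ := hwsep t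
    rw [hweq k t hk.le]
    refine ((R (ν k)).hasDerivAt_of_separated (hz _) hsep).congr_of_eventuallyEq ?_
    filter_upwards [(isOpen_lt continuous_abs continuous_const).mem_nhds hk] with s hs
    exact hweq k s (le_of_lt hs)
  · obtain ⟨k, hk, hsep⟩ := hwsep t
    rw [hweq k t hk.le]
    exact sub_ne_zero.1 (hsep.sub_ne_zero (cutoffDist_pos _) hij)
  · simp only [hw, hz0]

/-- Almost every initial datum has exactly one global collision-free trajectory. -/
lemma Admissible.ae_existsUnique (hφ : Admissible φ φmin A α) (hA : 0 ≤ A)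
    (hα2 : α < 2) (hmin : φmin ≤ 0) (hβ : 0 < β) :
    ∀ᵐ Z ∂(gibbs N φ β), ∃! γ : ℝ → Phase N, IsTrajectory φ γ ∧ γ 0 = Z := by
  have R : ∀ n, CutoffFlow N φ (cutoffDist n) := fun n =>
    (hφ.nonempty_cutoffFlow hA hα2 N (cutoffDist_pos n)).some
  filter_upwards [hφ.ae_exists_safe hA hα2 hmin hβ R] with Z hZ
  obtain ⟨γ, h, h0⟩ := exists_isTrajectory R hZ
  exact ⟨γ, ⟨h, h0⟩, fun γ' h' => h'.1.unique h R (h'.2.trans h0.symm)⟩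

lemma isTrajectory_flow {Z : Phase N} (h : ∃ γ : ℝ → Phase N, IsTrajectory φ γ ∧ γ 0 = Z) :
    IsTrajectory φ fun t => flow φ t Z := by
  have : (fun t => flow φ t Z) = h.choose := funext fun t => by rw [flow, dif_pos h]
  rw [this]
  exact h.choose_spec.1

lemma flow_zero (φ : T3 → ℝ) (Z : Phase N) : flow φ 0 Z = Z := by
  by_cases h : ∃ γ : ℝ → Phase N, IsTrajectory φ γ ∧ γ 0 = Z
  · rw [flow, dif_pos h]
    exact h.choose_spec.2
  · rw [flow, dif_neg h]

end Trajectories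

end NParticle

namespace NParticle

/-! ### Pathwise growth of the logarithmic distance -/

section Stability

variable {N : ℕ} {φ : T3 → ℝ} {φmin A α β : ℝ}

/-- A logarithmic form of Grönwall's inequality. -/
lemma log_one_add_div_le_of_le_integral {D e ρ : ℝ → ℝ} {δ : ℝ} (hδ : 0 < δ)
    (he : Continuous e) (hρ : Continuous ρ) (he0 : ∀ s, 0 ≤ e s) (hρ0 : ∀ s, 0 ≤ ρ s)
    (hD0 : ∀ s, 0 ≤ D s) (hD : ∀ t, 0 ≤ t → D t ≤ D 0 + ∫ s in (0 : ℝ)..t, e s)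
    (hle : ∀ s, e s ≤ ρ s * (D s + δ)) {t : ℝ} (ht : 0 ≤ t) :
    Real.log (1 + D t / δ) ≤ Real.log (1 + D 0 / δ) + ∫ s in (0 : ℝ)..t, ρ s := by
  -- A differentiable majorant of `D + δ`; `D` itself is only known through an integral inequality.
  set E : ℝ → ℝ := fun t => D 0 + δ + ∫ s in (0 : ℝ)..t, e s with hE
  have hEpos : ∀ s, 0 ≤ s → 0 < E s := fun s hs => by
    have h1 := intervalIntegral.integral_nonneg_of_forall (μ := volume) hs he0
    have h2 := hD0 0
    simp only [hE]
    linarith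
  have hEd : ∀ s, HasDerivAt E (e s) s := fun s => (he.integral_hasStrictDerivAt 0 s).hasDerivAt.const_add _
  have hρd : ∀ s, HasDerivAt (fun t => ∫ s in (0 : ℝ)..t, ρ s) (ρ s) s := fun s =>
    (hρ.integral_hasStrictDerivAt 0 s).hasDerivAt
  have hd : ∀ s, 0 ≤ s → HasDerivAt (fun t => Real.log (E t) - ∫ s in (0 : ℝ)..t, ρ s)
      (e s / E s - ρ s) s := fun s hs => ((hEd s).log (hEpos s hs).ne').sub (hρd s)
  have hanti : AntitoneOn (fun t => Real.log (E t) - ∫ s in (0 : ℝ)..t, ρ s) (Ici 0) := by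
    refine antitoneOn_of_deriv_nonpos (convex_Ici 0)
      (fun s hs => (hd s hs).continuousAt.continuousWithinAt)
      (fun s hs => (hd s (interior_subset hs)).differentiableAt.differentiableWithinAt)
      fun s hs => ?_
    have hs0 : 0 ≤ s := interior_subset hs
    rw [(hd s hs0).deriv, sub_nonpos, div_le_iff₀ (hEpos s hs0)]
    refine (hle s).trans (mul_le_mul_of_nonneg_left ?_ (hρ0 s))
    have := hD s hs0
    simp only [hE]
    linarith
  have h1 := hanti self_mem_Ici (mem_Ici.2 ht) ht
  have hE0 : E 0 = D 0 + δ := by simp [hE]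
  simp only [intervalIntegral.integral_same, sub_zero, hE0] at h1
  have h2 : Real.log (D t + δ) ≤ Real.log (E t) := by
    refine Real.log_le_log (by linarith [hD0 t]) ?_
    have := hD t ht
    simp only [hE]
    linarith
  have h3 : ∀ s, Real.log (1 + D s / δ) = Real.log (D s + δ) - Real.log δ := fun s => by
    rw [← Real.log_div (by linarith [hD0 s]) hδ.ne']
    congr 1
    field_simp
    ring
  rw [h3, h3]
  linarith

lemma norm1_nonneg (Z : Phase N) : 0 ≤ norm1 Z := by
  unfold norm1
  have : 0 ≤ ∑ i, (tnorm (Z.1 i) + ‖Z.2 i‖) :=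
    Finset.sum_nonneg fun i _ => add_nonneg (tnorm_nonneg _) (norm_nonneg _)
  positivity

/-- The rate of separation of two configurations is controlled by the two stability rates. -/
lemma KernelBound.separation_rate_le {G B : T3 → ℝ} {κ L δ : ℝ} (hK : KernelBound φ G B κ)
    (hκ : 0 < κ) (hδ : 0 < δ) (hL : 0 ≤ L) {Z Z' : Phase N}
    (hZ : ∀ i j, i ≠ j → Z.1 i - Z.1 j ≠ 0) (hZ' : ∀ i j, i ≠ j → Z'.1 i - Z'.1 j ≠ 0) :
    1 / (2 * (N : ℝ)) * ∑ i, (‖Z.2 i - Z'.2 i‖ + ‖meanForce φ Z.1 i - meanForce φ Z'.1 i‖) ≤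
      (1 + stabilityRate G B κ L δ Z.1 + stabilityRate G B κ L δ Z'.1) *
        (norm1 (Z - Z') + δ) := by
  rcases Nat.eq_zero_or_pos N with rfl | hNpos
  · have h1 := stabilityRate_nonneg (G := G) hκ.le hL hδ.le hK.B_nonneg Z.1
    have h2 := stabilityRate_nonneg (G := G) hκ.le hL hδ.le hK.B_nonneg Z'.1
    have h3 := norm1_nonneg (Z - Z')
    simp only [Finset.univ_eq_empty, Finset.sum_empty, mul_zero]
    positivity
  have hN : (0 : ℝ) < N := by exact_mod_cast hNpos
  set d : Fin N → ℝ := fun i => tnorm (Z.1 i - Z'.1 i) with hd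
  have hd0 : ∀ i, 0 ≤ d i := fun i => tnorm_nonneg _
  set g : Fin N → Fin N → ℝ := fun i j => G (Z.1 i - Z.1 j) + G (Z'.1 i - Z'.1 j) with hg
  set b : Fin N → Fin N → ℝ := fun i j => B (Z.1 i - Z.1 j) + B (Z'.1 i - Z'.1 j) with hb
  have hg0 : ∀ i j, 0 ≤ g i j := fun i j => add_nonneg (hK.G_nonneg _) (hK.G_nonneg _)
  have hgs : ∀ i j, g i j = g j i := fun i j => by
    simp only [hg]
    rw [← hK.G_neg (Z.1 i - Z.1 j), ← hK.G_neg (Z'.1 i - Z'.1 j), neg_sub, neg_sub]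
  have hforce : ∀ i, ‖meanForce φ Z.1 i - meanForce φ Z'.1 i‖ ≤
      1 / (N : ℝ) * ∑ j ∈ Finset.univ.erase i, (g i j * (d i + d j) + b i j) := by
    intro i
    rw [meanForce, meanForce, ← smul_sub, ← Finset.sum_sub_distrib, norm_smul,
      Real.norm_of_nonneg (by positivity)]
    refine mul_le_mul_of_nonneg_left ((norm_sum_le _ _).trans
      (Finset.sum_le_sum fun j hj => ?_)) (by positivity)
    have hij : i ≠ j := (Finset.ne_of_mem_erase hj).symm
    refine (hK.bound _ _ (hZ i j hij) (hZ' i j hij)).trans ?_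
    refine add_le_add_left (mul_le_mul_of_nonneg_left ?_ (hg0 i j)) _
    have : Z.1 i - Z.1 j - (Z'.1 i - Z'.1 j) = (Z.1 i - Z'.1 i) - (Z.1 j - Z'.1 j) := by abel
    rw [this]
    exact tnorm_sub_le _ _
  -- The symmetry of `g` exchanges `d j` for `d i`. Each displacement is then multiplied by a sum
  -- over `j` alone, which `hgM` bounds uniformly in `i`.
  have hsum : ∑ i, ∑ j ∈ Finset.univ.erase i, (g i j * (d i + d j) + b i j) =
      2 * ∑ i, d i * ∑ j ∈ Finset.univ.erase i, g i j +
        ∑ i, ∑ j ∈ Finset.univ.erase i, b i j := by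
    have e1 : ∑ i, ∑ j ∈ Finset.univ.erase i, g i j * d j =
        ∑ i, ∑ j ∈ Finset.univ.erase i, g i j * d i := by
      rw [sum_erase_swap]
      exact Finset.sum_congr rfl fun i _ => Finset.sum_congr rfl fun j _ => by rw [hgs j i]
    have e2 : ∀ i, d i * ∑ j ∈ Finset.univ.erase i, g i j =
        ∑ j ∈ Finset.univ.erase i, g i j * d i := fun i => by
      rw [Finset.mul_sum]
      exact Finset.sum_congr rfl fun j _ => mul_comm _ _
    simp only [mul_add, Finset.sum_add_distrib, e1, e2]
    ring
  set M : Phase N → ℝ := fun Z => κ / N * (L + Real.exp (-L) *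
    ∑ i, Real.exp (∑ j ∈ Finset.univ.erase i, G (Z.1 i - Z.1 j) / κ)) with hM
  set S : Phase N → ℝ := fun Z => 1 / (2 * (N : ℝ) ^ 2 * δ) *
    ∑ i, ∑ j ∈ Finset.univ.erase i, B (Z.1 i - Z.1 j) with hS
  have hrate : ∀ Z : Phase N, stabilityRate G B κ L δ Z.1 = 2 * M Z + S Z := fun Z => rfl
  have hM0 : ∀ Z, 0 ≤ M Z := fun Z => by simp only [hM]; positivity
  have hS0 : ∀ Z, 0 ≤ S Z := fun Z => by
    have : 0 ≤ ∑ i, ∑ j ∈ Finset.univ.erase i, B (Z.1 i - Z.1 j) :=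
      Finset.sum_nonneg fun i _ => Finset.sum_nonneg fun j _ => hK.B_nonneg _
    simp only [hS]; positivity
  have hgM : ∀ i, 1 / (N : ℝ) * ∑ j ∈ Finset.univ.erase i, g i j ≤ M Z + M Z' := fun i => by
    simp only [hg, Finset.sum_add_distrib, mul_add]
    exact add_le_add (sum_div_le_of_exp_sum hκ Z.1 i) (sum_div_le_of_exp_sum hκ Z'.1 i)
  have hbS : ∑ i, ∑ j ∈ Finset.univ.erase i, b i j = 2 * (N : ℝ) ^ 2 * δ * (S Z + S Z') := by
    simp only [hb, hS, Finset.sum_add_distrib]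
    field_simp
  set v := 1 / (2 * (N : ℝ)) * ∑ i, ‖Z.2 i - Z'.2 i‖ with hv
  set p := 1 / (2 * (N : ℝ)) * ∑ i, d i with hp
  have hv0 : 0 ≤ v := mul_nonneg (by positivity) (Finset.sum_nonneg fun i _ => norm_nonneg _)
  have hp0 : 0 ≤ p := mul_nonneg (by positivity) (Finset.sum_nonneg fun i _ => hd0 i)
  have hnorm : norm1 (Z - Z') = p + v := by
    simp only [norm1, hp, hv, hd, Finset.sum_add_distrib, mul_add, Prod.fst_sub, Prod.snd_sub,
      Pi.sub_apply]
  have hmain : 1 / (2 * (N : ℝ)) * ∑ i, ‖meanForce φ Z.1 i - meanForce φ Z'.1 i‖ ≤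
      2 * (M Z + M Z') * p + δ * (S Z + S Z') := by
    calc _ ≤ 1 / (2 * (N : ℝ)) *
          ∑ i, (1 / (N : ℝ) * ∑ j ∈ Finset.univ.erase i, (g i j * (d i + d j) + b i j)) :=
          mul_le_mul_of_nonneg_left (Finset.sum_le_sum fun i _ => hforce i) (by positivity)
      _ = 1 / (2 * (N : ℝ)) * (2 * ∑ i, d i * (1 / (N : ℝ) * ∑ j ∈ Finset.univ.erase i, g i j)) +
          δ * (S Z + S Z') := by
          rw [← Finset.mul_sum, hsum, hbS]
          have : ∑ i, d i * (1 / (N : ℝ) * ∑ j ∈ Finset.univ.erase i, g i j) =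
              1 / (N : ℝ) * ∑ i, d i * ∑ j ∈ Finset.univ.erase i, g i j := by
            rw [Finset.mul_sum]
            exact Finset.sum_congr rfl fun i _ => by ring
          rw [this]
          field_simp
      _ ≤ 1 / (2 * (N : ℝ)) * (2 * ∑ i, d i * (M Z + M Z')) + δ * (S Z + S Z') := by
          gcongr with i _
          · exact hd0 i
          · exact hgM i
      _ = _ := by rw [← Finset.sum_mul, hp]; ring
  rw [Finset.sum_add_distrib, mul_add, ← hv, hrate, hrate, hnorm]
  -- The two products are the slack between `hmain` and the product form: the maxima are needed only
  -- against `p`, the crude parts only against `δ`.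
  have h1 := mul_nonneg (add_nonneg (hM0 Z) (hM0 Z')) (add_nonneg hv0 hδ.le)
  have h2 := mul_nonneg (add_nonneg (hS0 Z) (hS0 Z')) (add_nonneg hp0 hv0)
  nlinarith [hmain]

namespace IsTrajectory

variable {γ γ' : ℝ → Phase N}

lemma continuous_sub_comp (h : IsTrajectory φ γ) {E : Type*} [TopologicalSpace E] {k : T3 → E}
    (hk : ∀ z, z ≠ 0 → ContinuousAt k z) {i j : Fin N} (hij : i ≠ j) :
    Continuous fun t => k ((γ t).1 i - (γ t).1 j) := by
  have h1 : Continuous fun t => (γ t).1 := continuous_fst.comp h.continuous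
  have h2 : Continuous fun t => (γ t).1 i - (γ t).1 j :=
    ((continuous_apply i).comp h1).sub ((continuous_apply j).comp h1)
  exact continuous_iff_continuousAt.2 fun t =>
    ContinuousAt.comp (f := fun t => (γ t).1 i - (γ t).1 j) (hk _ (h.sub_ne_zero t hij))
      h2.continuousAt

lemma continuous_stabilityRate (h : IsTrajectory φ γ) {G B : T3 → ℝ} {κ : ℝ}
    (hK : KernelBound φ G B κ) (L δ : ℝ) :
    Continuous fun t => stabilityRate G B κ L δ (γ t).1 := by
  have h1 : ∀ i, ∀ j ∈ Finset.univ.erase i, Continuous fun t => G ((γ t).1 i - (γ t).1 j) :=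
    fun i j hj => h.continuous_sub_comp hK.continuousAt_G (Finset.ne_of_mem_erase hj).symm
  have h2 : ∀ i, ∀ j ∈ Finset.univ.erase i, Continuous fun t => B ((γ t).1 i - (γ t).1 j) :=
    fun i j hj => h.continuous_sub_comp hK.continuousAt_B (Finset.ne_of_mem_erase hj).symm
  unfold stabilityRate
  refine Continuous.add ?_ (continuous_const.mul
    (continuous_finsetSum _ fun i _ => continuous_finsetSum _ fun j hj => h2 i j hj))
  refine continuous_const.mul (continuous_const.mul (continuous_const.add (continuous_const.mul
    (continuous_finsetSum _ fun i _ => Real.continuous_exp.comp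
      (continuous_finsetSum _ fun j hj => (h1 i j hj).div_const _)))))

lemma continuous_meanForce (h : IsTrajectory φ γ) (hφ : Admissible φ φmin A α) (i : Fin N) :
    Continuous fun t => meanForce φ (γ t).1 i := by
  have : Continuous fun t => ∑ j ∈ Finset.univ.erase i, torusForce φ ((γ t).1 i - (γ t).1 j) :=
    continuous_finsetSum _ fun j hj => h.continuous_sub_comp
      (fun z hz => hφ.continuousAt_torusForce hz) (Finset.ne_of_mem_erase hj).symm
  exact this.const_smul (1 / (N : ℝ))

/-- The distance of two trajectories grows at most by the integral of their separation rate. -/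
lemma norm1_sub_le (h : IsTrajectory φ γ) (h' : IsTrajectory φ γ') (hφ : Admissible φ φmin A α)
    {t : ℝ} (ht : 0 ≤ t) :
    norm1 (γ t - γ' t) ≤ norm1 (γ 0 - γ' 0) + ∫ s in (0 : ℝ)..t, 1 / (2 * (N : ℝ)) *
      ∑ i, (‖(γ s).2 i - (γ' s).2 i‖ + ‖meanForce φ (γ s).1 i - meanForce φ (γ' s).1 i‖) := by
  obtain ⟨w, hw, hd⟩ := h.exists_curve
  obtain ⟨w', hw', hd'⟩ := h'.exists_curve
  have hf : ∀ s, projN (w s).1 = (γ s).1 := fun s => congrArg Prod.fst (hw s)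
  have hf' : ∀ s, projN (w' s).1 = (γ' s).1 := fun s => congrArg Prod.fst (hw' s)
  have hs : ∀ s, (w s).2 = (γ s).2 := fun s => congrArg Prod.snd (hw s)
  have hs' : ∀ s, (w' s).2 = (γ' s).2 := fun s => congrArg Prod.snd (hw' s)
  have cv : ∀ i, Continuous fun s => (γ s).2 i := fun i =>
    (continuous_apply i).comp (continuous_snd.comp h.continuous)
  have cv' : ∀ i, Continuous fun s => (γ' s).2 i := fun i =>
    (continuous_apply i).comp (continuous_snd.comp h'.continuous)
  have dx : ∀ i s, HasDerivAt (fun s => (w s).1 i - (w' s).1 i) ((γ s).2 i - (γ' s).2 i) s :=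
    fun i s => by
      rw [← hs, ← hs']
      exact (hasDerivAt_pi.1 (hasDerivAt_fst (hd s)) i).sub
        (hasDerivAt_pi.1 (hasDerivAt_fst (hd' s)) i)
  have dv : ∀ i s, HasDerivAt (fun s => (γ s).2 i - (γ' s).2 i)
      (meanForce φ (γ s).1 i - meanForce φ (γ' s).1 i) s := fun i s => by
    rw [← hf, ← hf']
    simp only [← hs, ← hs']
    exact (hasDerivAt_pi.1 (hasDerivAt_snd (hd s)) i).sub
      (hasDerivAt_pi.1 (hasDerivAt_snd (hd' s)) i)
  have cdv : ∀ i, Continuous fun s => (γ s).2 i - (γ' s).2 i := fun i => (cv i).sub (cv' i)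
  have cda : ∀ i, Continuous fun s => meanForce φ (γ s).1 i - meanForce φ (γ' s).1 i := fun i =>
    (h.continuous_meanForce hφ i).sub (h'.continuous_meanForce hφ i)
  have hpos : ∀ i, tnorm ((γ t).1 i - (γ' t).1 i) ≤ tnorm ((γ 0).1 i - (γ' 0).1 i) +
      ∫ s in (0 : ℝ)..t, ‖(γ s).2 i - (γ' s).2 i‖ := fun i => by
    have h1 := intervalIntegral.integral_eq_sub_of_hasDerivAt (fun s _ => dx i s)
      ((cdv i).intervalIntegrable 0 t)
    -- Torus displacements evolve by the projection of the lifted displacement, and projecting does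
    -- not increase length.
    have h2 : (γ t).1 i - (γ' t).1 i = ((γ 0).1 i - (γ' 0).1 i) +
        proj (∫ s in (0 : ℝ)..t, ((γ s).2 i - (γ' s).2 i)) := by
      rw [h1, proj_sub, proj_sub, proj_sub, ← hf, ← hf', ← hf, ← hf']
      simp only [projN]
      abel
    rw [h2]
    refine (tnorm_add_le _ _).trans (add_le_add_right ((tnorm_proj_le _).trans ?_) _)
    exact intervalIntegral.norm_integral_le_integral_norm ht
  have hvel : ∀ i, ‖(γ t).2 i - (γ' t).2 i‖ ≤ ‖(γ 0).2 i - (γ' 0).2 i‖ +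
      ∫ s in (0 : ℝ)..t, ‖meanForce φ (γ s).1 i - meanForce φ (γ' s).1 i‖ := fun i => by
    have h1 := intervalIntegral.integral_eq_sub_of_hasDerivAt (fun s _ => dv i s)
      ((cda i).intervalIntegrable 0 t)
    have h2 : (γ t).2 i - (γ' t).2 i = ((γ 0).2 i - (γ' 0).2 i) +
        ∫ s in (0 : ℝ)..t, (meanForce φ (γ s).1 i - meanForce φ (γ' s).1 i) := by
      rw [h1]; abel
    rw [h2]
    refine (norm_add_le _ _).trans (add_le_add_right ?_ _)
    exact intervalIntegral.norm_integral_le_integral_norm ht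
  have hint : ∫ s in (0 : ℝ)..t, 1 / (2 * (N : ℝ)) *
      ∑ i, (‖(γ s).2 i - (γ' s).2 i‖ + ‖meanForce φ (γ s).1 i - meanForce φ (γ' s).1 i‖) =
      1 / (2 * (N : ℝ)) * ∑ i, ((∫ s in (0 : ℝ)..t, ‖(γ s).2 i - (γ' s).2 i‖) +
        ∫ s in (0 : ℝ)..t, ‖meanForce φ (γ s).1 i - meanForce φ (γ' s).1 i‖) := by
    have hcont : ∀ i, Continuous fun s => ‖(γ s).2 i - (γ' s).2 i‖ +
        ‖meanForce φ (γ s).1 i - meanForce φ (γ' s).1 i‖ := fun i => (cdv i).norm.add (cda i).norm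
    rw [intervalIntegral.integral_const_mul,
      intervalIntegral.integral_finsetSum fun i _ => (hcont i).intervalIntegrable 0 t]
    congr 1
    exact Finset.sum_congr rfl fun i _ => intervalIntegral.integral_add
      ((cdv i).norm.intervalIntegrable 0 t) ((cda i).norm.intervalIntegrable 0 t)
  rw [hint, norm1, norm1, ← mul_add, ← Finset.sum_add_distrib]
  refine mul_le_mul_of_nonneg_left (Finset.sum_le_sum fun i _ => ?_) (by positivity)
  have h1 := hpos i
  have h2 := hvel i
  simp only [Prod.fst_sub, Prod.snd_sub, Pi.sub_apply]
  linarith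

/-- Stability of trajectories: the logarithmic distance grows at most by the time integral of the
stability rates. -/
lemma ofReal_log_norm1_sub_le (h : IsTrajectory φ γ) (h' : IsTrajectory φ γ')
    (hφ : Admissible φ φmin A α) {G B : T3 → ℝ} {κ L δ : ℝ} (hK : KernelBound φ G B κ)
    (hκ : 0 < κ) (hδ : 0 < δ) (hL : 0 ≤ L) {t : ℝ} (ht : 0 ≤ t) :
    ENNReal.ofReal (Real.log (1 + norm1 (γ t - γ' t) / δ)) ≤
      ENNReal.ofReal (Real.log (1 + norm1 (γ 0 - γ' 0) / δ)) + (ENNReal.ofReal t +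
        ((∫⁻ s in Ioc 0 t, ENNReal.ofReal (stabilityRate G B κ L δ (γ s).1)) +
          ∫⁻ s in Ioc 0 t, ENNReal.ofReal (stabilityRate G B κ L δ (γ' s).1))) := by
  have c := h.continuous_stabilityRate hK L δ
  have c' := h'.continuous_stabilityRate hK L δ
  have hr := fun s => stabilityRate_nonneg (G := G) hκ.le hL hδ.le hK.B_nonneg (γ s).1
  have hr' := fun s => stabilityRate_nonneg (G := G) hκ.le hL hδ.le hK.B_nonneg (γ' s).1
  have key := log_one_add_div_le_of_le_integral (D := fun s => norm1 (γ s - γ' s))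
    (e := fun s => 1 / (2 * (N : ℝ)) * ∑ i, (‖(γ s).2 i - (γ' s).2 i‖ +
      ‖meanForce φ (γ s).1 i - meanForce φ (γ' s).1 i‖))
    (ρ := fun s => 1 + stabilityRate G B κ L δ (γ s).1 + stabilityRate G B κ L δ (γ' s).1) hδ
    (continuous_const.mul (continuous_finsetSum _ fun i _ =>
      (((continuous_apply i).comp (continuous_snd.comp h.continuous)).sub
        ((continuous_apply i).comp (continuous_snd.comp h'.continuous))).norm.add
      ((h.continuous_meanForce hφ i).sub (h'.continuous_meanForce hφ i)).norm))
    ((continuous_const.add c).add c')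
    (fun s => mul_nonneg (by positivity)
      (Finset.sum_nonneg fun i _ => add_nonneg (norm_nonneg _) (norm_nonneg _)))
    (fun s => by linarith [hr s, hr' s]) (fun s => norm1_nonneg _)
    (fun t ht => h.norm1_sub_le h' hφ ht)
    (fun s => hK.separation_rate_le hκ hδ hL (fun i j hij => h.sub_ne_zero s hij)
      (fun i j hij => h'.sub_ne_zero s hij)) ht
  have hconv : ∀ f : ℝ → ℝ, Continuous f → (∀ s, 0 ≤ f s) →
      ∫⁻ s in Ioc 0 t, ENNReal.ofReal (f s) = ENNReal.ofReal (∫ s in (0 : ℝ)..t, f s) := by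
    intro f hf h0
    rw [intervalIntegral.integral_of_le ht, ofReal_integral_eq_lintegral_ofReal
      (hf.intervalIntegrable 0 t).1 (ae_of_all _ h0)]
  have hsplit : ∫ s in (0 : ℝ)..t,
      (1 + stabilityRate G B κ L δ (γ s).1 + stabilityRate G B κ L δ (γ' s).1) =
      t + ((∫ s in (0 : ℝ)..t, stabilityRate G B κ L δ (γ s).1) +
        ∫ s in (0 : ℝ)..t, stabilityRate G B κ L δ (γ' s).1) := by
    have c1 : Continuous fun s => 1 + stabilityRate G B κ L δ (γ s).1 := continuous_const.add c
    rw [intervalIntegral.integral_add (c1.intervalIntegrable 0 t)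
      (c'.intervalIntegrable 0 t), intervalIntegral.integral_add
      (continuous_const.intervalIntegrable 0 t) (c.intervalIntegrable 0 t),
      intervalIntegral.integral_const]
    simp only [sub_zero, smul_eq_mul, mul_one]
    ring
  have i1 := intervalIntegral.integral_nonneg_of_forall (μ := volume) ht hr
  have i2 := intervalIntegral.integral_nonneg_of_forall (μ := volume) ht hr'
  rw [hconv _ c hr, hconv _ c' hr', ← ENNReal.ofReal_add i1 i2,
    ← ENNReal.ofReal_add ht (add_nonneg i1 i2), ← ENNReal.ofReal_add
      (Real.log_nonneg (by have := div_nonneg (norm1_nonneg (γ 0 - γ' 0)) hδ.le; linarith))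
      (add_nonneg ht (add_nonneg i1 i2)), ← hsplit]
  exact ENNReal.ofReal_le_ofReal key

end IsTrajectory

end Stability

end NParticle

namespace NParticle

/-! ### Averaging over initial data and shifts -/

section LogDistance

variable {N : ℕ} {φ : T3 → ℝ} {φmin A α β : ℝ}

/-- A jointly measurable version of `f` along the trajectories of the Newton system. -/
noncomputable def alongFlow (R : ∀ n, CutoffFlow N φ (cutoffDist n)) (f : Phase N → ℝ≥0∞)
    (p : Phase N × ℝ) : ℝ≥0∞ :=
  liminf (fun n => ((R n).safe p.2).indicator (fun Z => f ((R n).Φ p.2 Z)) p.1) atTop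

section AlongFlow

variable (R : ∀ n, CutoffFlow N φ (cutoffDist n)) {f : Phase N → ℝ≥0∞}

lemma measurable_safe_indicator_swap (hf : Measurable f) (n : ℕ) :
    Measurable fun p : Phase N × ℝ =>
      ((R n).safe p.2).indicator (fun Z => f ((R n).Φ p.2 Z)) p.1 := by
  simpa only [mul_one] using (R n).measurable_safe_indicator_mul hf 1

lemma measurable_alongFlow (hf : Measurable f) : Measurable (alongFlow R f) :=
  Measurable.liminf fun n => measurable_safe_indicator_swap R hf n

/-- The sequence is eventually constant. This replaces the flow, defined by choice, by something
visibly measurable in datum and time. -/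
lemma IsTrajectory.alongFlow_eq {γ : ℝ → Phase N} (h : IsTrajectory φ γ) (t : ℝ) :
    alongFlow R f (γ 0, t) = f (γ t) := by
  have : (fun n => ((R n).safe t).indicator (fun Z => f ((R n).Φ t Z)) (γ 0)) =ᶠ[atTop]
      fun _ => f (γ t) := by
    filter_upwards [h.eventually_safe R t] with n hn
    rw [indicator_of_mem hn.1, hn.2]
  rw [alongFlow, liminf_congr this, liminf_const]

/-- Fatou transfers the non-increase of the Gibbs measure from the cut-off flows to the Newton flow.
-/
lemma Admissible.lintegral_alongFlow_le (hφ : Admissible φ φmin A α) (hf : Measurable f) (t : ℝ) :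
    ∫⁻ Z, alongFlow R f (Z, t) ∂(gibbs N φ β) ≤ ∫⁻ Z, f Z ∂(gibbs N φ β) := by
  have hm : ∀ n, Measurable fun Z : Phase N =>
      ((R n).safe t).indicator (fun Z => f ((R n).Φ t Z)) Z := fun n =>
    (hf.comp ((R n).measurable_apply t)).indicator ((R n).measurableSet_safe t)
  refine (lintegral_liminf_le hm).trans ?_
  refine (liminf_le_liminf (Eventually.of_forall fun n =>
    (R n).lintegral_safe_le hφ (cutoffDist_pos n) t hf)).trans ?_
  rw [liminf_const]

lemma Admissible.lintegral_setLIntegral_alongFlow_le (hφ : Admissible φ φmin A α)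
    (hf : Measurable f) (t : ℝ) :
    ∫⁻ Z, (∫⁻ s in Ioc 0 t, alongFlow R f (Z, s)) ∂(gibbs N φ β) ≤
      ENNReal.ofReal t * ∫⁻ Z, f Z ∂(gibbs N φ β) := by
  have hm := measurable_alongFlow R hf
  rw [lintegral_lintegral_swap (f := fun Z s => alongFlow R f (Z, s)) hm.aemeasurable]
  calc _ ≤ ∫⁻ _ in Ioc 0 t, ∫⁻ Z, f Z ∂(gibbs N φ β) :=
        lintegral_mono fun s => hφ.lintegral_alongFlow_le R hf s
    _ = _ := by rw [setLIntegral_const, Real.volume_Ioc, sub_zero, mul_comm]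

end AlongFlow

/-- Growth of the mean logarithmic distance in terms of the mean stability rate. -/
theorem Admissible.Q_le (hφ : Admissible φ φmin A α) (hA : 0 ≤ A) (hα2 : α < 2) (hmin : φmin ≤ 0)
    (hβ : 0 < β) {G B : T3 → ℝ} {κ L δ : ℝ} (hK : KernelBound φ G B κ) (hκ : 0 < κ) (hδ : 0 < δ)
    (hL : 0 ≤ L) (ψ : Kernel (Phase N) (Phase N)) [IsMarkovKernel ψ] {K : ℝ≥0∞}
    (hψ : shifted φ β ψ ≤ K • gibbs N φ β) {t : ℝ} (ht : 0 ≤ t) {E : ℝ≥0∞}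
    (hE : ∫⁻ Z : Phase N, ENNReal.ofReal (stabilityRate G B κ L δ Z.1) ∂(gibbs N φ β) ≤ E) :
    Q φ β ψ δ t ≤ Q φ β ψ δ 0 + (ENNReal.ofReal t +
      (ENNReal.ofReal t * E + K * (ENNReal.ofReal t * E))) := by
  have R : ∀ n, CutoffFlow N φ (cutoffDist n) := fun n =>
    (hφ.nonempty_cutoffFlow hA hα2 N (cutoffDist_pos n)).some
  set μ := gibbs N φ β with hμ
  set f : Phase N → ℝ≥0∞ := fun Z => ENNReal.ofReal (stabilityRate G B κ L δ Z.1) with hf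
  have hfm : Measurable f :=
    ((measurable_stabilityRate hK.measurable_G hK.measurable_B κ L δ).comp
      measurable_fst).ennreal_ofReal
  obtain ⟨h, hh, hhm, hhle⟩ : ∃ h : Phase N → ℝ≥0∞,
      (∀ Z, h Z = ∫⁻ s in Ioc 0 t, alongFlow R f (Z, s)) ∧ Measurable h ∧
        ∫⁻ Z, h Z ∂μ ≤ ENNReal.ofReal t * E :=
    ⟨_, fun Z => rfl, (measurable_alongFlow R hfm).lintegral_prod_right',
      (hφ.lintegral_setLIntegral_alongFlow_le R hfm t).trans (mul_le_mul' le_rfl hE)⟩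
  have hadd : Measurable fun p : Phase N × Phase N => p.1 + p.2 := measurable_add
  set good : Phase N → Prop := fun Z => ∃ γ : ℝ → Phase N, IsTrajectory φ γ ∧ γ 0 = Z with hgood
  have hae : ∀ᵐ Z ∂μ, good Z :=
    (hφ.ae_existsUnique hA hα2 hmin hβ).mono fun Z hZ => hZ.exists
  -- Domination by a multiple of `μ` makes almost every shifted datum have a global trajectory too.
  have hac : shifted φ β ψ ≪ μ :=
    (Measure.absolutelyContinuous_of_le hψ).trans Measure.smul_absolutelyContinuous
  have hae' : ∀ᵐ Z ∂μ, ∀ᵐ d ∂(ψ Z), good (Z + d) := by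
    have h1 : ∀ᵐ Z ∂(shifted φ β ψ), good Z := hac.ae_le hae
    have h2 : ∀ᵐ p ∂(μ ⊗ₘ ψ), good (p.1 + p.2) := ae_of_ae_map hadd.aemeasurable h1
    exact Measure.ae_ae_of_ae_compProd h2
  have htraj : ∀ Z, good Z → ∫⁻ s in Ioc 0 t, f (flow φ s Z) = h Z := fun Z hZ => by
    rw [hh]
    refine lintegral_congr fun s => ?_
    have := (isTrajectory_flow hZ).alongFlow_eq R (f := f) s
    rw [flow_zero] at this
    exact this.symm
  have hpoint : ∀ Z d, good Z → good (Z + d) →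
      ENNReal.ofReal (Real.log (1 + norm1 (flow φ t Z - flow φ t (Z + d)) / δ)) ≤
      ENNReal.ofReal (Real.log (1 + norm1 (flow φ 0 Z - flow φ 0 (Z + d)) / δ)) +
        (ENNReal.ofReal t + (h Z + h (Z + d))) := by
    intro Z d h1 h2
    rw [← htraj Z h1, ← htraj _ h2]
    exact (isTrajectory_flow h1).ofReal_log_norm1_sub_le (isTrajectory_flow h2) hφ hK hκ hδ hL ht
  have hm2 : Measurable fun p : Phase N × Phase N => h (p.1 + p.2) := hhm.comp hadd
  have hm1 : Measurable fun p : Phase N × Phase N => h p.1 := hhm.comp measurable_fst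
  have hsum : Measurable fun p : Phase N × Phase N =>
      ENNReal.ofReal t + (h p.1 + h (p.1 + p.2)) := measurable_const.add (hm1.add hm2)
  have hsumZ : ∀ Z, Measurable fun d => ENNReal.ofReal t + (h Z + h (Z + d)) := fun Z =>
    hsum.comp measurable_prodMk_left
  have hint : Measurable fun Z => ∫⁻ d, (ENNReal.ofReal t + (h Z + h (Z + d))) ∂(ψ Z) :=
    hsum.lintegral_kernel_prod_right'
  calc Q φ β ψ δ t ≤ ∫⁻ Z, ((∫⁻ d, ENNReal.ofReal
          (Real.log (1 + norm1 (flow φ 0 Z - flow φ 0 (Z + d)) / δ)) ∂(ψ Z)) +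
          ∫⁻ d, (ENNReal.ofReal t + (h Z + h (Z + d))) ∂(ψ Z)) ∂μ := by
        -- The integral is split with the measurable summand on the right, so no measurability of
        -- the logarithmic distance, hence of `flow`, is required.
        refine lintegral_mono_ae ?_
        filter_upwards [hae, hae'] with Z h1 h2
        rw [← lintegral_add_right _ (hsumZ Z)]
        exact lintegral_mono_ae (h2.mono fun d hd => hpoint Z d h1 hd)
    _ = Q φ β ψ δ 0 + ∫⁻ Z, ∫⁻ d, (ENNReal.ofReal t + (h Z + h (Z + d))) ∂(ψ Z) ∂μ :=
        lintegral_add_right _ hint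
    _ = Q φ β ψ δ 0 + ∫⁻ p, (ENNReal.ofReal t + (h p.1 + h (p.1 + p.2))) ∂(μ ⊗ₘ ψ) := by
        rw [Measure.lintegral_compProd hsum]
    _ ≤ _ := by
        refine add_le_add_right ?_ _
        have h12 : Measurable fun p : Phase N × Phase N => h p.1 + h (p.1 + p.2) := hm1.add hm2
        rw [lintegral_add_left measurable_const, lintegral_add_left hm1, lintegral_const]
        refine add_le_add ?_ (add_le_add ?_ ?_)
        · rw [Measure.compProd_apply_univ]
          exact (mul_le_mul' le_rfl (gibbs_univ_le_one hφ.measurable)).trans (mul_one _).le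
        · rw [Measure.lintegral_compProd hm1]
          simpa using hhle
        · have : ∫⁻ p, h (p.1 + p.2) ∂(μ ⊗ₘ ψ) = ∫⁻ Z, h Z ∂(shifted φ β ψ) := by
            rw [shifted, lintegral_map hhm hadd]
          rw [this]
          refine (lintegral_mono' hψ le_rfl).trans ?_
          rw [lintegral_smul_measure, smul_eq_mul]
          exact mul_le_mul' le_rfl hhle

/-- The mean stability rate is bounded uniformly in the number of particles. -/
lemma Admissible.exists_stabilityRate_bound (hφ : Admissible φ φmin A α) (hA : 0 < A)
    (hα2 : α < 2) (hmin : φmin ≤ 0) (hβ : 0 < β) (hN : 1 ≤ N) {ε : ℝ} (hε : ε ≤ 1 - α / 3) :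
    ∃ G B κ L, KernelBound φ G B κ ∧ 0 < κ ∧ 0 ≤ L ∧
      ∫⁻ Z : Phase N, ENNReal.ofReal (stabilityRate G B κ L ((N : ℝ) ^ (-ε)) Z.1) ∂(gibbs N φ β) ≤
        ENNReal.ofReal (2640 * A * Real.exp (-β * φmin) / (2 - α)) := by
  obtain ⟨G, B, κ, hK, hκ, hκN, hG, hB⟩ := hφ.exists_kernelBound hA hα2 hN
  have hN1 : (1 : ℝ) ≤ N := by exact_mod_cast hN
  have hN0 : (0 : ℝ) < N := by linarith
  have h2 : 0 < 2 - α := by linarith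
  have hlog := Real.log_nonneg hN1
  set c := Real.exp (-β * φmin) with hc
  have hc1 : 1 ≤ c := Real.one_le_exp (by nlinarith)
  set I := 256 * A / (2 - α) with hI
  have hI0 : 0 ≤ I := by positivity
  have hJ0 : 0 ≤ 3072 * A / (2 - α) * (N : ℝ) ^ (-(1 - α / 3)) := by positivity
  refine ⟨G, B, κ, Real.log N + 2 * N * c * I / κ, hK, hκ, by positivity, ?_⟩
  refine (hφ.lintegral_stabilityRate_le hA.le hα2 hmin hβ hN hK hκ hI0 hJ0
    (Real.rpow_pos_of_pos hN0 (-ε)) hG hB rfl).trans (ENNReal.ofReal_le_ofReal ?_)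
  have hq : (N : ℝ) ^ (-(1 - α / 3)) ≤ (N : ℝ) ^ (-ε) :=
    Real.rpow_le_rpow_of_exponent_le hN1 (by linarith)
  have hδ0 : 0 < (N : ℝ) ^ (-ε) := Real.rpow_pos_of_pos hN0 _
  -- This is where `ε ≤ 1 - α / 3` enters: the close pairs contribute at most a constant after
  -- division by `δ_N`.
  have h3 : c * (3072 * A / (2 - α) * (N : ℝ) ^ (-(1 - α / 3))) / (2 * (N : ℝ) ^ (-ε)) ≤
      1536 * (c * (A / (2 - α))) := by
    rw [div_le_iff₀ (by positivity)]
    have : 0 ≤ 3072 * (c * (A / (2 - α))) := by positivity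
    calc _ = 3072 * (c * (A / (2 - α))) * (N : ℝ) ^ (-(1 - α / 3)) := by ring
      _ ≤ 3072 * (c * (A / (2 - α))) * (N : ℝ) ^ (-ε) := by gcongr
      _ = _ := by ring
  have h4 : A / (2 - α) ≤ c * (A / (2 - α)) := le_mul_of_one_le_left (by positivity) hc1
  have h5 : 40 * A / (2 - α) = 40 * (A / (2 - α)) := by ring
  have h6 : I = 256 * (A / (2 - α)) := by rw [hI]; ring
  -- `2640 = 2 * 40 + 4 * 256 + 1536`: the logarithmic term, the integral of `G` and the close
  -- pairs; `c ≥ 1` lets the first term carry a factor `c`.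
  have h7 : 2640 * A * c / (2 - α) = 2640 * (c * (A / (2 - α))) := by ring
  rw [h5] at hκN
  rw [h7, h6]
  linarith

end LogDistance

end NParticle

/-! ### Final statement -/

theorem theorem1 (A : ℝ) (hA : 0 < A) :
    ∃ C : ℝ, 0 < C ∧ ∃ Ca : ℝ → ℝ → ℝ,
      (∀ α a : ℝ, α < 2 → 2 * α / 3 < a → 0 < Ca α a ∧ Ca α a ≤ C / (3 * a - 2 * α)) ∧
      ∀ (α φmin β : ℝ) (φ : NParticle.T3 → ℝ), α < 2 → φmin ≤ 0 → 0 < β →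
        NParticle.Admissible φ φmin A α →
        ∀ N : ℕ, (6 : ℝ) ^ 4 / (2 - α) ^ 2 ≤ (N : ℝ) →
          (∀ᵐ Z₀ ∂(NParticle.gibbs N φ β), ∃! γ : ℝ → NParticle.Phase N,
            NParticle.IsTrajectory φ γ ∧ γ 0 = Z₀) ∧
          ∀ (ψ : ProbabilityTheory.Kernel (NParticle.Phase N) (NParticle.Phase N))
            (_ : ProbabilityTheory.IsMarkovKernel ψ) (K : ℝ), 0 < K →
            NParticle.shifted φ β ψ ≤ ENNReal.ofReal K • NParticle.gibbs N φ β →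
            ∀ ε a t : ℝ, ε ≤ 1 - α / 3 → 2 * α / 3 < a → 0 ≤ t →
              NParticle.Q φ β ψ ((N : ℝ) ^ (-ε)) t ≤
                ENNReal.ofReal
                  ((1 + (1 + K) *
                    ((C * Real.exp (-β * φmin) + Ca α a * Real.exp (-β * φmin) ^ a) / (2 - α))) * t)
                + NParticle.Q φ β ψ ((N : ℝ) ^ (-ε)) 0 := by
  have hCa : ∀ α a : ℝ, 2 * α / 3 < a → 0 < 2640 * A / (3 * a - 2 * α) := fun α a ha =>
    div_pos (by positivity) (by linarith)
  -- The term linear in `c` already bounds the mean rate. `Ca` only has to be positive and at most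
  -- `C / (3 * a - 2 * α)`, and is given that extreme value.
  refine ⟨2640 * A, by positivity, fun α a => 2640 * A / (3 * a - 2 * α),
    fun α a _ ha => ⟨hCa α a ha, le_rfl⟩, ?_⟩
  intro α φmin β φ hα2 hmin hβ hφ N hN
  refine ⟨hφ.ae_existsUnique hA.le hα2 hmin hβ, ?_⟩
  intro ψ hMarkov K hK hψ ε a t hε ha ht
  have h2 : 0 < 2 - α := by linarith
  have hN1 : 1 ≤ N := by
    have : (0 : ℝ) < N := lt_of_lt_of_le (by positivity) hN
    exact_mod_cast this
  have hδ : (0 : ℝ) < (N : ℝ) ^ (-ε) := Real.rpow_pos_of_pos (by exact_mod_cast hN1) _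
  obtain ⟨G, B, κ, L, hKer, hκ, hL, hE⟩ :=
    hφ.exists_stabilityRate_bound hA hα2 hmin hβ hN1 hε
  refine (hφ.Q_le hA.le hα2 hmin hβ hKer hκ hδ hL ψ hψ ht hE).trans ?_
  rw [add_comm]
  refine add_le_add_left ?_ _
  set c := Real.exp (-β * φmin) with hc
  have hc0 : 0 < c := Real.exp_pos _
  have hE0 : 0 ≤ 2640 * A * c / (2 - α) := by positivity
  rw [← ENNReal.ofReal_mul ht, ← ENNReal.ofReal_mul hK.le, ← ENNReal.ofReal_add (by positivity)
    (by positivity), ← ENNReal.ofReal_add ht (by positivity)]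
  refine ENNReal.ofReal_le_ofReal ?_
  -- The term with `c ^ a` is nonnegative, so adding it only weakens the bound.
  have h3 : 2640 * A * c / (2 - α) ≤
      (2640 * A * c + 2640 * A / (3 * a - 2 * α) * c ^ a) / (2 - α) := by
    have := mul_pos (hCa α a ha) (Real.rpow_pos_of_pos hc0 a)
    gcongr
    linarith
  calc t + (t * (2640 * A * c / (2 - α)) + K * (t * (2640 * A * c / (2 - α))))
      = (1 + (1 + K) * (2640 * A * c / (2 - α))) * t := by ring
    _ ≤ _ := by gcongr
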